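/- Setting. For every $n$ let $\mathbf y=\mathbf X_1\beta_1^*+\mathbf X_2\beta_2^*+\mathbf X_3\beta_3^*+\varepsilon\in\mathbb R^n$, where $\mathbf X_1,\mathbf X_2,\mathbf X_3$ are deterministic $n\times p_1$, $n\times p_2$, $n\times p_{3n}$ matrices (the columns of the design belonging to the strong signals $S_1$, the weak signals $S_2$ and the null coefficients $S_3$), $p_n=p_1+p_2+p_{3n}$, $p_1,p_2$ do not depend on $n$, the coefficients may depend on $n$, and the $\varepsilon_i$ are independent $N(0,\sigma^2)$, $\sigma>0$. Put $\Sigma_n=n^{-1}(\mathbf X_1,\mathbf X_2)'(\mathbf X_1,\mathbf X_2)$ with blocks $\Sigma_{n11},\Sigma_{n12},\Sigma_{n21},\Sigma_{n22}$, $\Sigma_{n11.2}=\Sigma_{n11}-\Sigma_{n12}\Sigma_{n22}^{-1}\Sigma_{n21}$, $\Sigma_{n22.1}=\Sigma_{n22}-\Sigma_{n21}\Sigma_{n11}^{-1}\Sigma_{n12}$, $\mathbf M_1=I_n-\mathbf X_1(\mathbf X_1'\mathbf X_1)^{-1}\mathbf X_1'$, $\mathbf U=(\mathbf X_2,\mathbf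 X_3)$. Assumptions, with constants $0<\tau<1/2$, $\tau<\eta\le1$, $0<\nu<1$: (i) for some $c_0>0$, $|\beta_j^*|>c_0\sqrt{(\log p_n)/n}$ for $j\in S_1$ and all large $n$; $\beta^*_j=\delta_j/\sqrt n$ for $j\in S_2$, with a fixed vector $\delta\in\mathbb R^{p_2}$, $|\delta_j|<\delta_{\max}$; $\beta_j^*=0$ for $j\in S_3$; (ii) the smallest positive eigenvalue $\varrho_{1n}$ of $\mathbf U'\mathbf M_1\mathbf U$ satisfies $\varrho_{1n}^{-1}=O(n^{-\eta})$; (iii) $\log p_n=O(n^\nu)$; (iv) $\Sigma_n\to\Sigma$ with $\Sigma$ positive definite; $\Sigma_{22.1}$ denotes the corresponding Schur complement of $\Sigma$. Let $a_n=c_1n^{-\alpha}$ and $r_n=c_2a_n^{-2}(\log\log n)^3\log(n\vee p_n)$ with $c_1,c_2>0$ and $0<\alpha<\min\{(\eta-\nu-\tau)/3,\ 1/4-\tau/2\}$. Estimators ($S_1$ and $S_3$ known). The weighted ridge estimator $(\hat\beta^{\rm WR}_{1n},\hat\beta^{\rm WR}_{2n})$ minimises $\|\mathbf y-\mathbf X_1b_1-\mathbf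 X_2b_2\|^2+r_n\|b_2\|^2$; the post-selection least squares estimator is $\hat\beta^{\rm RE}_{1n}=(\mathbf X_1'\mathbf X_1)^{-1}\mathbf X_1'\mathbf y$; with $\hat T_n=(\hat\beta_{2n}^{\rm WR})'\mathbf X_2'\mathbf M_1\mathbf X_2\hat\beta^{\rm WR}_{2n}/\sigma^2$ and for $p_2>2$, $$\hat\beta^{\rm SE}_{1n}=\hat\beta^{\rm WR}_{1n}-\tfrac{p_2-2}{\hat T_n}(\hat\beta^{\rm WR}_{1n}-\hat\beta^{\rm RE}_{1n}),\qquad \hat\beta^{\rm PSE}_{1n}=\hat\beta^{\rm WR}_{1n}-\Big(\tfrac{p_2-2}{\hat T_n}\wedge1\Big)(\hat\beta^{\rm WR}_{1n}-\hat\beta^{\rm RE}_{1n}).$$ Let $d_{1n}\in\mathbb R^{p_1}$ with $0<\|d_{1n}\|\le1$, $s_{1n}^2=\sigma^2d_{1n}'\Sigma_{n11.2}^{-1}d_{1n}$. The asymptotic distributional risk is ${\rm ADR}(d_{1n}'\hat\beta_{1n})=\lim_{n\to\infty}E\{[n^{1/2}s_{1n}^{-1}d_{1n}'(\hat\beta_{1n}-\beta_1^*)]^2\}$.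 Put $d_{2n}=\Sigma_{n21}\Sigma_{n11}^{-1}d_{1n}$, $s_{2n}^2=\sigma^2d_{2n}'\Sigma_{n22.1}^{-1}d_{2n}$, $Q_n(x)=x'\Sigma_{n22.1}x/\sigma^2$, and (quotients with zero denominator being read as $0$) $$c=\lim_{n\to\infty}\frac{d_{1n}'\Sigma_{n11}^{-1}d_{1n}}{d_{1n}'\Sigma_{n11.2}^{-1}d_{1n}},\qquad \Delta=\lim_{n\to\infty}\Delta_{d_{1n}},\quad \Delta_{d_{1n}}=\frac{d_{1n}'(\Sigma_{n11}^{-1}\Sigma_{n12}\delta\delta'\Sigma_{n21}\Sigma_{n11}^{-1})d_{1n}}{\sigma^2\,d_{1n}'(\Sigma_{n11}^{-1}\Sigma_{n12}\Sigma_{n22.1}^{-1}\Sigma_{n21}\Sigma_{n11}^{-1})d_{1n}},$$ $$g_1(x)=\lim_{n\to\infty}(1-c)\frac{p_2-2}{Q_n(x)}\Big[2-\frac{(p_2+2)(d_{2n}'x)^2}{s_{2n}^2Q_n(x)}\Big],$$ $$g_2(x)=\lim_{n\to\infty}\Big\{(1-c)\frac{p_2-2}{Q_n(x)}\Big[2-\frac{(p_2+2)(d_{2n}'x)^2}{s_{2n}^2Q_n(x)}\Big]I(Q_n(x)\ge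 p_2-2)+(1-c)\big[2-s_{2n}^{-2}(d_{2n}'x)^2\big]I(Q_n(x)\le p_2-2)\Big\},$$ the last two limits being taken for almost every $x\in\mathbb R^{p_2}$. Let $z_2\sim N(0,\sigma^2\Sigma_{22.1}^{-1})$. Theorem. The ADR of $d_{1n}'\hat\beta^{\rm WR}_{1n}$ exists and equals $1$. If the limit $c$ exists, then $c\le1$ and, whenever the limit that defines the right-hand side exists (for $\Delta$ this is needed only if $c<1$; if $c=1$ the first right-hand side below is $1$), $${\rm ADR}(d_{1n}'\hat\beta^{\rm RE}_{1n})=1-(1-c)(1-\Delta),$$ and, for $p_2>2$, $g_1(z_2+\delta)$ and $g_2(z_2+\delta)$ are integrable and $${\rm ADR}(d_{1n}'\hat\beta^{\rm SE}_{1n})=1-E[g_1(z_2+\delta)],\qquad {\rm ADR}(d_{1n}'\hat\beta^{\rm PSE}_{1n})=1-E[g_2(z_2+\delta)].$$ In each case the ADR exists, i.e. the expectations are finite for large $n$ and converge. -/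

import Mathlib

open Filter Topology MeasureTheory ProbabilityTheory Matrix

namespace ShrinkageRisk

/-! ### Blocks of a second-moment matrix `S = [S₁₁ S₁₂; S₂₁ S₂₂]` -/

section Blocks

variable {m k : ℕ}

/-- `S₁₁.₂ = S₁₁ - S₁₂ S₂₂⁻¹ S₂₁`. -/
noncomputable def schur11 (S : Matrix (Fin m ⊕ Fin k) (Fin m ⊕ Fin k) ℝ) :
    Matrix (Fin m) (Fin m) ℝ :=
  S.toBlocks₁₁ - S.toBlocks₁₂ * S.toBlocks₂₂⁻¹ * S.toBlocks₂₁

/-- `S₂₂.₁ = S₂₂ - S₂₁ S₁₁⁻¹ S₁₂`. -/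
noncomputable def schur22 (S : Matrix (Fin m ⊕ Fin k) (Fin m ⊕ Fin k) ℝ) :
    Matrix (Fin k) (Fin k) ℝ :=
  S.toBlocks₂₂ - S.toBlocks₂₁ * S.toBlocks₁₁⁻¹ * S.toBlocks₁₂

/-- `s₁² = σ² d₁' S₁₁.₂⁻¹ d₁`. -/
noncomputable def s1sq (σ : ℝ) (S : Matrix (Fin m ⊕ Fin k) (Fin m ⊕ Fin k) ℝ)
    (d : Fin m → ℝ) : ℝ :=
  σ ^ 2 * (d ⬝ᵥ ((schur11 S)⁻¹ *ᵥ d))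

/-- `d₂ = S₂₁ S₁₁⁻¹ d₁`. -/
noncomputable def d2 (S : Matrix (Fin m ⊕ Fin k) (Fin m ⊕ Fin k) ℝ)
    (d : Fin m → ℝ) : Fin k → ℝ :=
  S.toBlocks₂₁ *ᵥ (S.toBlocks₁₁⁻¹ *ᵥ d)

/-- `s₂² = σ² d₂' S₂₂.₁⁻¹ d₂`. -/
noncomputable def s2sq (σ : ℝ) (S : Matrix (Fin m ⊕ Fin k) (Fin m ⊕ Fin k) ℝ)
    (d : Fin m → ℝ) : ℝ :=
  σ ^ 2 * (d2 S d ⬝ᵥ ((schur22 S)⁻¹ *ᵥ d2 S d))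

/-- `d₁' S₁₁⁻¹ d₁ / (d₁' S₁₁.₂⁻¹ d₁)`, whose limit is the constant `c`. -/
noncomputable def cRatio (S : Matrix (Fin m ⊕ Fin k) (Fin m ⊕ Fin k) ℝ)
    (d : Fin m → ℝ) : ℝ :=
  (d ⬝ᵥ (S.toBlocks₁₁⁻¹ *ᵥ d)) / (d ⬝ᵥ ((schur11 S)⁻¹ *ᵥ d))

/-- `Δ_{d₁} = d₁'(S₁₁⁻¹ S₁₂ δ δ' S₂₁ S₁₁⁻¹)d₁ / (σ² d₁'(S₁₁⁻¹ S₁₂ S₂₂.₁⁻¹ S₂₁ S₁₁⁻¹)d₁)`,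
that is `(d₂'δ)² / s₂²`. -/
noncomputable def DeltaD (σ : ℝ) (S : Matrix (Fin m ⊕ Fin k) (Fin m ⊕ Fin k) ℝ)
    (δ : Fin k → ℝ) (d : Fin m → ℝ) : ℝ :=
  (d2 S d ⬝ᵥ δ) ^ 2 / s2sq σ S d

/-- `Q(x) = x' S₂₂.₁ x / σ²`. -/
noncomputable def quadForm (σ : ℝ) (S : Matrix (Fin m ⊕ Fin k) (Fin m ⊕ Fin k) ℝ)
    (x : Fin k → ℝ) : ℝ :=
  (x ⬝ᵥ (schur22 S *ᵥ x)) / σ ^ 2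

/-- The function whose limit in `n` (with `S = Σₙ`, `d = d₁ₙ`) is `g₁`. -/
noncomputable def g1Pre (σ c : ℝ) (S : Matrix (Fin m ⊕ Fin k) (Fin m ⊕ Fin k) ℝ)
    (d : Fin m → ℝ) (x : Fin k → ℝ) : ℝ :=
  (1 - c) * (((k : ℝ) - 2) / quadForm σ S x) *
    (2 - ((k : ℝ) + 2) * (d2 S d ⬝ᵥ x) ^ 2 / (s2sq σ S d * quadForm σ S x))

open Classical in
/-- The function whose limit in `n` (with `S = Σₙ`, `d = d₁ₙ`) is `g₂`. -/
noncomputable def g2Pre (σ c : ℝ) (S : Matrix (Fin m ⊕ Fin k) (Fin m ⊕ Fin k) ℝ)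
    (d : Fin m → ℝ) (x : Fin k → ℝ) : ℝ :=
  (if (k : ℝ) - 2 ≤ quadForm σ S x then g1Pre σ c S d x else 0) +
    (if quadForm σ S x ≤ (k : ℝ) - 2 then
      (2 - (d2 S d ⬝ᵥ x) ^ 2 / s2sq σ S d) * (1 - c) else 0)

end Blocks

/-! ### Sample objects and estimators, for sample size `n` -/

section Estimators

variable {n m k l : ℕ}

/-- `Σₙ = n⁻¹ Z'Z` with `Z = (X₁, X₂)`. -/
noncomputable def sampleGram (X₁ : Matrix (Fin n) (Fin m) ℝ) (X₂ : Matrix (Fin n) (Fin k) ℝ) :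
    Matrix (Fin m ⊕ Fin k) (Fin m ⊕ Fin k) ℝ :=
  (n : ℝ)⁻¹ • ((fromCols X₁ X₂)ᵀ * fromCols X₁ X₂)

/-- `M₁ = Iₙ - X₁ (X₁'X₁)⁻¹ X₁'`. -/
noncomputable def residualProj (X₁ : Matrix (Fin n) (Fin m) ℝ) : Matrix (Fin n) (Fin n) ℝ :=
  1 - X₁ * (X₁ᵀ * X₁)⁻¹ * X₁ᵀ

/-- `U' M₁ U` with `U = (X₂, X₃)`. -/
noncomputable def redundantGram (X₁ : Matrix (Fin n) (Fin m) ℝ) (X₂ : Matrix (Fin n) (Fin k) ℝ)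
    (X₃ : Matrix (Fin n) (Fin l) ℝ) : Matrix (Fin k ⊕ Fin l) (Fin k ⊕ Fin l) ℝ :=
  (fromCols X₂ X₃)ᵀ * residualProj X₁ * fromCols X₂ X₃

/-- The response `y = X₁ β₁ + X₂ β₂ + X₃ β₃ + ε`. -/
def response (X₁ : Matrix (Fin n) (Fin m) ℝ) (X₂ : Matrix (Fin n) (Fin k) ℝ)
    (X₃ : Matrix (Fin n) (Fin l) ℝ) (β₁ : Fin m → ℝ) (β₂ : Fin k → ℝ) (β₃ : Fin l → ℝ)
    (e : Fin n → ℝ) : Fin n → ℝ :=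
  X₁ *ᵥ β₁ + X₂ *ᵥ β₂ + X₃ *ᵥ β₃ + e

/-- The post-selection least squares estimator `(X₁'X₁)⁻¹ X₁' y`. -/
noncomputable def estRE (X₁ : Matrix (Fin n) (Fin m) ℝ) (y : Fin n → ℝ) : Fin m → ℝ :=
  (X₁ᵀ * X₁)⁻¹ *ᵥ (X₁ᵀ *ᵥ y)

/-- The loss `‖y - X₁ b₁ - X₂ b₂‖² + r ‖b₂‖²`. -/
def ridgeLoss (X₁ : Matrix (Fin n) (Fin m) ℝ) (X₂ : Matrix (Fin n) (Fin k) ℝ) (r : ℝ)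
    (y : Fin n → ℝ) (b : (Fin m → ℝ) × (Fin k → ℝ)) : ℝ :=
  ∑ i, (y i - (X₁ *ᵥ b.1) i - (X₂ *ᵥ b.2) i) ^ 2 + r * ∑ j, b.2 j ^ 2

/-- The weighted ridge estimator `(β̂₁, β̂₂)`: a minimiser of the loss (it is the unique one as soon
as `r > 0` and `X₁` has full column rank, and arbitrary if there is none). -/
noncomputable def estWR (X₁ : Matrix (Fin n) (Fin m) ℝ) (X₂ : Matrix (Fin n) (Fin k) ℝ) (r : ℝ)
    (y : Fin n → ℝ) : (Fin m → ℝ) × (Fin k → ℝ) :=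
  Classical.epsilon fun b => ∀ b', ridgeLoss X₁ X₂ r y b ≤ ridgeLoss X₁ X₂ r y b'

/-- `T̂ = β̂₂' (X₂' M₁ X₂) β̂₂ / σ²` with `β̂₂` the weighted ridge estimator. -/
noncomputable def statT (σ : ℝ) (X₁ : Matrix (Fin n) (Fin m) ℝ) (X₂ : Matrix (Fin n) (Fin k) ℝ)
    (r : ℝ) (y : Fin n → ℝ) : ℝ :=
  ((estWR X₁ X₂ r y).2 ⬝ᵥ ((X₂ᵀ * residualProj X₁ * X₂) *ᵥ (estWR X₁ X₂ r y).2)) / σ ^ 2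

/-- The shrinkage estimator. -/
noncomputable def estSE (σ : ℝ) (X₁ : Matrix (Fin n) (Fin m) ℝ) (X₂ : Matrix (Fin n) (Fin k) ℝ)
    (r : ℝ) (y : Fin n → ℝ) : Fin m → ℝ :=
  (estWR X₁ X₂ r y).1 -
    (((k : ℝ) - 2) / statT σ X₁ X₂ r y) • ((estWR X₁ X₂ r y).1 - estRE X₁ y)

/-- The positive shrinkage estimator. -/
noncomputable def estPSE (σ : ℝ) (X₁ : Matrix (Fin n) (Fin m) ℝ) (X₂ : Matrix (Fin n) (Fin k) ℝ)
    (r : ℝ) (y : Fin n → ℝ) : Fin m → ℝ :=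
  (estWR X₁ X₂ r y).1 -
    (min (((k : ℝ) - 2) / statT σ X₁ X₂ r y) 1) • ((estWR X₁ X₂ r y).1 - estRE X₁ y)

end Estimators

/-! ### Tuning parameters, assumptions and risk -/

/-- Threshold level `aₙ = c₁ n^{-α}`. -/
noncomputable def thresholdLevel (c₁ α : ℝ) (n : ℕ) : ℝ := c₁ * (n : ℝ) ^ (-α)

/-- Ridge parameter `rₙ = c₂ aₙ⁻² (log log n)³ log (n ∨ pₙ)`. -/
noncomputable def ridgeParam (c₁ c₂ α : ℝ) (p : ℕ → ℕ) (n : ℕ) : ℝ :=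
  c₂ * (thresholdLevel c₁ α n ^ 2)⁻¹ * Real.log (Real.log n) ^ 3 *
    Real.log (max n (p n) : ℕ)

/-- Strong signals: `|β_j| > c √(log pₙ / n)` on the first block, for some `c > 0`. -/
def StrongSignals {m : ℕ} (p : ℕ → ℕ) (β₁ : ℕ → Fin m → ℝ) : Prop :=
  ∃ c : ℝ, 0 < c ∧ ∀ᶠ n : ℕ in atTop, ∀ j, c * √(Real.log (p n) / n) < |β₁ n j|

/-- Local weak signals: `β_j = δ_j / √n` on the second block, `|δ_j| < δ_max`. -/
def LocalSignals {k : ℕ} (δ : Fin k → ℝ) (β₂ : ℕ → Fin k → ℝ) : Prop :=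
  (∃ δmax : ℝ, 0 < δmax ∧ ∀ j, |δ j| < δmax) ∧ ∀ᶠ n : ℕ in atTop, ∀ j, β₂ n j = δ j / √(n : ℝ)

/-- No signal on the third block. -/
def NoSignals (l : ℕ → ℕ) (β₃ : ∀ n, Fin (l n) → ℝ) : Prop :=
  ∀ᶠ n : ℕ in atTop, ∀ j, β₃ n j = 0

/-- The smallest positive eigenvalue `ϱ₁ₙ` of `Gₙ` satisfies `ϱ₁ₙ⁻¹ = O(n^{-η})`. -/
def PositiveEigenvaluesGrow {ι : ℕ → Type} [∀ n, Fintype (ι n)] [∀ n, DecidableEq (ι n)]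
    (G : ∀ n, Matrix (ι n) (ι n) ℝ) (η : ℝ) : Prop :=
  ∃ K : ℝ, ∀ᶠ n : ℕ in atTop, ∀ ϱ : ℝ, 0 < ϱ →
    Module.End.HasEigenvalue (Matrix.toLin' (G n)) ϱ → ϱ⁻¹ ≤ K * (n : ℝ) ^ (-η)

/-- For each `n` the errors are independent `N(0, σ²)`. -/
def GaussianErrors {Ω : Type*} [MeasurableSpace Ω] (P : Measure Ω) (σ : ℝ)
    (ε : ∀ n : ℕ, Fin n → Ω → ℝ) : Prop :=
  ∀ n, iIndepFun (ε n) P ∧ ∀ i, HasLaw (ε n i) (gaussianReal 0 ⟨σ ^ 2, sq_nonneg σ⟩) P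

/-- The asymptotic distributional risk of `d₁ₙ' β̂₁ₙ` exists and equals `ℓ`: the expectations of
`[n^{1/2} s₁ₙ⁻¹ d₁ₙ'(β̂₁ₙ - β₁)]²` are eventually finite and converge to `ℓ`. -/
def HasADR {Ω : Type*} [MeasurableSpace Ω] (P : Measure Ω) {m : ℕ}
    (s₁sq : ℕ → ℝ) (d β₁ : ℕ → Fin m → ℝ) (est : ℕ → Ω → Fin m → ℝ) (ℓ : ℝ) : Prop :=
  (∀ᶠ n : ℕ in atTop,
    Integrable (fun ω => (√(n : ℝ) * (√(s₁sq n))⁻¹ * (d n ⬝ᵥ (est n ω - β₁ n))) ^ 2) P) ∧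
  Tendsto (fun n : ℕ =>
    ∫ ω, (√(n : ℝ) * (√(s₁sq n))⁻¹ * (d n ⬝ᵥ (est n ω - β₁ n))) ^ 2 ∂P) atTop (𝓝 ℓ)

end ShrinkageRisk

/-!
The proof is an exact finite-sample decomposition followed by dominated convergence.

Put `w = √n β̂₂` for the weighted ridge estimator `β̂₂`. As soon as the Gram matrix is positive
definite, the normal equations (`estWR_eq`) show that `√n d₁'(β̂₁ - β₁)` equals, for each of the
four estimators, a linear form `a'ε` plus a function of `w` alone (`sqrt_mul_estRE`,
`sqrt_mul_shrink`). Here `a` lies in the column space of `X₁`, while `w` depends on the errors only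
through `M₁ ε`. So the two terms are independent, `w` is Gaussian, and after division by `s₁` the
second moment of the sum is `cRatio + E[F(w)²]` (`second_moment_split`, `RegularDesign.hasADR`).
Since `r / n → 0`, the law of `w` tends to `N(δ, σ² S₂₂.₁⁻¹)`. For the ridge and the post-selection
estimator `F` is affine or constant and the second moment is explicit.

For the two shrinkage estimators `F(w) = f'(δ - w) + (a / max Q(w) b) f'w` with `f = s₁⁻¹ d₂`,
`a = p₂ - 2` and `b = 0` or `b = a`. In dimension at least three `‖w‖⁻²` is integrable against
Gaussian densities, uniformly along the sequence, so the law of `w` and the matrix of `Q` may be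
replaced by their limits inside the integral (`tendsto_integral_gaussDensity_sub`). The vector `f`
need not converge, only the integrands have to come close. Under the limiting law Stein's identity
(`stein_max`, obtained by integration by parts for a smooth approximation of `max`) turns the risk
into `f'K⁻¹f` minus the integral of `riskGain`, and the gain is asymptotically the function whose
limit defines `g₁` or `g₂` (`tendsto_riskGain_of_lt`, `tendsto_riskGain_of_gt`). Its quotients by
`s₂²`, which may vanish, are controlled by the identity `1 - c = s₂² / s₁²` at sample size `n` and
the bound `κ ‖f‖² ≤ 1 - c` (`tendsto_contrast_sub`).
-/

namespace ShrinkageRisk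

/-! ### Schur complements -/

section SchurComplements

variable {m k : ℕ} {S : Matrix (Fin m ⊕ Fin k) (Fin m ⊕ Fin k) ℝ}

lemma posDef_toBlocks₁₁ (hS : S.PosDef) : S.toBlocks₁₁.PosDef :=
  hS.submatrix Sum.inl_injective

lemma posDef_toBlocks₂₂ (hS : S.PosDef) : S.toBlocks₂₂.PosDef :=
  hS.submatrix Sum.inr_injective

lemma transpose_toBlocks₁₂ (hS : S.IsHermitian) : S.toBlocks₁₂ᵀ = S.toBlocks₂₁ := by
  ext i j
  have := congrFun (congrFun hS (Sum.inr i)) (Sum.inl j)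
  simpa [toBlocks₁₂, toBlocks₂₁, conjTranspose_apply] using this

lemma posDef_schur22 (hS : S.PosDef) : (schur22 S).PosDef := by
  have hA := posDef_toBlocks₁₁ hS
  have := hA.isUnit.invertible
  have hB := transpose_toBlocks₁₂ hS.isHermitian
  have hS' : S = fromBlocks S.toBlocks₁₁ S.toBlocks₁₂ S.toBlocks₁₂ᴴ S.toBlocks₂₂ := by
    rw [conjTranspose_eq_transpose_of_trivial, hB, fromBlocks_toBlocks]
  have hpsd : (schur22 S).PosSemidef := by
    have h := (PosDef.fromBlocks₁₁ S.toBlocks₁₂ S.toBlocks₂₂ hA).1 (hS' ▸ hS.posSemidef)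
    rwa [conjTranspose_eq_transpose_of_trivial, hB] at h
  refine .of_dotProduct_mulVec_pos hpsd.isHermitian fun x hx => ?_
  -- evaluate the form of `S` at `(-S₁₁⁻¹ S₁₂ x, x)`, where it equals the form of `S₂₂.₁` at `x`
  have h := schur_complement_eq₁₁ S.toBlocks₁₂ S.toBlocks₂₂
    (-((S.toBlocks₁₁⁻¹ * S.toBlocks₁₂) *ᵥ x)) x hA.isHermitian
  rw [← hS', neg_add_cancel, dotProduct_zero, zero_add, conjTranspose_eq_transpose_of_trivial,
    hB] at h
  have hne : (-((S.toBlocks₁₁⁻¹ * S.toBlocks₁₂) *ᵥ x)) ⊕ᵥ x ≠ 0 := fun h0 =>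
    hx (funext fun i => congrFun h0 (Sum.inr i))
  have hpos := hS.dotProduct_mulVec_pos hne
  rw [dotProduct_mulVec, h, ← dotProduct_mulVec] at hpos
  exact hpos

/-- The upper left block of `S⁻¹`, from Woodbury's identity. -/
lemma inv_schur11 (hS : S.PosDef) :
    (schur11 S)⁻¹ = S.toBlocks₁₁⁻¹ +
      S.toBlocks₁₁⁻¹ * S.toBlocks₁₂ * (schur22 S)⁻¹ * S.toBlocks₂₁ * S.toBlocks₁₁⁻¹ := by
  have h1 := (posDef_toBlocks₁₁ hS).isUnit
  have h2 := (posDef_toBlocks₂₂ hS).isUnit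
  have h3 := (posDef_schur22 hS).isUnit
  have hd := (isUnit_iff_isUnit_det _).1 h2
  have e : (-(S.toBlocks₂₂⁻¹))⁻¹ + S.toBlocks₂₁ * S.toBlocks₁₁⁻¹ * S.toBlocks₁₂ =
      -(schur22 S) := by
    have : (-(S.toBlocks₂₂⁻¹))⁻¹ = -S.toBlocks₂₂ := by
      apply inv_eq_right_inv
      rw [neg_mul_neg, nonsing_inv_mul _ hd]
    rw [this, schur22]; abel
  have e' : (-(schur22 S))⁻¹ = -(schur22 S)⁻¹ := by
    apply inv_eq_right_inv
    rw [neg_mul_neg, mul_nonsing_inv _ ((isUnit_iff_isUnit_det _).1 h3)]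
  have key := add_mul_mul_inv_eq_sub (A := S.toBlocks₁₁) (U := S.toBlocks₁₂)
    (C := -(S.toBlocks₂₂⁻¹)) (V := S.toBlocks₂₁) h1
    ((isUnit_nonsing_inv_iff.2 h2).neg) (by rw [e]; exact h3.neg)
  rw [e, e'] at key
  simp only [Matrix.mul_neg, Matrix.neg_mul, sub_neg_eq_add, ← sub_eq_add_neg] at key
  exact key

lemma dotProduct_inv_toBlocks₁₁ (hS : S.PosDef) (d : Fin m → ℝ) (z : Fin k → ℝ) :
    d ⬝ᵥ (S.toBlocks₁₁⁻¹ *ᵥ (S.toBlocks₁₂ *ᵥ z)) = d2 S d ⬝ᵥ z := by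
  have h1 : (S.toBlocks₁₁⁻¹)ᵀ = S.toBlocks₁₁⁻¹ := by
    rw [transpose_nonsing_inv]
    congr 1
    exact (posDef_toBlocks₁₁ hS).isHermitian
  rw [d2, dotProduct_mulVec, dotProduct_mulVec, ← mulVec_transpose, ← mulVec_transpose, h1,
    transpose_toBlocks₁₂ hS.isHermitian]

lemma s1sq_eq (σ : ℝ) (hS : S.PosDef) (d : Fin m → ℝ) :
    s1sq σ S d = σ ^ 2 * (d ⬝ᵥ (S.toBlocks₁₁⁻¹ *ᵥ d)) + s2sq σ S d := by
  rw [s1sq, s2sq, inv_schur11 hS, add_mulVec, dotProduct_add, mul_add,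
    ← dotProduct_inv_toBlocks₁₁ hS]
  simp only [d2, mulVec_mulVec, Matrix.mul_assoc]

lemma s1sq_pos {σ : ℝ} (hσ : 0 < σ) (hS : S.PosDef) {d : Fin m → ℝ} (hd : d ≠ 0) :
    0 < s1sq σ S d := by
  rw [s1sq_eq σ hS]
  have h1 := (posDef_toBlocks₁₁ hS).inv.dotProduct_mulVec_pos hd
  have h2 := (posDef_schur22 hS).inv.posSemidef.dotProduct_mulVec_nonneg (d2 S d)
  simp only [star_trivial] at h1 h2
  rw [s2sq]
  positivity

lemma s2sq_nonneg (σ : ℝ) (hS : S.PosDef) (d : Fin m → ℝ) : 0 ≤ s2sq σ S d := by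
  have h2 := (posDef_schur22 hS).inv.posSemidef.dotProduct_mulVec_nonneg (d2 S d)
  simp only [star_trivial] at h2
  rw [s2sq]
  positivity

lemma cRatio_eq {σ : ℝ} (hσ : 0 < σ) (S : Matrix (Fin m ⊕ Fin k) (Fin m ⊕ Fin k) ℝ)
    (d : Fin m → ℝ) :
    cRatio S d = σ ^ 2 * (d ⬝ᵥ (S.toBlocks₁₁⁻¹ *ᵥ d)) / s1sq σ S d := by
  rw [cRatio, s1sq, mul_div_mul_left _ _ (by positivity)]

/-- The share of the asymptotic variance that the redundant block accounts for. -/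
lemma one_sub_cRatio {σ : ℝ} (hσ : 0 < σ) (hS : S.PosDef) {d : Fin m → ℝ} (hd : d ≠ 0) :
    1 - cRatio S d = s2sq σ S d / s1sq σ S d := by
  have h := s1sq_pos hσ hS hd
  rw [cRatio_eq hσ, eq_div_iff h.ne', sub_mul, div_mul_cancel₀ _ h.ne', s1sq_eq σ hS]
  ring

end SchurComplements

/-! ### Closed forms of the estimators -/

section ClosedForms

variable {n m k : ℕ} {X₁ : Matrix (Fin n) (Fin m) ℝ} {X₂ : Matrix (Fin n) (Fin k) ℝ}

lemma residualProj_transpose (X₁ : Matrix (Fin n) (Fin m) ℝ) :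
    (residualProj X₁)ᵀ = residualProj X₁ := by
  simp [residualProj, transpose_mul, transpose_nonsing_inv, Matrix.mul_assoc]

lemma residualProj_mul_self (h : (X₁ᵀ * X₁).PosDef) : residualProj X₁ * X₁ = 0 := by
  have hd := (isUnit_iff_isUnit_det _).1 h.isUnit
  rw [residualProj, Matrix.sub_mul, Matrix.one_mul, Matrix.mul_assoc, Matrix.mul_assoc,
    nonsing_inv_mul _ hd, Matrix.mul_one, sub_self]

lemma transpose_mul_residualProj (h : (X₁ᵀ * X₁).PosDef) : X₁ᵀ * residualProj X₁ = 0 := by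
  rw [← transpose_inj, transpose_mul, residualProj_transpose, transpose_transpose,
    residualProj_mul_self h, transpose_zero]

lemma residualProj_idem (h : (X₁ᵀ * X₁).PosDef) :
    residualProj X₁ * residualProj X₁ = residualProj X₁ := by
  nth_rw 2 [residualProj]
  rw [Matrix.mul_sub, Matrix.mul_one, ← Matrix.mul_assoc, ← Matrix.mul_assoc,
    residualProj_mul_self h]
  simp

lemma posSemidef_residualGram (h : (X₁ᵀ * X₁).PosDef) :
    (X₂ᵀ * residualProj X₁ * X₂).PosSemidef := by
  have : X₂ᵀ * residualProj X₁ * X₂ = (residualProj X₁ * X₂)ᴴ * (residualProj X₁ * X₂) := by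
    rw [conjTranspose_eq_transpose_of_trivial, transpose_mul, residualProj_transpose,
      Matrix.mul_assoc, Matrix.mul_assoc, ← Matrix.mul_assoc (residualProj X₁), residualProj_idem h]
  rw [this]
  exact posSemidef_conjTranspose_mul_self _

/-- Completing the square in the ridge loss at a point `c` that solves the normal equations. -/
lemma ridgeLoss_eq_add {r : ℝ} {y : Fin n → ℝ} {c : (Fin m → ℝ) × (Fin k → ℝ)}
    (h1 : X₁ᵀ *ᵥ (y - X₁ *ᵥ c.1 - X₂ *ᵥ c.2) = 0)
    (h2 : X₂ᵀ *ᵥ (y - X₁ *ᵥ c.1 - X₂ *ᵥ c.2) = r • c.2) (b : (Fin m → ℝ) × (Fin k → ℝ)) :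
    ridgeLoss X₁ X₂ r y b = ridgeLoss X₁ X₂ r y c +
      ((X₁ *ᵥ (b.1 - c.1) + X₂ *ᵥ (b.2 - c.2)) ⬝ᵥ (X₁ *ᵥ (b.1 - c.1) + X₂ *ᵥ (b.2 - c.2)) +
        r * ((b.2 - c.2) ⬝ᵥ (b.2 - c.2))) := by
  have key (b : (Fin m → ℝ) × (Fin k → ℝ)) : ridgeLoss X₁ X₂ r y b =
      (y - X₁ *ᵥ b.1 - X₂ *ᵥ b.2) ⬝ᵥ (y - X₁ *ᵥ b.1 - X₂ *ᵥ b.2) + r * (b.2 ⬝ᵥ b.2) := by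
    simp [ridgeLoss, dotProduct, sq]
  rw [key, key]
  set e := y - X₁ *ᵥ c.1 - X₂ *ᵥ c.2 with he
  set u := b.1 - c.1
  set v := b.2 - c.2 with hv
  have e1 : y - X₁ *ᵥ b.1 - X₂ *ᵥ b.2 = e - (X₁ *ᵥ u + X₂ *ᵥ v) := by
    simp only [e, u, v, mulVec_sub]; abel
  have e2 : b.2 = c.2 + v := by simp [v]
  have e3 : e ⬝ᵥ (X₁ *ᵥ u) = 0 := by
    rw [dotProduct_mulVec, ← mulVec_transpose, h1, zero_dotProduct]
  have e4 : e ⬝ᵥ (X₂ *ᵥ v) = r * (c.2 ⬝ᵥ v) := by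
    rw [dotProduct_mulVec, ← mulVec_transpose, h2, smul_dotProduct, smul_eq_mul]
  rw [e1, e2]
  generalize X₁ *ᵥ u = p at *
  generalize X₂ *ᵥ v = q at *
  simp only [sub_dotProduct, dotProduct_sub, dotProduct_add, add_dotProduct, e3, e4,
    dotProduct_comm p e, dotProduct_comm q e, dotProduct_comm v c.2, dotProduct_comm q p]
  ring

/-- For `r > 0` and `X₁` of full column rank the ridge estimator is the unique solution of the
normal equations, with the first block profiled out. -/
lemma estWR_eq (h : (X₁ᵀ * X₁).PosDef) {r : ℝ} (hr : 0 < r) (y : Fin n → ℝ) :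
    (estWR X₁ X₂ r y).2 =
        (X₂ᵀ * residualProj X₁ * X₂ + r • 1)⁻¹ *ᵥ (X₂ᵀ *ᵥ (residualProj X₁ *ᵥ y)) ∧
      (estWR X₁ X₂ r y).1 =
        estRE X₁ y - (X₁ᵀ * X₁)⁻¹ *ᵥ (X₁ᵀ *ᵥ (X₂ *ᵥ (estWR X₁ X₂ r y).2)) := by
  have hd := (isUnit_iff_isUnit_det _).1 h.isUnit
  have hG : (X₂ᵀ * residualProj X₁ * X₂ + r • (1 : Matrix (Fin k) (Fin k) ℝ)).PosDef :=
    PosDef.posSemidef_add (posSemidef_residualGram h) (PosDef.one.smul hr)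
  have hGd := (isUnit_iff_isUnit_det _).1 hG.isUnit
  set c₂ := (X₂ᵀ * residualProj X₁ * X₂ + r • 1)⁻¹ *ᵥ (X₂ᵀ *ᵥ (residualProj X₁ *ᵥ y)) with hc₂
  set c₁ := estRE X₁ y - (X₁ᵀ * X₁)⁻¹ *ᵥ (X₁ᵀ *ᵥ (X₂ *ᵥ c₂)) with hc₁
  have hres : y - X₁ *ᵥ c₁ - X₂ *ᵥ c₂ = residualProj X₁ *ᵥ (y - X₂ *ᵥ c₂) := by
    simp only [hc₁, estRE, residualProj, sub_mulVec, one_mulVec, mulVec_sub, mulVec_mulVec,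
      Matrix.mul_assoc, Matrix.sub_mul, Matrix.one_mul]
    abel
  have h1 : X₁ᵀ *ᵥ (y - X₁ *ᵥ c₁ - X₂ *ᵥ c₂) = 0 := by
    rw [hres, mulVec_mulVec, transpose_mul_residualProj h, zero_mulVec]
  have h2 : X₂ᵀ *ᵥ (y - X₁ *ᵥ c₁ - X₂ *ᵥ c₂) = r • c₂ := by
    have : (X₂ᵀ * residualProj X₁ * X₂ + r • 1) *ᵥ c₂ = X₂ᵀ *ᵥ (residualProj X₁ *ᵥ y) := by
      rw [hc₂, mulVec_mulVec, mul_nonsing_inv _ hGd, one_mulVec]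
    rw [add_mulVec, smul_mulVec, one_mulVec] at this
    rw [hres, mulVec_sub, mulVec_sub, ← this]
    simp only [mulVec_mulVec, Matrix.mul_assoc]
    abel
  have hmin := fun b => ridgeLoss_eq_add (c := (c₁, c₂)) h1 h2 b
  have hnn (b : (Fin m → ℝ) × (Fin k → ℝ)) :
      0 ≤ (X₁ *ᵥ (b.1 - c₁) + X₂ *ᵥ (b.2 - c₂)) ⬝ᵥ (X₁ *ᵥ (b.1 - c₁) + X₂ *ᵥ (b.2 - c₂)) ∧
      0 ≤ (b.2 - c₂) ⬝ᵥ (b.2 - c₂) := by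
    constructor <;> exact Finset.sum_nonneg fun i _ => mul_self_nonneg _
  have hspec : ∀ b', ridgeLoss X₁ X₂ r y (estWR X₁ X₂ r y) ≤ ridgeLoss X₁ X₂ r y b' := by
    apply Classical.epsilon_spec
      (p := fun b => ∀ b', ridgeLoss X₁ X₂ r y b ≤ ridgeLoss X₁ X₂ r y b')
    refine ⟨(c₁, c₂), fun b => ?_⟩
    rw [hmin b]
    have := hnn b
    have := mul_nonneg hr.le this.2
    simp only
    linarith
  have hle := hspec (c₁, c₂)
  set b := estWR X₁ X₂ r y
  rw [hmin b] at hle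
  obtain ⟨n1, n2⟩ := hnn b
  have n3 := mul_nonneg hr.le n2
  simp only at hle
  have z2 : (b.2 - c₂) ⬝ᵥ (b.2 - c₂) = 0 := by
    have : r * ((b.2 - c₂) ⬝ᵥ (b.2 - c₂)) = 0 := by linarith
    exact (mul_eq_zero.1 this).resolve_left hr.ne'
  have hb2 : b.2 = c₂ := sub_eq_zero.1 (dotProduct_self_eq_zero.1 z2)
  refine ⟨hb2, ?_⟩
  have z1 : (X₁ *ᵥ (b.1 - c₁) + X₂ *ᵥ (b.2 - c₂)) ⬝ᵥ (X₁ *ᵥ (b.1 - c₁) + X₂ *ᵥ (b.2 - c₂)) = 0 := by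
    linarith
  rw [dotProduct_self_eq_zero, hb2, sub_self, mulVec_zero, add_zero] at z1
  have z3 := congrArg (fun v => (X₁ᵀ * X₁)⁻¹ *ᵥ (X₁ᵀ *ᵥ v)) z1
  simp only [mulVec_mulVec, ← Matrix.mul_assoc, mulVec_zero] at z3
  rw [Matrix.mul_assoc, nonsing_inv_mul _ hd, one_mulVec] at z3
  rw [hb2, ← hc₁]
  exact sub_eq_zero.1 z3

end ClosedForms

/-! ### Gaussian densities -/

section GaussianDensities

/-- The quadratic form `x ↦ x' K x` of a matrix on Euclidean space. -/
noncomputable def matQuad {k : ℕ} (K : Matrix (Fin k) (Fin k) ℝ) (x : EuclideanSpace ℝ (Fin k)) :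
    ℝ :=
  x.ofLp ⬝ᵥ (K *ᵥ x.ofLp)

/-- The density of the Gaussian law with mean `μ` and precision matrix (inverse covariance) `K`. -/
noncomputable def gaussDensity {k : ℕ} (K : Matrix (Fin k) (Fin k) ℝ)
    (μ x : EuclideanSpace ℝ (Fin k)) : ℝ :=
  (2 * Real.pi) ^ (-(k / 2 : ℝ)) * √K.det * Real.exp (-(matQuad K (x - μ) / 2))

variable {k : ℕ}

lemma continuous_matQuad (K : Matrix (Fin k) (Fin k) ℝ) : Continuous (matQuad K) := by
  unfold matQuad; fun_prop

lemma dot_self_eq (x : EuclideanSpace ℝ (Fin k)) : x.ofLp ⬝ᵥ x.ofLp = ‖x‖ ^ 2 := by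
  rw [EuclideanSpace.real_norm_sq_eq]; simp [dotProduct, sq]

/-- Both measures have the same characteristic function. -/
lemma stdGaussian_eq_withDensity :
    stdGaussian (EuclideanSpace ℝ (Fin k)) =
      volume.withDensity fun x => ENNReal.ofReal
        ((2 * Real.pi) ^ (-(k / 2 : ℝ)) * Real.exp (-(‖x‖ ^ 2 / 2))) := by
  have hpos : (0 : ℝ) < (2 * Real.pi) ^ (-(k / 2 : ℝ)) := by positivity
  have hint : Integrable (fun x : EuclideanSpace ℝ (Fin k) =>
      (2 * Real.pi) ^ (-(k / 2 : ℝ)) * Real.exp (-(‖x‖ ^ 2 / 2))) := by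
    refine Integrable.const_mul ?_ _
    have := GaussianFourier.integrable_cexp_neg_mul_sq_norm_add_of_euclideanSpace
      (ι := Fin k) (b := 1/2) (by norm_num) 0 0
    refine this.norm.congr (.of_forall fun x => ?_)
    simp only [Complex.norm_exp]
    congr 1
    simp [← Complex.ofReal_pow]
    ring
  have : IsFiniteMeasure (volume.withDensity fun x : EuclideanSpace ℝ (Fin k) => ENNReal.ofReal
        ((2 * Real.pi) ^ (-(k / 2 : ℝ)) * Real.exp (-(‖x‖ ^ 2 / 2)))) :=
    isFiniteMeasure_withDensity_ofReal hint.2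
  apply Measure.ext_of_charFun
  ext t
  rw [charFun_stdGaussian, charFun_apply,
    integral_withDensity_eq_integral_toReal_smul (by fun_prop) (by simp)]
  have h := GaussianFourier.integral_cexp_neg_mul_sq_norm_add_of_euclideanSpace
      (ι := Fin k) (b := 1/2) (by norm_num) Complex.I t
  have : ∀ x : EuclideanSpace ℝ (Fin k), (ENNReal.ofReal
        ((2 * Real.pi) ^ (-(k / 2 : ℝ)) * Real.exp (-(‖x‖ ^ 2 / 2)))).toReal •
          Complex.exp (inner ℝ x t * Complex.I) =
      ((2 * Real.pi) ^ (-(k / 2 : ℝ)) : ℝ) *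
        Complex.exp (-(1/2) * ‖x‖ ^ 2 + Complex.I * inner ℝ t x) := by
    intro x
    rw [ENNReal.toReal_ofReal (by positivity), Complex.real_smul, Complex.ofReal_mul, mul_assoc,
      Complex.ofReal_exp, ← Complex.exp_add, real_inner_comm]
    congr 2
    push_cast
    ring
  simp_rw [this]
  rw [integral_const_mul, h, ← mul_assoc]
  have e : (((2 * Real.pi) ^ (-(k / 2 : ℝ)) : ℝ) : ℂ) *
      (Real.pi / (1/2)) ^ (Fintype.card (Fin k) / 2 : ℂ) = 1 := by
    have : (Real.pi / (1/2) : ℂ) = ((2 * Real.pi : ℝ) : ℂ) := by push_cast; ring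
    rw [this, Fintype.card_fin]
    have : ((k : ℂ) / 2) = ((k / 2 : ℝ) : ℂ) := by push_cast; ring
    rw [this, ← Complex.ofReal_cpow (by positivity), ← Complex.ofReal_mul,
      Real.rpow_neg (by positivity), inv_mul_cancel₀ (by positivity), Complex.ofReal_one]
  rw [e, one_mul]
  congr 1
  rw [Complex.I_sq]
  ring

lemma continuous_gaussDensity (K : Matrix (Fin k) (Fin k) ℝ) (μ : EuclideanSpace ℝ (Fin k)) :
    Continuous (gaussDensity K μ) := by
  unfold gaussDensity
  have := continuous_matQuad K
  fun_prop

lemma gaussDensity_nonneg (K : Matrix (Fin k) (Fin k) ℝ) (μ x : EuclideanSpace ℝ (Fin k)) :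
    0 ≤ gaussDensity K μ x := by
  unfold gaussDensity; positivity

open scoped MatrixOrder in
theorem multivariateGaussian_eq_withDensity {V : Matrix (Fin k) (Fin k) ℝ} (hV : V.PosDef)
    (μ : EuclideanSpace ℝ (Fin k)) :
    multivariateGaussian μ V =
      volume.withDensity fun x => ENNReal.ofReal (gaussDensity V⁻¹ μ x) := by
  -- the law is the image of the standard Gaussian under `x ↦ μ + L x` with `L = √V`
  set L := CFC.sqrt V with hL
  have hLL : L * L = V := CFC.sqrt_mul_sqrt_self V hV.posSemidef.nonneg
  have hLs : Lᵀ = L := (CFC.sqrt_nonneg V).posSemidef.isHermitian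
  have hdet : L.det * L.det = V.det := by rw [← det_mul, hLL]
  have hdet0 : L.det ≠ 0 := by
    intro h
    rw [h, zero_mul] at hdet
    exact hV.det_pos.ne hdet
  set A : EuclideanSpace ℝ (Fin k) →ₗ[ℝ] EuclideanSpace ℝ (Fin k) := L.toLpLin 2 2 with hA
  have hAdet : LinearMap.det A = L.det := LinearMap.det_toLpLin 2 L
  have hAL (x : EuclideanSpace ℝ (Fin k)) : toEuclideanCLM (𝕜 := ℝ) L x = A x := by
    ext i; simp [hA, ofLp_toLpLin]
  have hAc : Continuous A := A.continuous_of_finiteDimensional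
  have hquad (x : EuclideanSpace ℝ (Fin k)) : matQuad V⁻¹ (A x) = ‖x‖ ^ 2 := by
    have hu := (Matrix.isUnit_iff_isUnit_det L).2 hdet0.isUnit
    have : L * (V⁻¹ * L) = 1 := by
      rw [← hLL, Matrix.mul_inv_rev, Matrix.mul_assoc, nonsing_inv_mul _ hdet0.isUnit,
        Matrix.mul_one, mul_nonsing_inv _ hdet0.isUnit]
    rw [← dot_self_eq, matQuad, hA, ofLp_toLpLin]
    simp only [toLin'_apply]
    rw [dotProduct_comm, dotProduct_mulVec, ← mulVec_transpose, hLs, mulVec_mulVec, mulVec_mulVec,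
      Matrix.mul_assoc, this, one_mulVec]
  rw [multivariateGaussian, stdGaussian_eq_withDensity]
  have hmeas : Measurable fun x : EuclideanSpace ℝ (Fin k) =>
      μ + toEuclideanCLM (𝕜 := ℝ) (CFC.sqrt V) x := by fun_prop
  have hmap : (volume : Measure (EuclideanSpace ℝ (Fin k))).map
      (fun x => μ + toEuclideanCLM (𝕜 := ℝ) (CFC.sqrt V) x) =
      ENNReal.ofReal |L.det⁻¹| • volume := by
    have : (fun x => μ + toEuclideanCLM (𝕜 := ℝ) (CFC.sqrt V) x) = (fun x => μ + x) ∘ A := by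
      ext1 x; simp [← hL, hAL]
    rw [this, ← Measure.map_map (by fun_prop) hAc.measurable,
      Measure.map_linearMap_addHaar_eq_smul_addHaar _ (by rwa [hAdet]), hAdet, Measure.map_smul,
      map_add_left_eq_self]
  have hgm : Measurable fun x => ENNReal.ofReal (gaussDensity V⁻¹ μ x) :=
    (continuous_gaussDensity _ _).measurable.ennreal_ofReal
  ext s hs
  rw [Measure.map_apply hmeas hs, withDensity_apply _ (hmeas hs), withDensity_apply _ hs]
  have hvol : (volume : Measure (EuclideanSpace ℝ (Fin k))) = ENNReal.ofReal |L.det| •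
      (volume : Measure (EuclideanSpace ℝ (Fin k))).map
        (fun x => μ + toEuclideanCLM (𝕜 := ℝ) (CFC.sqrt V) x) := by
    rw [hmap, smul_smul, ← ENNReal.ofReal_mul (abs_nonneg _), ← abs_mul, mul_inv_cancel₀ hdet0]
    simp
  nth_rw 2 [hvol]
  rw [setLIntegral_smul_measure, setLIntegral_map hs hgm hmeas, smul_eq_mul,
    ← lintegral_const_mul' _ _ ENNReal.ofReal_ne_top]
  refine lintegral_congr fun x => ?_
  rw [← ENNReal.ofReal_mul (abs_nonneg _)]
  congr 1
  have e1 : √(V⁻¹).det = |L.det|⁻¹ := by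
    rw [det_nonsing_inv, Ring.inverse_eq_inv', ← hdet, mul_inv, Real.sqrt_mul_self_eq_abs, abs_inv]
  have e2 : matQuad V⁻¹ (μ + toEuclideanCLM (𝕜 := ℝ) (CFC.sqrt V) x - μ) = ‖x‖ ^ 2 := by
    rw [add_sub_cancel_left, ← hL, hAL, hquad]
  rw [gaussDensity, e1, e2]
  field_simp

lemma integral_multivariateGaussian {V : Matrix (Fin k) (Fin k) ℝ} (hV : V.PosDef)
    (μ : EuclideanSpace ℝ (Fin k)) (F : EuclideanSpace ℝ (Fin k) → ℝ) :
    ∫ x, F x ∂multivariateGaussian μ V = ∫ x, gaussDensity V⁻¹ μ x * F x := by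
  rw [multivariateGaussian_eq_withDensity hV, integral_withDensity_eq_integral_toReal_smul
    (continuous_gaussDensity _ _).measurable.ennreal_ofReal (by simp)]
  simp_rw [ENNReal.toReal_ofReal (gaussDensity_nonneg _ _ _), smul_eq_mul]

lemma integrable_multivariateGaussian_iff {V : Matrix (Fin k) (Fin k) ℝ} (hV : V.PosDef)
    (μ : EuclideanSpace ℝ (Fin k)) (F : EuclideanSpace ℝ (Fin k) → ℝ) :
    Integrable F (multivariateGaussian μ V) ↔
      Integrable fun x => gaussDensity V⁻¹ μ x * F x := by
  rw [multivariateGaussian_eq_withDensity hV, integrable_withDensity_iff_integrable_smul'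
    (continuous_gaussDensity _ _).measurable.ennreal_ofReal (by simp)]
  simp_rw [ENNReal.toReal_ofReal (gaussDensity_nonneg _ _ _), smul_eq_mul]

end GaussianDensities

/-! ### Uniform bounds along convergent matrices -/

section UniformBounds

variable {k : ℕ}

lemma exists_le_matQuad {K : Matrix (Fin k) (Fin k) ℝ} (hK : K.PosDef) :
    ∃ κ > 0, ∀ x, κ * ‖x‖ ^ 2 ≤ matQuad K x := by
  have hpos (x : EuclideanSpace ℝ (Fin k)) (hx : x ≠ 0) : 0 < matQuad K x := by
    have := hK.dotProduct_mulVec_pos (x := x.ofLp) (by simpa using hx)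
    simpa [matQuad] using this
  by_cases hne : (Metric.sphere (0 : EuclideanSpace ℝ (Fin k)) 1).Nonempty
  · obtain ⟨x₀, hx₀, hmin⟩ := (isCompact_sphere (0 : EuclideanSpace ℝ (Fin k)) 1).exists_isMinOn
      hne (continuous_matQuad K).continuousOn
    have hx₀' : x₀ ≠ 0 := by rintro rfl; simp at hx₀
    refine ⟨matQuad K x₀, hpos _ hx₀', fun x => ?_⟩
    rcases eq_or_ne x 0 with rfl | hx
    · simp [matQuad]
    have hn : ‖x‖ ≠ 0 := norm_ne_zero_iff.2 hx
    have h1 : matQuad K x₀ ≤ matQuad K (‖x‖⁻¹ • x) := hmin (by simp [norm_smul, hn])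
    have h2 : matQuad K (‖x‖⁻¹ • x) = (‖x‖ ^ 2)⁻¹ * matQuad K x := by
      simp only [matQuad, WithLp.ofLp_smul, mulVec_smul, dotProduct_smul, smul_dotProduct,
        smul_eq_mul]
      ring
    rw [h2] at h1
    have : 0 < ‖x‖ ^ 2 := by positivity
    rw [inv_mul_eq_div, le_div_iff₀ this] at h1
    exact h1
  · refine ⟨1, one_pos, fun x => ?_⟩
    have hx : x = 0 := by
      by_contra hx
      exact hne ⟨‖x‖⁻¹ • x, by simp [norm_smul, norm_ne_zero_iff.2 hx]⟩
    simp [hx, matQuad]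

lemma abs_matQuad_le (K : Matrix (Fin k) (Fin k) ℝ) (x : EuclideanSpace ℝ (Fin k)) :
    |matQuad K x| ≤ (∑ i, ∑ j, |K i j|) * ‖x‖ ^ 2 := by
  have hc (i : Fin k) : |x i| ≤ ‖x‖ := by
    simpa using PiLp.norm_apply_le x i
  simp only [matQuad, dotProduct, mulVec, Finset.mul_sum, Finset.sum_mul]
  refine (Finset.abs_sum_le_sum_abs _ _).trans (Finset.sum_le_sum fun i _ => ?_)
  refine (Finset.abs_sum_le_sum_abs _ _).trans (Finset.sum_le_sum fun j _ => ?_)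
  rw [abs_mul, abs_mul]
  have := mul_le_mul (hc i) (hc j) (abs_nonneg _) (norm_nonneg _)
  nlinarith [abs_nonneg (K i j)]

lemma matQuad_sub_left (K J : Matrix (Fin k) (Fin k) ℝ) (x : EuclideanSpace ℝ (Fin k)) :
    matQuad (K - J) x = matQuad K x - matQuad J x := by
  simp [matQuad, sub_mulVec, dotProduct_sub]

variable {ι : Type*} {l : Filter ι}

lemma tendsto_sum_abs_sub {J : ι → Matrix (Fin k) (Fin k) ℝ} {K : Matrix (Fin k) (Fin k) ℝ}
    (h : Tendsto J l (𝓝 K)) :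
    Tendsto (fun n => ∑ i, ∑ j, |(J n - K) i j|) l (𝓝 0) := by
  have hc : Continuous fun M : Matrix (Fin k) (Fin k) ℝ => ∑ i, ∑ j, |(M - K) i j| := by
    simp only [Matrix.sub_apply]
    fun_prop
  simpa [Function.comp_def] using (hc.tendsto K).comp h

/-- Uniform coercivity along a sequence with positive definite limit. -/
lemma eventually_le_matQuad {J : ι → Matrix (Fin k) (Fin k) ℝ} {K : Matrix (Fin k) (Fin k) ℝ}
    (hK : K.PosDef) (h : Tendsto J l (𝓝 K)) :
    ∃ κ > 0, (∀ x, κ * ‖x‖ ^ 2 ≤ matQuad K x) ∧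
      ∀ᶠ n in l, ∀ x, κ * ‖x‖ ^ 2 ≤ matQuad (J n) x := by
  obtain ⟨κ, hκ, hle⟩ := exists_le_matQuad hK
  refine ⟨κ / 2, by positivity, fun x => ?_, ?_⟩
  · have := hle x
    have : 0 ≤ κ * ‖x‖ ^ 2 := by positivity
    linarith
  filter_upwards [(tendsto_sum_abs_sub h).eventually (gt_mem_nhds (half_pos hκ))] with n hn x
  have h1 := abs_le.1 (abs_matQuad_le (J n - K) x)
  rw [matQuad_sub_left] at h1
  have h2 := hle x
  nlinarith [sq_nonneg ‖x‖]

lemma tendsto_matQuad {J : ι → Matrix (Fin k) (Fin k) ℝ} {K : Matrix (Fin k) (Fin k) ℝ}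
    (h : Tendsto J l (𝓝 K)) {z : ι → EuclideanSpace ℝ (Fin k)} {x : EuclideanSpace ℝ (Fin k)}
    (hz : Tendsto z l (𝓝 x)) : Tendsto (fun n => matQuad (J n) (z n)) l (𝓝 (matQuad K x)) := by
  have hc : Continuous fun p : Matrix (Fin k) (Fin k) ℝ × EuclideanSpace ℝ (Fin k) =>
      matQuad p.1 p.2 := by
    unfold matQuad; fun_prop
  exact (hc.tendsto (K, x)).comp (h.prodMk_nhds hz)

lemma tendsto_gaussDensity {J : ι → Matrix (Fin k) (Fin k) ℝ} {K : Matrix (Fin k) (Fin k) ℝ}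
    (h : Tendsto J l (𝓝 K)) {μ : ι → EuclideanSpace ℝ (Fin k)} {δ : EuclideanSpace ℝ (Fin k)}
    (hμ : Tendsto μ l (𝓝 δ)) (x : EuclideanSpace ℝ (Fin k)) :
    Tendsto (fun n => gaussDensity (J n) (μ n) x) l (𝓝 (gaussDensity K δ x)) := by
  have h1 := tendsto_matQuad h (hμ.const_sub x)
  have h2 : Tendsto (fun n => (J n).det) l (𝓝 K.det) :=
    ((continuous_id.matrix_det (n := Fin k) (R := ℝ)).tendsto K).comp h
  unfold gaussDensity
  exact (h2.sqrt.const_mul _).mul ((h1.div_const 2).neg.rexp)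

lemma gaussDensity_le {J : Matrix (Fin k) (Fin k) ℝ} {κ D M : ℝ} (hκ : 0 < κ)
    (hJ : ∀ x, κ * ‖x‖ ^ 2 ≤ matQuad J x) (hD : J.det ≤ D) {μ : EuclideanSpace ℝ (Fin k)}
    (hμ : ‖μ‖ ≤ M) (x : EuclideanSpace ℝ (Fin k)) :
    gaussDensity J μ x ≤ ((2 * Real.pi) ^ (-(k / 2 : ℝ)) * √D * Real.exp (κ * M ^ 2 / 2)) *
      Real.exp (-(κ / 4) * ‖x‖ ^ 2) := by
  rw [gaussDensity, mul_assoc _ (Real.exp _), ← Real.exp_add]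
  have h1 := hJ (x - μ)
  have h2 : ‖x‖ ^ 2 ≤ 2 * ‖x - μ‖ ^ 2 + 2 * M ^ 2 := by
    have : ‖x‖ ≤ ‖x - μ‖ + M := by
      have := norm_add_le (x - μ) μ
      rw [sub_add_cancel] at this
      linarith
    nlinarith [norm_nonneg x, sq_nonneg (‖x - μ‖ - M), norm_nonneg μ, norm_nonneg (x - μ)]
  gcongr
  nlinarith

/-- A Gaussian majorant, uniform along convergent parameters. -/
lemma exists_gaussDensity_le {J : ι → Matrix (Fin k) (Fin k) ℝ} {K : Matrix (Fin k) (Fin k) ℝ}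
    (hK : K.PosDef) (h : Tendsto J l (𝓝 K)) {μ : ι → EuclideanSpace ℝ (Fin k)}
    {δ : EuclideanSpace ℝ (Fin k)} (hμ : Tendsto μ l (𝓝 δ)) :
    ∃ C κ : ℝ, 0 ≤ C ∧ 0 < κ ∧
      (∀ x, gaussDensity K δ x ≤ C * Real.exp (-κ * ‖x‖ ^ 2)) ∧
      ∀ᶠ n in l, ∀ x, gaussDensity (J n) (μ n) x ≤ C * Real.exp (-κ * ‖x‖ ^ 2) := by
  obtain ⟨κ, hκ, hK', hJ⟩ := eventually_le_matQuad hK h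
  have h2 : Tendsto (fun n => (J n).det) l (𝓝 K.det) :=
    ((continuous_id.matrix_det (n := Fin k) (R := ℝ)).tendsto K).comp h
  refine ⟨(2 * Real.pi) ^ (-(k / 2 : ℝ)) * √(K.det + 1) *
    Real.exp (κ * (‖δ‖ + 1) ^ 2 / 2), κ / 4, by positivity, by positivity, ?_, ?_⟩
  · exact gaussDensity_le hκ hK' (by linarith) (by linarith)
  · filter_upwards [hJ, h2.eventually (gt_mem_nhds (lt_add_one _)),
      hμ.norm.eventually (gt_mem_nhds (lt_add_one _))] with n h1 h2 h3
    exact gaussDensity_le hκ h1 h2.le h3.le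

/-- In dimension at least three `‖x‖⁻²` is integrable against Gaussian weights. -/
lemma integrable_norm_weight (hk : 3 ≤ k) {κ : ℝ} (hκ : 0 < κ) :
    Integrable fun x : EuclideanSpace ℝ (Fin k) =>
      (1 + ‖x‖ ^ 2 + (‖x‖ ^ 2)⁻¹) * Real.exp (-κ * ‖x‖ ^ 2) := by
  have : Nontrivial (EuclideanSpace ℝ (Fin k)) := by
    have : Nonempty (Fin k) := ⟨⟨0, by omega⟩⟩
    infer_instance
  rw [integrable_fun_norm_addHaar volume
    (f := fun y : ℝ => (1 + y ^ 2 + (y ^ 2)⁻¹) * Real.exp (-κ * y ^ 2))]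
  rw [finrank_euclideanSpace_fin]
  -- in polar coordinates the weight `‖x‖⁻²` meets the factor `‖x‖ ^ (k - 1)`
  obtain ⟨j, rfl⟩ : ∃ j, k = j + 3 := ⟨k - 3, by omega⟩
  have h (s : ℕ) := integrableOn_rpow_mul_exp_neg_mul_sq hκ (s := (s : ℝ))
    (by have : (0 : ℝ) ≤ s := s.cast_nonneg
        linarith)
  refine (((h (j + 2)).add (h (j + 4))).add (h j)).congr_fun (fun y hy => ?_) measurableSet_Ioi
  have hy' : (0 : ℝ) < y := hy
  simp only [Pi.add_apply, Real.rpow_natCast, smul_eq_mul]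
  have : j + 3 - 1 = j + 2 := by omega
  rw [this]
  field_simp
  ring

end UniformBounds

/-! ### Stein's identity for shrinkage factors -/

/-- A smooth upper approximation of `q ↦ max q b`, which is bounded away from zero for `q, b ≥ 0`
and `ε > 0`. -/
noncomputable def smoothMax (b ε q : ℝ) : ℝ := (q + b + √((q - b) ^ 2 + ε ^ 2)) / 2

/-- The derivative of `smoothMax b ε`. -/
noncomputable def smoothMaxDeriv (b ε q : ℝ) : ℝ := (1 + (q - b) / √((q - b) ^ 2 + ε ^ 2)) / 2

section SmoothMax

variable {b ε q : ℝ}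

lemma hasDerivAt_smoothMax (hε : 0 < ε) (b q : ℝ) :
    HasDerivAt (smoothMax b ε) (smoothMaxDeriv b ε q) q := by
  have hpos : 0 < (q - b) ^ 2 + ε ^ 2 := by positivity
  have h1 : HasDerivAt (fun q => (q - b) ^ 2 + ε ^ 2) (2 * (q - b)) q := by
    simpa using (((hasDerivAt_id q).sub_const b).pow 2).add_const (ε ^ 2)
  have h2 := h1.sqrt hpos.ne'
  have h3 := (((hasDerivAt_id q).add_const b).add h2).div_const 2
  convert! h3 using 1
  rw [smoothMaxDeriv, mul_div_mul_left _ _ two_ne_zero]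

lemma max_le_smoothMax (b ε q : ℝ) : max q b ≤ smoothMax b ε q := by
  have h : |q - b| ≤ √((q - b) ^ 2 + ε ^ 2) := by
    rw [← Real.sqrt_sq_eq_abs]
    exact Real.sqrt_le_sqrt (by nlinarith [sq_nonneg ε])
  have := abs_le.1 h
  rw [smoothMax]
  apply max_le <;> linarith [this.1, this.2, neg_abs_le (q - b), le_abs_self (q - b)]

lemma half_le_smoothMax (hb : 0 ≤ b) (hq : 0 ≤ q) : ε / 2 ≤ smoothMax b ε q := by
  have h : ε ≤ √((q - b) ^ 2 + ε ^ 2) := by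
    apply Real.le_sqrt_of_sq_le
    nlinarith [sq_nonneg (q - b)]
  rw [smoothMax]
  linarith

lemma smoothMaxDeriv_mem (hε : 0 < ε) (b q : ℝ) :
    0 ≤ smoothMaxDeriv b ε q ∧ smoothMaxDeriv b ε q ≤ 1 := by
  have hpos : 0 < √((q - b) ^ 2 + ε ^ 2) := by positivity
  have h : |q - b| ≤ √((q - b) ^ 2 + ε ^ 2) := by
    rw [← Real.sqrt_sq_eq_abs]
    exact Real.sqrt_le_sqrt (by nlinarith [sq_nonneg ε])
  have h1 : |(q - b) / √((q - b) ^ 2 + ε ^ 2)| ≤ 1 := by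
    rw [abs_div, abs_of_pos hpos]
    exact div_le_one_of_le₀ h hpos.le
  have := abs_le.1 h1
  rw [smoothMaxDeriv]
  constructor <;> linarith [this.1, this.2]

lemma continuous_smoothMaxDeriv (hε : 0 < ε) (b : ℝ) : Continuous (smoothMaxDeriv b ε) := by
  unfold smoothMaxDeriv
  have : ∀ q : ℝ, √((q - b) ^ 2 + ε ^ 2) ≠ 0 := fun q => by positivity
  fun_prop (disch := assumption)

lemma tendsto_smoothMax (b q : ℝ) :
    Tendsto (fun ε => smoothMax b ε q) (𝓝[>] 0) (𝓝 (max q b)) := by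
  have hc : Continuous fun ε => smoothMax b ε q := by unfold smoothMax; fun_prop
  have := (hc.tendsto 0).mono_left (nhdsWithin_le_nhds (s := Set.Ioi 0))
  convert! this using 2
  simp only [smoothMax, ne_eq, OfNat.ofNat_ne_zero, not_false_eq_true, zero_pow, add_zero,
    Real.sqrt_sq_eq_abs]
  rcases le_total q b with h | h
  · rw [max_eq_right h, abs_of_nonpos (by linarith)]; ring
  · rw [max_eq_left h, abs_of_nonneg (by linarith)]; ring

open Classical in
lemma tendsto_smoothMaxDeriv (hq : q ≠ b) :
    Tendsto (fun ε => smoothMaxDeriv b ε q) (𝓝[>] 0) (𝓝 (if b < q then 1 else 0)) := by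
  have hne : √((q - b) ^ 2 + 0 ^ 2) ≠ 0 := by
    have : q - b ≠ 0 := sub_ne_zero.2 hq
    positivity
  have hc : ContinuousAt (fun ε => smoothMaxDeriv b ε q) 0 := by
    unfold smoothMaxDeriv
    fun_prop (disch := assumption)
  have := hc.tendsto.mono_left (nhdsWithin_le_nhds (s := Set.Ioi 0))
  convert! this using 2
  have h0 : q - b ≠ 0 := sub_ne_zero.2 hq
  simp only [smoothMaxDeriv, ne_eq, OfNat.ofNat_ne_zero, not_false_eq_true, zero_pow, add_zero,
    Real.sqrt_sq_eq_abs]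
  split_ifs with h
  · rw [abs_of_pos (by linarith), div_self h0]; norm_num
  · have : q - b < 0 := lt_of_le_of_ne (by linarith) h0
    rw [abs_of_neg this, div_neg, div_self h0]; norm_num

end SmoothMax

section Ellipsoids

variable {k : ℕ}

lemma abs_dot_le (f : Fin k → ℝ) (x : EuclideanSpace ℝ (Fin k)) :
    |f ⬝ᵥ x.ofLp| ≤ ‖WithLp.toLp 2 f‖ * ‖x‖ := by
  have h : f ⬝ᵥ x.ofLp = inner ℝ x (WithLp.toLp 2 f) := by
    rw [EuclideanSpace.inner_eq_star_dotProduct]; simp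
  rw [h, mul_comm]
  exact abs_real_inner_le_norm _ _

lemma ae_ne_zero (hk : 3 ≤ k) : ∀ᵐ x : EuclideanSpace ℝ (Fin k), x ≠ 0 := by
  have : Nonempty (Fin k) := ⟨⟨0, by omega⟩⟩
  simp [ae_iff]

/-- Ellipsoids are Lebesgue null sets. -/
lemma ae_matQuad_ne (hk : 3 ≤ k) {K : Matrix (Fin k) (Fin k) ℝ} (hK : K.PosDef)
    (b : ℝ) : ∀ᵐ x, matQuad K x ≠ b := by
  have : Nonempty (Fin k) := ⟨⟨0, by omega⟩⟩
  obtain ⟨B, hB⟩ : ∃ B : Matrix (Fin k) (Fin k) ℝ, K = Bᵀ * B := by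
    open scoped MatrixOrder in
    obtain ⟨B, hB⟩ := CStarAlgebra.nonneg_iff_eq_star_mul_self.mp hK.posSemidef.nonneg
    exact ⟨B, by rw [hB, star_eq_conjTranspose, conjTranspose_eq_transpose_of_trivial]⟩
  have hdet : (LinearMap.det (B.toLpLin 2 2)) ≠ 0 := by
    rw [LinearMap.det_toLpLin]
    intro h
    have := hK.det_pos
    rw [hB, det_mul, h, mul_zero] at this
    exact this.false
  have hn := Measure.addHaar_preimage_linearMap volume hdet (Metric.sphere 0 √b)
  rw [Measure.addHaar_sphere, mul_zero] at hn
  rw [ae_iff]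
  refine measure_mono_null (fun x hx => ?_) hn
  have hx' : matQuad K x = b := by simpa using hx
  have hq : matQuad K x = ‖(B.toLpLin 2 2) x‖ ^ 2 := by
    rw [← dot_self_eq, matQuad, hB, ofLp_toLpLin, toLin'_apply, ← mulVec_mulVec,
      dotProduct_mulVec, vecMul_transpose]
  simp only [Set.mem_preimage, mem_sphere_zero_iff_norm]
  rw [← hx', hq, Real.sqrt_sq (norm_nonneg _)]

/-- The growth condition admits the singularity of a shrinkage factor at the origin. -/
lemma integrable_gaussDensity_mul (hk : 3 ≤ k) {K : Matrix (Fin k) (Fin k) ℝ} (hK : K.PosDef)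
    (δ : EuclideanSpace ℝ (Fin k)) {F : EuclideanSpace ℝ (Fin k) → ℝ}
    (hF : AEStronglyMeasurable F volume) {C : ℝ}
    (hC : ∀ᵐ x, |F x| ≤ C * (1 + ‖x‖ ^ 2 + (‖x‖ ^ 2)⁻¹)) :
    Integrable fun x => gaussDensity K δ x * F x := by
  obtain ⟨A, κ, hA, hκ, hle, -⟩ := exists_gaussDensity_le (l := (atTop : Filter ℕ)) hK
    (tendsto_const_nhds (x := K)) (tendsto_const_nhds (x := δ))
  refine Integrable.mono' ((integrable_norm_weight hk hκ).const_mul (A * C))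
    ((continuous_gaussDensity K δ).aestronglyMeasurable.mul hF) ?_
  filter_upwards [hC] with x hx
  rw [Real.norm_eq_abs, abs_mul, abs_of_nonneg (gaussDensity_nonneg _ _ _)]
  calc _ ≤ (A * Real.exp (-κ * ‖x‖ ^ 2)) * (C * (1 + ‖x‖ ^ 2 + (‖x‖ ^ 2)⁻¹)) :=
        mul_le_mul (hle x) hx (abs_nonneg _) (by positivity)
    _ = _ := by ring

end Ellipsoids

section LineDerivatives

variable {k : ℕ} {K : Matrix (Fin k) (Fin k) ℝ}

lemma matQuad_add_smul (hK : K.PosDef) (f : Fin k → ℝ) (x : EuclideanSpace ℝ (Fin k)) (t : ℝ) :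
    matQuad K (x + t • WithLp.toLp 2 (K⁻¹ *ᵥ f)) =
      matQuad K x + 2 * t * (f ⬝ᵥ x.ofLp) + t ^ 2 * (f ⬝ᵥ (K⁻¹ *ᵥ f)) := by
  have hd := (isUnit_iff_isUnit_det _).1 hK.isUnit
  have hs : Kᵀ = K := hK.isHermitian
  have h1 : K *ᵥ (K⁻¹ *ᵥ f) = f := by rw [mulVec_mulVec, mul_nonsing_inv _ hd, one_mulVec]
  have h2 : (K⁻¹ *ᵥ f) ⬝ᵥ (K *ᵥ x.ofLp) = f ⬝ᵥ x.ofLp := by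
    rw [dotProduct_mulVec, ← mulVec_transpose, hs, h1]
  simp only [matQuad, WithLp.ofLp_add, WithLp.ofLp_smul, mulVec_add, mulVec_smul, h1,
    add_dotProduct, dotProduct_add, smul_dotProduct, dotProduct_smul, smul_eq_mul, h2]
  rw [dotProduct_comm x.ofLp f, dotProduct_comm (K⁻¹ *ᵥ f) f]
  ring

lemma hasDerivAt_matQuad_line (hK : K.PosDef) (f : Fin k → ℝ) (x : EuclideanSpace ℝ (Fin k)) :
    HasDerivAt (fun t : ℝ => matQuad K (x + t • WithLp.toLp 2 (K⁻¹ *ᵥ f)))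
      (2 * (f ⬝ᵥ x.ofLp)) 0 := by
  simp_rw [matQuad_add_smul hK]
  have h1 : HasDerivAt (fun t : ℝ => 2 * t * (f ⬝ᵥ x.ofLp)) (2 * (f ⬝ᵥ x.ofLp)) 0 := by
    simpa using ((hasDerivAt_id (0 : ℝ)).const_mul 2).mul_const (f ⬝ᵥ x.ofLp)
  have h2 : HasDerivAt (fun t : ℝ => t ^ 2 * (f ⬝ᵥ (K⁻¹ *ᵥ f))) 0 0 := by
    simpa using ((hasDerivAt_id (0 : ℝ)).pow 2).mul_const (f ⬝ᵥ (K⁻¹ *ᵥ f))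
  have h3 := (h1.const_add (matQuad K x)).add h2
  rw [add_zero] at h3
  exact h3

/-- In the direction `K⁻¹ f` the logarithmic derivative of the density is `-f'(x - δ)`, which is
why this direction is the one used in Stein's identity. -/
lemma hasLineDerivAt_gaussDensity (hK : K.PosDef) (f : Fin k → ℝ)
    (δ x : EuclideanSpace ℝ (Fin k)) :
    HasLineDerivAt ℝ (gaussDensity K δ) (-(f ⬝ᵥ (x - δ).ofLp) * gaussDensity K δ x) x
      (WithLp.toLp 2 (K⁻¹ *ᵥ f)) := by
  have h := hasDerivAt_matQuad_line hK f (x - δ)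
  have h2 := ((h.div_const 2).neg.exp).const_mul ((2 * Real.pi) ^ (-(k / 2 : ℝ)) * √K.det)
  rw [HasLineDerivAt]
  convert! h2 using 1
  · ext t; rw [gaussDensity, add_sub_right_comm]; rfl
  · simp [gaussDensity]; ring

lemma hasLineDerivAt_dot_div (hK : K.PosDef) (f : Fin k → ℝ) {m : ℝ → ℝ} {m' : ℝ}
    (x : EuclideanSpace ℝ (Fin k)) (hm : HasDerivAt m m' (matQuad K x))
    (h0 : m (matQuad K x) ≠ 0) :
    HasLineDerivAt ℝ (fun x : EuclideanSpace ℝ (Fin k) => (f ⬝ᵥ x.ofLp) / m (matQuad K x))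
      ((f ⬝ᵥ (K⁻¹ *ᵥ f)) / m (matQuad K x) -
        2 * m' * (f ⬝ᵥ x.ofLp) ^ 2 / m (matQuad K x) ^ 2) x (WithLp.toLp 2 (K⁻¹ *ᵥ f)) := by
  have h := hasDerivAt_matQuad_line hK f x
  have hx : matQuad K (x + (0 : ℝ) • WithLp.toLp 2 (K⁻¹ *ᵥ f)) = matQuad K x := by simp
  have h1 : HasDerivAt (fun t : ℝ => m (matQuad K (x + t • WithLp.toLp 2 (K⁻¹ *ᵥ f))))
      (m' * (2 * (f ⬝ᵥ x.ofLp))) 0 :=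
    HasDerivAt.comp (h₂ := m) (0 : ℝ) (by rw [hx]; exact hm) h
  have h2 : HasDerivAt (fun t : ℝ => f ⬝ᵥ (x + t • WithLp.toLp 2 (K⁻¹ *ᵥ f)).ofLp)
      (f ⬝ᵥ (K⁻¹ *ᵥ f)) 0 := by
    simp only [WithLp.ofLp_add, WithLp.ofLp_smul, dotProduct_add, dotProduct_smul, smul_eq_mul]
    simpa using ((hasDerivAt_id (0 : ℝ)).mul_const (f ⬝ᵥ (K⁻¹ *ᵥ f))).const_add (f ⬝ᵥ x.ofLp)
  have h3 := h2.div h1 (by rw [hx]; exact h0)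
  rw [HasLineDerivAt]
  convert! h3 using 1
  rw [hx]
  simp only [zero_smul, add_zero]
  field_simp

end LineDerivatives

/-! ### Dominated convergence and integration by parts -/

section Integrals

variable {k : ℕ}

/-- Dominated convergence against convergent Gaussian densities. The integrands may oscillate: only
their difference has to vanish in the limit. -/
lemma tendsto_integral_gaussDensity_sub (hk : 3 ≤ k) {ι : Type*} {l : Filter ι}
    [l.IsCountablyGenerated] {J : ι → Matrix (Fin k) (Fin k) ℝ} {K : Matrix (Fin k) (Fin k) ℝ}
    (hK : K.PosDef) (hJ : Tendsto J l (𝓝 K)) (hJp : ∀ᶠ n in l, (J n).PosDef)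
    {μ : ι → EuclideanSpace ℝ (Fin k)}
    {δ : EuclideanSpace ℝ (Fin k)} (hμ : Tendsto μ l (𝓝 δ))
    {F G : ι → EuclideanSpace ℝ (Fin k) → ℝ}
    (hF : ∀ n, AEStronglyMeasurable (F n) volume) (hG : ∀ n, AEStronglyMeasurable (G n) volume)
    {C : ℝ} (hFC : ∀ᶠ n in l, ∀ᵐ x, |F n x| ≤ C * (1 + ‖x‖ ^ 2 + (‖x‖ ^ 2)⁻¹))
    (hGC : ∀ᶠ n in l, ∀ᵐ x, |G n x| ≤ C * (1 + ‖x‖ ^ 2 + (‖x‖ ^ 2)⁻¹))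
    (hFG : ∀ᵐ x, Tendsto (fun n => F n x - G n x) l (𝓝 0))
    (hGb : ∀ᵐ x, ∀ᶠ n in l, |G n x| ≤ C * (1 + ‖x‖ ^ 2 + (‖x‖ ^ 2)⁻¹)) :
    Tendsto (fun n => (∫ x, gaussDensity (J n) (μ n) x * F n x) -
      ∫ x, gaussDensity K δ x * G n x) l (𝓝 0) := by
  obtain ⟨A, κ, hA, hκ, hle, hle'⟩ := exists_gaussDensity_le hK hJ hμ
  have key : Tendsto (fun n => ∫ x, (gaussDensity (J n) (μ n) x * F n x -
      gaussDensity K δ x * G n x)) l (𝓝 (∫ _x : EuclideanSpace ℝ (Fin k), (0 : ℝ))) := by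
    refine tendsto_integral_filter_of_dominated_convergence
      (fun x => 2 * (A * C) * ((1 + ‖x‖ ^ 2 + (‖x‖ ^ 2)⁻¹) * Real.exp (-κ * ‖x‖ ^ 2))) ?_ ?_
      ((integrable_norm_weight hk hκ).const_mul _) ?_
    · exact .of_forall fun n => ((continuous_gaussDensity _ _).aestronglyMeasurable.mul (hF n)).sub
        ((continuous_gaussDensity _ _).aestronglyMeasurable.mul (hG n))
    · filter_upwards [hFC, hGC, hle'] with n h1 h2 h3
      filter_upwards [h1, h2] with x h1 h2
      have a1 := mul_le_mul (h3 x) h1 (abs_nonneg _) (by positivity)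
      have a2 := mul_le_mul (hle x) h2 (abs_nonneg _) (by positivity)
      refine (norm_sub_le _ _).trans ?_
      rw [Real.norm_eq_abs, Real.norm_eq_abs, abs_mul, abs_mul,
        abs_of_nonneg (gaussDensity_nonneg _ _ _), abs_of_nonneg (gaussDensity_nonneg _ _ _)]
      linarith
    · filter_upwards [hFG, hGb] with x h1 h2
      have e : ∀ n, gaussDensity (J n) (μ n) x * F n x - gaussDensity K δ x * G n x =
          gaussDensity (J n) (μ n) x * (F n x - G n x) +
            (gaussDensity (J n) (μ n) x - gaussDensity K δ x) * G n x := fun n => by ring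
      simp_rw [e]
      have t1 := (tendsto_gaussDensity hJ hμ x).mul h1
      have t2 : Tendsto (fun n => gaussDensity (J n) (μ n) x - gaussDensity K δ x) l (𝓝 0) := by
        simpa using (tendsto_gaussDensity hJ hμ x).sub_const (gaussDensity K δ x)
      have t3 : Tendsto (fun n => (gaussDensity (J n) (μ n) x - gaussDensity K δ x) * G n x) l
          (𝓝 0) := by
        refine t2.zero_mul_isBoundedUnder_le ?_
        exact ⟨_, eventually_map.2 (h2.mono fun n hn => hn)⟩
      simpa using t1.add t3
  rw [integral_zero] at key
  refine key.congr' ?_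
  filter_upwards [hFC, hGC, hJp] with n h1 h2 h3
  rw [integral_sub (integrable_gaussDensity_mul hk h3 _ (hF n) h1)
    (integrable_gaussDensity_mul hk hK _ (hG n) h2)]

lemma tendsto_integral_gaussDensity (hk : 3 ≤ k) {ι : Type*} {l : Filter ι} [l.NeBot]
    [l.IsCountablyGenerated] {K : Matrix (Fin k) (Fin k) ℝ}
    (hK : K.PosDef) (δ : EuclideanSpace ℝ (Fin k))
    {F : ι → EuclideanSpace ℝ (Fin k) → ℝ} {G : EuclideanSpace ℝ (Fin k) → ℝ}
    (hF : ∀ n, AEStronglyMeasurable (F n) volume)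
    {C : ℝ} (hFC : ∀ᵐ x, ∀ᶠ n in l, |F n x| ≤ C * (1 + ‖x‖ ^ 2 + (‖x‖ ^ 2)⁻¹))
    (hFC' : ∀ᶠ n in l, ∀ᵐ x, |F n x| ≤ C * (1 + ‖x‖ ^ 2 + (‖x‖ ^ 2)⁻¹))
    (hFG : ∀ᵐ x, Tendsto (fun n => F n x) l (𝓝 (G x))) :
    Integrable (fun x => gaussDensity K δ x * G x) ∧
    Tendsto (fun n => ∫ x, gaussDensity K δ x * F n x) l (𝓝 (∫ x, gaussDensity K δ x * G x)) := by
  have hG : AEStronglyMeasurable G volume := aestronglyMeasurable_of_tendsto_ae l hF hFG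
  have hGC : ∀ᵐ x, |G x| ≤ C * (1 + ‖x‖ ^ 2 + (‖x‖ ^ 2)⁻¹) := by
    filter_upwards [hFC, hFG] with x h1 h2
    exact le_of_tendsto h2.abs h1
  refine ⟨integrable_gaussDensity_mul hk hK δ hG hGC, ?_⟩
  have := tendsto_integral_gaussDensity_sub (l := l) hk hK (tendsto_const_nhds (x := K))
    (.of_forall fun _ => hK) (tendsto_const_nhds (x := δ)) hF (fun _ => hG) hFC'
    (.of_forall fun _ => hGC)
    (hFG.mono fun x hx => by simpa using hx.sub_const (G x))
    (hGC.mono fun x hx => .of_forall fun _ => hx)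
  simpa using this.add_const (∫ x, gaussDensity K δ x * G x)

/-- Integration by parts for the smoothed shrinkage factor. -/
lemma stein_smoothMax (hk : 3 ≤ k) {K : Matrix (Fin k) (Fin k) ℝ} (hK : K.PosDef)
    (f : Fin k → ℝ) (δ : EuclideanSpace ℝ (Fin k)) {b ε : ℝ} (hb : 0 ≤ b) (hε : 0 < ε) :
    ∫ x, gaussDensity K δ x * ((f ⬝ᵥ (x - δ).ofLp) *
        ((f ⬝ᵥ x.ofLp) / smoothMax b ε (matQuad K x))) =
      ∫ x, gaussDensity K δ x * ((f ⬝ᵥ (K⁻¹ *ᵥ f)) / smoothMax b ε (matQuad K x) -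
        2 * smoothMaxDeriv b ε (matQuad K x) * (f ⬝ᵥ x.ofLp) ^ 2 /
          smoothMax b ε (matQuad K x) ^ 2) := by
  obtain ⟨κ, hκ, hκK⟩ := exists_le_matQuad hK
  have hQ0 (x : EuclideanSpace ℝ (Fin k)) : 0 ≤ matQuad K x :=
    le_trans (by positivity) (hκK x)
  have hm (x : EuclideanSpace ℝ (Fin k)) : ε / 2 ≤ smoothMax b ε (matQuad K x) :=
    half_le_smoothMax hb (hQ0 x)
  have hm0 (x : EuclideanSpace ℝ (Fin k)) : 0 < smoothMax b ε (matQuad K x) :=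
    lt_of_lt_of_le (by positivity) (hm x)
  have hcQ := continuous_matQuad K
  have hcm : Continuous fun x => smoothMax b ε (matQuad K x) := by
    unfold smoothMax; fun_prop
  have hcm' : Continuous fun x => smoothMaxDeriv b ε (matQuad K x) :=
    (continuous_smoothMaxDeriv hε b).comp hcQ
  have hne : ∀ x, smoothMax b ε (matQuad K x) ≠ 0 := fun x => (hm0 x).ne'
  set N := ‖WithLp.toLp 2 f‖ with hN
  have hN0 : 0 ≤ N := norm_nonneg _
  have hfx (x : EuclideanSpace ℝ (Fin k)) : |f ⬝ᵥ x.ofLp| ≤ N * ‖x‖ := abs_dot_le f x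
  have hφ (x : EuclideanSpace ℝ (Fin k)) :
      |(f ⬝ᵥ x.ofLp) / smoothMax b ε (matQuad K x)| ≤ N * ‖x‖ / (ε / 2) := by
    rw [abs_div, abs_of_pos (hm0 x)]
    exact div_le_div₀ (by positivity) (hfx x) (by positivity) (hm x)
  have hw (x : EuclideanSpace ℝ (Fin k)) : 0 ≤ (‖x‖ ^ 2)⁻¹ := by positivity
  have i1 := integrable_gaussDensity_mul hk hK δ
    (F := fun x => (f ⬝ᵥ (x - δ).ofLp) * ((f ⬝ᵥ x.ofLp) / smoothMax b ε (matQuad K x)))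
    (Continuous.aestronglyMeasurable (by fun_prop (disch := assumption)))
    (C := N * N / (ε / 2) * (1 + ‖δ‖)) (.of_forall fun x => by
      have hs : |f ⬝ᵥ (x - δ).ofLp| ≤ N * (‖x‖ + ‖δ‖) :=
        (hfx _).trans (mul_le_mul_of_nonneg_left (norm_sub_le _ _) hN0)
      rw [abs_mul]
      calc _ ≤ (N * (‖x‖ + ‖δ‖)) * (N * ‖x‖ / (ε / 2)) :=
            mul_le_mul hs (hφ x) (abs_nonneg _) (by positivity)
        _ = N * N / (ε / 2) * ((‖x‖ + ‖δ‖) * ‖x‖) := by ring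
        _ ≤ N * N / (ε / 2) * ((1 + ‖δ‖) * (1 + ‖x‖ ^ 2 + (‖x‖ ^ 2)⁻¹)) := by
            refine mul_le_mul_of_nonneg_left ?_ (by positivity)
            have := hw x
            nlinarith [norm_nonneg x, norm_nonneg δ, sq_nonneg (‖x‖ - 1),
              mul_nonneg (norm_nonneg δ) this, mul_nonneg (norm_nonneg δ) (sq_nonneg (‖x‖ - 1)),
              mul_nonneg (norm_nonneg δ) (sq_nonneg ‖x‖)]
        _ = _ := by ring)
  have i2 := integrable_gaussDensity_mul hk hK δ
    (F := fun x => (f ⬝ᵥ (K⁻¹ *ᵥ f)) / smoothMax b ε (matQuad K x) -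
        2 * smoothMaxDeriv b ε (matQuad K x) * (f ⬝ᵥ x.ofLp) ^ 2 /
          smoothMax b ε (matQuad K x) ^ 2)
    (by
      have hne2 : ∀ x, smoothMax b ε (matQuad K x) ^ 2 ≠ 0 := fun x => pow_ne_zero 2 (hne x)
      exact Continuous.aestronglyMeasurable (by fun_prop (disch := assumption)))
    (C := |f ⬝ᵥ (K⁻¹ *ᵥ f)| / (ε / 2) + 2 * N ^ 2 / (ε / 2) ^ 2) (.of_forall fun x => by
      obtain ⟨d0, d1⟩ := smoothMaxDeriv_mem hε b (matQuad K x)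
      refine (abs_sub _ _).trans ?_
      have b1 : |(f ⬝ᵥ (K⁻¹ *ᵥ f)) / smoothMax b ε (matQuad K x)| ≤
          |f ⬝ᵥ (K⁻¹ *ᵥ f)| / (ε / 2) := by
        rw [abs_div, abs_of_pos (hm0 x)]
        exact div_le_div_of_nonneg_left (abs_nonneg _) (by positivity) (hm x)
      have b2 : |2 * smoothMaxDeriv b ε (matQuad K x) * (f ⬝ᵥ x.ofLp) ^ 2 /
          smoothMax b ε (matQuad K x) ^ 2| ≤ 2 * N ^ 2 / (ε / 2) ^ 2 * ‖x‖ ^ 2 := by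
        have hsq : (f ⬝ᵥ x.ofLp) ^ 2 ≤ N ^ 2 * ‖x‖ ^ 2 := by
          rw [← mul_pow, ← sq_abs]
          exact pow_le_pow_left₀ (abs_nonneg _) (hfx x) 2
        have hm2 : (ε / 2) ^ 2 ≤ smoothMax b ε (matQuad K x) ^ 2 :=
          pow_le_pow_left₀ (by positivity) (hm x) 2
        rw [abs_of_nonneg (by positivity)]
        calc _ ≤ 2 * 1 * (N ^ 2 * ‖x‖ ^ 2) / (ε / 2) ^ 2 := by
              apply div_le_div₀ (by positivity) _ (by positivity) hm2
              gcongr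
          _ = _ := by ring
      have := hw x
      have c1 : 0 ≤ |f ⬝ᵥ (K⁻¹ *ᵥ f)| / (ε / 2) := by positivity
      have c2 : 0 ≤ 2 * N ^ 2 / (ε / 2) ^ 2 := by positivity
      nlinarith [mul_nonneg c1 this, mul_nonneg c2 this, mul_nonneg c1 (sq_nonneg ‖x‖)])
  have i3 := integrable_gaussDensity_mul hk hK δ
    (F := fun x => (f ⬝ᵥ x.ofLp) / smoothMax b ε (matQuad K x))
    (Continuous.aestronglyMeasurable (by fun_prop (disch := assumption)))
    (C := N / (ε / 2)) (.of_forall fun x => by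
      refine (hφ x).trans ?_
      rw [mul_div_right_comm]
      refine mul_le_mul_of_nonneg_left ?_ (by positivity)
      have := hw x
      nlinarith [sq_nonneg (‖x‖ - 1)])
  have key := integral_bilinear_hasLineDerivAt_right_eq_neg_left_of_integrable
    (μ := (volume : Measure (EuclideanSpace ℝ (Fin k)))) (B := ContinuousLinearMap.mul ℝ ℝ)
    (f := fun x : EuclideanSpace ℝ (Fin k) => (f ⬝ᵥ x.ofLp) / smoothMax b ε (matQuad K x))
    (f' := fun x => (f ⬝ᵥ (K⁻¹ *ᵥ f)) / smoothMax b ε (matQuad K x) -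
        2 * smoothMaxDeriv b ε (matQuad K x) * (f ⬝ᵥ x.ofLp) ^ 2 /
          smoothMax b ε (matQuad K x) ^ 2)
    (g := gaussDensity K δ) (g' := fun x => -(f ⬝ᵥ (x - δ).ofLp) * gaussDensity K δ x)
    (v := WithLp.toLp 2 (K⁻¹ *ᵥ f))
    (i2.congr (.of_forall fun x => by simp; ring))
    (i1.neg.congr (.of_forall fun x => by simp; ring))
    (i3.congr (.of_forall fun x => by simp; ring))
    (fun x _ => hasLineDerivAt_dot_div hK f x (hasDerivAt_smoothMax hε b _) (hne x))
    (fun x _ => hasLineDerivAt_gaussDensity hK f δ x)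
  simp only [ContinuousLinearMap.mul_apply'] at key
  rw [← neg_inj, ← integral_neg]
  calc _ = _ := integral_congr_ae (.of_forall fun x => by simp; ring)
    _ = _ := key
    _ = _ := by
      congr 1
      exact integral_congr_ae (.of_forall fun x => by simp only; ring)

end Integrals

/-! ### Quadratic risk under a fixed Gaussian law -/

section FixedLaw

variable {k : ℕ}

lemma dot_eq_inner (f : Fin k → ℝ) (x : EuclideanSpace ℝ (Fin k)) :
    f ⬝ᵥ x.ofLp = inner ℝ (WithLp.toLp 2 f) x := by
  rw [real_inner_comm, EuclideanSpace.inner_eq_star_dotProduct]; simp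

lemma second_moment_multivariateGaussian {V : Matrix (Fin k) (Fin k) ℝ} (hV : V.PosSemidef)
    (μ δ : EuclideanSpace ℝ (Fin k)) (f : Fin k → ℝ) :
    Integrable (fun x => (f ⬝ᵥ (δ - x).ofLp) ^ 2) (multivariateGaussian μ V) ∧
      ∫ x, (f ⬝ᵥ (δ - x).ofLp) ^ 2 ∂multivariateGaussian μ V =
        f ⬝ᵥ (V *ᵥ f) + (f ⬝ᵥ (δ - μ).ofLp) ^ 2 := by
  set P := multivariateGaussian μ V
  have hid : MemLp id 2 P := IsGaussian.memLp_two_id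
  have h1 : MemLp (fun x : EuclideanSpace ℝ (Fin k) => inner ℝ (WithLp.toLp 2 f) x) 2 P :=
    hid.const_inner _
  have h2 : MemLp (fun x : EuclideanSpace ℝ (Fin k) => f ⬝ᵥ (δ - x).ofLp) 2 P := by
    simp_rw [dot_eq_inner, inner_sub_right]
    exact (memLp_const _).sub h1
  refine ⟨h2.integrable_sq, ?_⟩
  have hv : Var[fun x : EuclideanSpace ℝ (Fin k) => f ⬝ᵥ (δ - x).ofLp; P] = f ⬝ᵥ (V *ᵥ f) := by
    simp_rw [dot_eq_inner, inner_sub_right]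
    rw [variance_const_sub h1.aestronglyMeasurable.aemeasurable.aestronglyMeasurable,
      ← covarianceBilin_self hid, covarianceBilin_multivariateGaussian hV]
  have hm : ∫ x, f ⬝ᵥ (δ - x).ofLp ∂P = f ⬝ᵥ (δ - μ).ofLp := by
    simp_rw [dot_eq_inner, inner_sub_right]
    rw [integral_sub (integrable_const _) (h1.integrable one_le_two),
      integral_inner (f := fun x => x) (hid.integrable one_le_two)]
    simp [P]
  have := variance_eq_sub h2
  rw [hv, hm] at this
  simp only [Pi.pow_apply] at this
  linarith

open Classical in
/-- Stein's identity for the shrinkage factor `1 / max Q b`; for `b = 0` the factor is singular at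
the origin. -/
lemma stein_max (hk : 3 ≤ k) {K : Matrix (Fin k) (Fin k) ℝ} (hK : K.PosDef)
    (f : Fin k → ℝ) (δ : EuclideanSpace ℝ (Fin k)) {b : ℝ} (hb : 0 ≤ b) :
    Integrable (fun x => gaussDensity K δ x * ((f ⬝ᵥ (x - δ).ofLp) *
        ((f ⬝ᵥ x.ofLp) / max (matQuad K x) b))) ∧
    Integrable (fun x => gaussDensity K δ x * ((f ⬝ᵥ (K⁻¹ *ᵥ f)) / max (matQuad K x) b -
        2 * (if b < matQuad K x then 1 else 0) * (f ⬝ᵥ x.ofLp) ^ 2 /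
          max (matQuad K x) b ^ 2)) ∧
    ∫ x, gaussDensity K δ x * ((f ⬝ᵥ (x - δ).ofLp) *
        ((f ⬝ᵥ x.ofLp) / max (matQuad K x) b)) =
      ∫ x, gaussDensity K δ x * ((f ⬝ᵥ (K⁻¹ *ᵥ f)) / max (matQuad K x) b -
        2 * (if b < matQuad K x then 1 else 0) * (f ⬝ᵥ x.ofLp) ^ 2 /
          max (matQuad K x) b ^ 2) := by
  obtain ⟨κ, hκ, hκK⟩ := exists_le_matQuad hK
  set N := ‖WithLp.toLp 2 f‖ with hN
  have hN0 : 0 ≤ N := norm_nonneg _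
  have hfx (x : EuclideanSpace ℝ (Fin k)) : |f ⬝ᵥ x.ofLp| ≤ N * ‖x‖ := abs_dot_le f x
  have hcQ := continuous_matQuad K
  have hcm (ε : ℝ) : Measurable fun x => smoothMax b ε (matQuad K x) := by
    unfold smoothMax; exact Continuous.measurable (by fun_prop)
  have hcm' (ε : ℝ) : Measurable fun x => smoothMaxDeriv b ε (matQuad K x) := by
    have := hcQ.measurable
    unfold smoothMaxDeriv; fun_prop
  have hmQ (ε : ℝ) (x : EuclideanSpace ℝ (Fin k)) :
      κ * ‖x‖ ^ 2 ≤ smoothMax b ε (matQuad K x) :=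
    (hκK x).trans ((le_max_left _ _).trans (max_le_smoothMax _ _ _))
  have hae0 := ae_ne_zero hk
  have hmax (x : EuclideanSpace ℝ (Fin k)) (hx : x ≠ 0) : max (matQuad K x) b ≠ 0 := by
    have : 0 < ‖x‖ := norm_pos_iff.2 hx
    exact (lt_of_lt_of_le (by positivity) ((hκK x).trans (le_max_left _ _))).ne'
  have bound1 (ε : ℝ) (x : EuclideanSpace ℝ (Fin k)) (hx : x ≠ 0) :
      |(f ⬝ᵥ (x - δ).ofLp) * ((f ⬝ᵥ x.ofLp) / smoothMax b ε (matQuad K x))| ≤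
        (N ^ 2 / κ * (1 + ‖δ‖)) * (1 + ‖x‖ ^ 2 + (‖x‖ ^ 2)⁻¹) := by
    have hs0 : 0 < ‖x‖ := norm_pos_iff.2 hx
    have hs : |f ⬝ᵥ (x - δ).ofLp| ≤ N * (‖x‖ + ‖δ‖) :=
      (hfx _).trans (mul_le_mul_of_nonneg_left (norm_sub_le _ _) hN0)
    have hpos : 0 < κ * ‖x‖ ^ 2 := by positivity
    have hφ : |(f ⬝ᵥ x.ofLp) / smoothMax b ε (matQuad K x)| ≤ N * ‖x‖ / (κ * ‖x‖ ^ 2) := by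
      rw [abs_div, abs_of_pos (hpos.trans_le (hmQ ε x))]
      exact div_le_div₀ (by positivity) (hfx x) hpos (hmQ ε x)
    rw [abs_mul]
    calc _ ≤ (N * (‖x‖ + ‖δ‖)) * (N * ‖x‖ / (κ * ‖x‖ ^ 2)) :=
          mul_le_mul hs hφ (abs_nonneg _) (by positivity)
      _ = N ^ 2 / κ * (1 + ‖δ‖ * ‖x‖⁻¹) := by field_simp
      _ ≤ N ^ 2 / κ * ((1 + ‖δ‖) * (1 + ‖x‖ ^ 2 + (‖x‖ ^ 2)⁻¹)) := by
          refine mul_le_mul_of_nonneg_left ?_ (by positivity)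
          have e : (‖x‖ ^ 2)⁻¹ = ‖x‖⁻¹ ^ 2 := by rw [inv_pow]
          rw [e]
          nlinarith [norm_nonneg δ, sq_nonneg (‖x‖⁻¹ - 1), sq_nonneg ‖x‖⁻¹,
            mul_nonneg (norm_nonneg δ) (sq_nonneg (‖x‖⁻¹ - 1)), sq_nonneg ‖x‖,
            mul_nonneg (norm_nonneg δ) (sq_nonneg ‖x‖),
            mul_nonneg (norm_nonneg δ) (sq_nonneg ‖x‖⁻¹)]
      _ = _ := by ring
  have bound2 (ε : ℝ) (hε : 0 < ε) (x : EuclideanSpace ℝ (Fin k)) (hx : x ≠ 0) :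
      |(f ⬝ᵥ (K⁻¹ *ᵥ f)) / smoothMax b ε (matQuad K x) -
        2 * smoothMaxDeriv b ε (matQuad K x) * (f ⬝ᵥ x.ofLp) ^ 2 /
          smoothMax b ε (matQuad K x) ^ 2| ≤
        (|f ⬝ᵥ (K⁻¹ *ᵥ f)| / κ + 2 * N ^ 2 / κ ^ 2) * (1 + ‖x‖ ^ 2 + (‖x‖ ^ 2)⁻¹) := by
    have hs0 : 0 < ‖x‖ := norm_pos_iff.2 hx
    have hpos : 0 < κ * ‖x‖ ^ 2 := by positivity
    have hm0 := hpos.trans_le (hmQ ε x)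
    obtain ⟨d0, d1⟩ := smoothMaxDeriv_mem hε b (matQuad K x)
    have b1 : |(f ⬝ᵥ (K⁻¹ *ᵥ f)) / smoothMax b ε (matQuad K x)| ≤
        |f ⬝ᵥ (K⁻¹ *ᵥ f)| / (κ * ‖x‖ ^ 2) := by
      rw [abs_div, abs_of_pos hm0]
      exact div_le_div_of_nonneg_left (abs_nonneg _) hpos (hmQ ε x)
    have b2 : |2 * smoothMaxDeriv b ε (matQuad K x) * (f ⬝ᵥ x.ofLp) ^ 2 /
        smoothMax b ε (matQuad K x) ^ 2| ≤ 2 * 1 * (N ^ 2 * ‖x‖ ^ 2) / (κ * ‖x‖ ^ 2) ^ 2 := by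
      have hsq : (f ⬝ᵥ x.ofLp) ^ 2 ≤ N ^ 2 * ‖x‖ ^ 2 := by
        rw [← mul_pow, ← sq_abs]
        exact pow_le_pow_left₀ (abs_nonneg _) (hfx x) 2
      have hm2 : (κ * ‖x‖ ^ 2) ^ 2 ≤ smoothMax b ε (matQuad K x) ^ 2 :=
        pow_le_pow_left₀ (by positivity) (hmQ ε x) 2
      rw [abs_of_nonneg (by positivity)]
      apply div_le_div₀ (by positivity) _ (by positivity) hm2
      gcongr
    refine (abs_sub _ _).trans ((add_le_add b1 b2).trans ?_)
    calc _ = (|f ⬝ᵥ (K⁻¹ *ᵥ f)| / κ + 2 * N ^ 2 / κ ^ 2) * (‖x‖ ^ 2)⁻¹ := by field_simp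
      _ ≤ _ := by
        refine mul_le_mul_of_nonneg_left ?_ (by positivity)
        have := sq_nonneg ‖x‖
        linarith
  -- let `ε → 0` in the identity for `smoothMax b ε`; the bounds above do not depend on `ε`
  have hpos_ev : ∀ᶠ ε : ℝ in 𝓝[>] 0, 0 < ε := self_mem_nhdsWithin
  obtain ⟨I1, L1⟩ := tendsto_integral_gaussDensity (l := 𝓝[>] (0 : ℝ)) hk hK δ
    (F := fun ε x => (f ⬝ᵥ (x - δ).ofLp) * ((f ⬝ᵥ x.ofLp) / smoothMax b ε (matQuad K x)))
    (G := fun x => (f ⬝ᵥ (x - δ).ofLp) * ((f ⬝ᵥ x.ofLp) / max (matQuad K x) b))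
    (C := N ^ 2 / κ * (1 + ‖δ‖))
    (fun ε => by
      have := hcm ε
      have h1 : Measurable fun x : EuclideanSpace ℝ (Fin k) => f ⬝ᵥ (x - δ).ofLp :=
        Continuous.measurable (by fun_prop)
      have h2 : Measurable fun x : EuclideanSpace ℝ (Fin k) => f ⬝ᵥ x.ofLp :=
        Continuous.measurable (by fun_prop)
      exact (h1.mul (h2.div this)).aestronglyMeasurable)
    (hae0.mono fun x hx => .of_forall fun ε => bound1 ε x hx)
    (.of_forall fun ε => hae0.mono fun x hx => bound1 ε x hx)
    (hae0.mono fun x hx => (tendsto_const_nhds.div (tendsto_smoothMax b _) (hmax x hx)).const_mul _)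
  obtain ⟨I2, L2⟩ := tendsto_integral_gaussDensity (l := 𝓝[>] (0 : ℝ)) hk hK δ
    (F := fun ε x => (f ⬝ᵥ (K⁻¹ *ᵥ f)) / smoothMax b ε (matQuad K x) -
        2 * smoothMaxDeriv b ε (matQuad K x) * (f ⬝ᵥ x.ofLp) ^ 2 /
          smoothMax b ε (matQuad K x) ^ 2)
    (G := fun x => (f ⬝ᵥ (K⁻¹ *ᵥ f)) / max (matQuad K x) b -
        2 * (if b < matQuad K x then 1 else 0) * (f ⬝ᵥ x.ofLp) ^ 2 /
          max (matQuad K x) b ^ 2)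
    (C := |f ⬝ᵥ (K⁻¹ *ᵥ f)| / κ + 2 * N ^ 2 / κ ^ 2)
    (fun ε => by
      have := hcm ε
      have := hcm' ε
      have h2 : Measurable fun x : EuclideanSpace ℝ (Fin k) => f ⬝ᵥ x.ofLp :=
        Continuous.measurable (by fun_prop)
      exact Measurable.aestronglyMeasurable (by fun_prop))
    (hae0.mono fun x hx => hpos_ev.mono fun ε hε => bound2 ε hε x hx)
    (hpos_ev.mono fun ε hε => hae0.mono fun x hx => bound2 ε hε x hx)
    (by
      filter_upwards [hae0, ae_matQuad_ne hk hK b] with x hx hxb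
      exact (tendsto_const_nhds.div (tendsto_smoothMax b _) (hmax x hx)).sub
        ((((tendsto_smoothMaxDeriv hxb).const_mul 2).mul_const _).div
          ((tendsto_smoothMax b _).pow 2) (pow_ne_zero 2 (hmax x hx))))
  refine ⟨I1, I2, tendsto_nhds_unique L1 (L2.congr' ?_)⟩
  filter_upwards [hpos_ev] with ε hε
  exact (stein_smoothMax hk hK f δ hb hε).symm

open Classical in
/-- The integrand by which shrinkage with the factor `a / max Q b` lowers the quadratic risk in
direction `f`, where `Q` is the quadratic form of `K`. -/
noncomputable def riskGain (a b : ℝ) (K : Matrix (Fin k) (Fin k) ℝ) (f : Fin k → ℝ)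
    (x : EuclideanSpace ℝ (Fin k)) : ℝ :=
  2 * a * ((f ⬝ᵥ (K⁻¹ *ᵥ f)) / max (matQuad K x) b -
      2 * (if b < matQuad K x then 1 else 0) * (f ⬝ᵥ x.ofLp) ^ 2 / max (matQuad K x) b ^ 2) -
    (a / max (matQuad K x) b * (f ⬝ᵥ x.ofLp)) ^ 2

lemma abs_shrink_le {a b κ : ℝ} (ha : 0 ≤ a) (hκ : 0 < κ) {K : Matrix (Fin k) (Fin k) ℝ}
    (hK : ∀ x, κ * ‖x‖ ^ 2 ≤ matQuad K x) (f : Fin k → ℝ) (x : EuclideanSpace ℝ (Fin k)) :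
    (a / max (matQuad K x) b * (f ⬝ᵥ x.ofLp)) ^ 2 ≤
      (a * ‖WithLp.toLp 2 f‖ / κ) ^ 2 * (‖x‖ ^ 2)⁻¹ := by
  rcases eq_or_ne x 0 with rfl | hx
  · simp
  have hs0 : 0 < ‖x‖ := norm_pos_iff.2 hx
  have hpos : 0 < κ * ‖x‖ ^ 2 := by positivity
  have hm : κ * ‖x‖ ^ 2 ≤ max (matQuad K x) b := (hK x).trans (le_max_left _ _)
  have h1 : |a / max (matQuad K x) b * (f ⬝ᵥ x.ofLp)| ≤
      a / (κ * ‖x‖ ^ 2) * (‖WithLp.toLp 2 f‖ * ‖x‖) := by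
    rw [abs_mul, abs_div, abs_of_nonneg ha, abs_of_pos (hpos.trans_le hm)]
    exact mul_le_mul (div_le_div_of_nonneg_left ha hpos hm) (abs_dot_le f x) (abs_nonneg _)
      (by positivity)
  rw [← sq_abs]
  calc _ ≤ (a / (κ * ‖x‖ ^ 2) * (‖WithLp.toLp 2 f‖ * ‖x‖)) ^ 2 :=
        pow_le_pow_left₀ (abs_nonneg _) h1 2
    _ = _ := by field_simp

/-- Quadratic risk of shrinkage under a Gaussian law with precision matrix `K`. -/
lemma integral_shrink_sq (hk : 3 ≤ k) {K : Matrix (Fin k) (Fin k) ℝ} (hK : K.PosDef)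
    (f : Fin k → ℝ) (δ : EuclideanSpace ℝ (Fin k)) {a b : ℝ} (ha : 0 ≤ a) (hb : 0 ≤ b) :
    Integrable (fun x => gaussDensity K δ x * riskGain a b K f x) ∧
    ∫ x, gaussDensity K δ x * (f ⬝ᵥ (δ - x).ofLp +
        a / max (matQuad K x) b * (f ⬝ᵥ x.ofLp)) ^ 2 =
      f ⬝ᵥ (K⁻¹ *ᵥ f) - ∫ x, gaussDensity K δ x * riskGain a b K f x := by
  obtain ⟨κ, hκ, hκK⟩ := exists_le_matQuad hK
  obtain ⟨I1, I2, E⟩ := stein_max hk hK f δ hb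
  have hKi : K⁻¹⁻¹ = K := nonsing_inv_nonsing_inv _ ((isUnit_iff_isUnit_det _).1 hK.isUnit)
  have hmaxm : Measurable fun x => max (matQuad K x) b :=
    (continuous_matQuad K).measurable.max measurable_const
  have hfm : Measurable fun x : EuclideanSpace ℝ (Fin k) => f ⬝ᵥ x.ofLp :=
    Continuous.measurable (by fun_prop)
  have I3 := integrable_gaussDensity_mul hk hK δ
    (F := fun x => (a / max (matQuad K x) b * (f ⬝ᵥ x.ofLp)) ^ 2)
    (Measurable.aestronglyMeasurable (by fun_prop))
    (C := (a * ‖WithLp.toLp 2 f‖ / κ) ^ 2) (.of_forall fun x => by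
      rw [abs_of_nonneg (sq_nonneg _)]
      refine (abs_shrink_le ha hκ hκK f x).trans
        (mul_le_mul_of_nonneg_left ?_ (sq_nonneg _))
      have := sq_nonneg ‖x‖
      linarith)
  obtain ⟨I4, E4⟩ := second_moment_multivariateGaussian hK.inv.posSemidef δ δ f
  rw [integrable_multivariateGaussian_iff hK.inv, hKi] at I4
  rw [integral_multivariateGaussian hK.inv, hKi] at E4
  have IG : Integrable (fun x => gaussDensity K δ x * riskGain a b K f x) := by
    refine ((I2.const_mul (2 * a)).sub I3).congr (.of_forall fun x => ?_)
    simp only [Pi.sub_apply, riskGain]; ring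
  refine ⟨IG, ?_⟩
  have e1 : ∫ x, gaussDensity K δ x * riskGain a b K f x =
      2 * a * (∫ x, gaussDensity K δ x * ((f ⬝ᵥ (x - δ).ofLp) *
        ((f ⬝ᵥ x.ofLp) / max (matQuad K x) b))) -
      ∫ x, gaussDensity K δ x * (a / max (matQuad K x) b * (f ⬝ᵥ x.ofLp)) ^ 2 := by
    rw [E, ← integral_const_mul, ← integral_sub (I2.const_mul _) I3]
    refine integral_congr_ae (.of_forall fun x => ?_)
    simp only [riskGain]; ring
  have e2 : ∫ x, gaussDensity K δ x * (f ⬝ᵥ (δ - x).ofLp +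
        a / max (matQuad K x) b * (f ⬝ᵥ x.ofLp)) ^ 2 =
      (∫ x, gaussDensity K δ x * (f ⬝ᵥ (δ - x).ofLp) ^ 2) -
      2 * a * (∫ x, gaussDensity K δ x * ((f ⬝ᵥ (x - δ).ofLp) *
        ((f ⬝ᵥ x.ofLp) / max (matQuad K x) b))) +
      ∫ x, gaussDensity K δ x * (a / max (matQuad K x) b * (f ⬝ᵥ x.ofLp)) ^ 2 := by
    rw [← integral_const_mul, ← integral_sub I4 (I1.const_mul _)]
    refine Eq.trans ?_ (integral_add (I4.sub (I1.const_mul (2 * a))) I3)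
    refine integral_congr_ae (.of_forall fun x => ?_)
    have : f ⬝ᵥ (x - δ).ofLp = -(f ⬝ᵥ (δ - x).ofLp) := by
      rw [← dotProduct_neg, ← WithLp.ofLp_neg, neg_sub]
    simp only [this]; ring
  rw [e2, e1, E4]
  simp
  ring

end FixedLaw

/-! ### Asymptotic risk of shrinkage -/

section AsymptoticShrinkage

variable {k : ℕ}

lemma abs_dotProduct_mulVec_le (M : Matrix (Fin k) (Fin k) ℝ) (f : Fin k → ℝ) {B : ℝ}
    (hf : ‖WithLp.toLp 2 f‖ ≤ B) : |f ⬝ᵥ (M *ᵥ f)| ≤ (∑ i, ∑ j, |M i j|) * B ^ 2 :=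
  (abs_matQuad_le M (WithLp.toLp 2 f)).trans (by gcongr)

lemma measurable_riskGain (a b : ℝ) (K : Matrix (Fin k) (Fin k) ℝ) (f : Fin k → ℝ) :
    Measurable (riskGain a b K f) := by
  have hq : Measurable (matQuad K) := (continuous_matQuad K).measurable
  have hf : Measurable fun x : EuclideanSpace ℝ (Fin k) => f ⬝ᵥ x.ofLp :=
    Continuous.measurable (by fun_prop)
  have hm : Measurable fun x => max (matQuad K x) b := hq.max measurable_const
  have hi : Measurable fun x => if b < matQuad K x then (1 : ℝ) else 0 :=
    Measurable.ite (measurableSet_lt measurable_const hq) measurable_const measurable_const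
  unfold riskGain
  fun_prop

lemma exists_abs_riskGain_le {K : Matrix (Fin k) (Fin k) ℝ} (hK : K.PosDef) {a : ℝ} (ha : 0 ≤ a)
    (b B : ℝ) : ∃ C, 0 ≤ C ∧ ∀ f : Fin k → ℝ, ‖WithLp.toLp 2 f‖ ≤ B → ∀ x, x ≠ 0 →
      |riskGain a b K f x| ≤ C * (1 + ‖x‖ ^ 2 + (‖x‖ ^ 2)⁻¹) := by
  obtain ⟨κ, hκ, hκK⟩ := exists_le_matQuad hK
  set A := ∑ i, ∑ j, |K⁻¹ i j| with hA
  have hA0 : 0 ≤ A := Finset.sum_nonneg fun _ _ => Finset.sum_nonneg fun _ _ => abs_nonneg _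
  refine ⟨2 * a * (A * B ^ 2 / κ + 2 * B ^ 2 / κ ^ 2) + (a * B / κ) ^ 2, by positivity,
    fun f hf x hx => ?_⟩
  have hs0 : 0 < ‖x‖ := norm_pos_iff.2 hx
  have hpos : 0 < κ * ‖x‖ ^ 2 := by positivity
  have hm : κ * ‖x‖ ^ 2 ≤ max (matQuad K x) b := (hκK x).trans (le_max_left _ _)
  have hm0 := hpos.trans_le hm
  have hfx : |f ⬝ᵥ x.ofLp| ≤ B * ‖x‖ := (abs_dot_le f x).trans (by gcongr)
  have b1 : |(f ⬝ᵥ (K⁻¹ *ᵥ f)) / max (matQuad K x) b| ≤ A * B ^ 2 / (κ * ‖x‖ ^ 2) := by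
    rw [abs_div, abs_of_pos hm0]
    exact div_le_div₀ (by positivity) (abs_dotProduct_mulVec_le _ f hf) hpos hm
  have b2 : |2 * (if b < matQuad K x then (1 : ℝ) else 0) * (f ⬝ᵥ x.ofLp) ^ 2 /
      max (matQuad K x) b ^ 2| ≤ 2 * 1 * (B ^ 2 * ‖x‖ ^ 2) / (κ * ‖x‖ ^ 2) ^ 2 := by
    have hsq : (f ⬝ᵥ x.ofLp) ^ 2 ≤ B ^ 2 * ‖x‖ ^ 2 := by
      rw [← mul_pow, ← sq_abs]
      exact pow_le_pow_left₀ (abs_nonneg _) hfx 2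
    have hi0 : 0 ≤ (if b < matQuad K x then (1 : ℝ) else 0) := by split_ifs <;> norm_num
    have hi1 : (if b < matQuad K x then (1 : ℝ) else 0) ≤ 1 := by split_ifs <;> norm_num
    rw [abs_of_nonneg (by positivity)]
    apply div_le_div₀ (by positivity) _ (by positivity)
      (pow_le_pow_left₀ (by positivity) hm 2)
    gcongr
  have b3 := abs_shrink_le (b := b) ha hκ hκK f x
  have b4 : (a * ‖WithLp.toLp 2 f‖ / κ) ^ 2 ≤ (a * B / κ) ^ 2 := by gcongr
  have hw : 0 ≤ (‖x‖ ^ 2)⁻¹ := by positivity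
  rw [riskGain]
  refine (abs_sub _ _).trans ?_
  rw [abs_mul, abs_of_nonneg (by positivity : 0 ≤ 2 * a),
    abs_of_nonneg (sq_nonneg (a / max (matQuad K x) b * (f ⬝ᵥ x.ofLp)))]
  calc _ ≤ 2 * a * (A * B ^ 2 / (κ * ‖x‖ ^ 2) +
          2 * 1 * (B ^ 2 * ‖x‖ ^ 2) / (κ * ‖x‖ ^ 2) ^ 2) + (a * B / κ) ^ 2 * (‖x‖ ^ 2)⁻¹ := by
        refine add_le_add (mul_le_mul_of_nonneg_left ((abs_sub _ _).trans (add_le_add b1 b2))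
          (by positivity)) (b3.trans (mul_le_mul_of_nonneg_right b4 hw))
    _ = (2 * a * (A * B ^ 2 / κ + 2 * B ^ 2 / κ ^ 2) + (a * B / κ) ^ 2) * (‖x‖ ^ 2)⁻¹ := by
        field_simp
    _ ≤ _ := by
        refine mul_le_mul_of_nonneg_left ?_ (by positivity)
        have := sq_nonneg ‖x‖
        linarith

lemma sq_shrink_le {a b κ B : ℝ} (ha : 0 ≤ a) (hκ : 0 < κ) {K : Matrix (Fin k) (Fin k) ℝ}
    (hK : ∀ x, κ * ‖x‖ ^ 2 ≤ matQuad K x) {f : Fin k → ℝ} (hf : ‖WithLp.toLp 2 f‖ ≤ B)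
    (δ x : EuclideanSpace ℝ (Fin k)) :
    |(f ⬝ᵥ (δ - x).ofLp + a / max (matQuad K x) b * (f ⬝ᵥ x.ofLp)) ^ 2| ≤
      (4 * B ^ 2 * (1 + ‖δ‖ ^ 2) + 2 * (a * B / κ) ^ 2) * (1 + ‖x‖ ^ 2 + (‖x‖ ^ 2)⁻¹) := by
  have h1 : |f ⬝ᵥ (δ - x).ofLp| ≤ B * (‖δ‖ + ‖x‖) :=
    (abs_dot_le f _).trans (mul_le_mul hf (norm_sub_le _ _) (norm_nonneg _)
      ((norm_nonneg _).trans hf))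
  have h2 : (f ⬝ᵥ (δ - x).ofLp) ^ 2 ≤ B ^ 2 * (‖δ‖ + ‖x‖) ^ 2 := by
    rw [← sq_abs, ← mul_pow]
    exact pow_le_pow_left₀ (abs_nonneg _) h1 2
  have h3 := abs_shrink_le (b := b) ha hκ hK f x
  have h4 : (a * ‖WithLp.toLp 2 f‖ / κ) ^ 2 ≤ (a * B / κ) ^ 2 := by gcongr
  have hw : 0 ≤ (‖x‖ ^ 2)⁻¹ := by positivity
  have h5 := h3.trans (mul_le_mul_of_nonneg_right h4 hw)
  rw [abs_of_nonneg (sq_nonneg _)]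
  have h6 : (‖δ‖ + ‖x‖) ^ 2 ≤ 2 * ((1 + ‖δ‖ ^ 2) * (1 + ‖x‖ ^ 2 + (‖x‖ ^ 2)⁻¹)) := by
    nlinarith [sq_nonneg (‖δ‖ - ‖x‖), mul_nonneg (sq_nonneg ‖δ‖) hw,
      mul_nonneg (sq_nonneg ‖δ‖) (sq_nonneg ‖x‖)]
  have h7 := mul_le_mul_of_nonneg_left h6 (sq_nonneg B)
  have h8 : (a * B / κ) ^ 2 * (‖x‖ ^ 2)⁻¹ ≤
      (a * B / κ) ^ 2 * (1 + ‖x‖ ^ 2 + (‖x‖ ^ 2)⁻¹) := by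
    refine mul_le_mul_of_nonneg_left ?_ (sq_nonneg _)
    have := sq_nonneg ‖x‖
    linarith
  have h9 := add_sq_le (a := f ⬝ᵥ (δ - x).ofLp)
    (b := a / max (matQuad K x) b * (f ⬝ᵥ x.ofLp))
  linarith

lemma measurable_shrink (a b : ℝ) (K : Matrix (Fin k) (Fin k) ℝ) (f : Fin k → ℝ)
    (δ : EuclideanSpace ℝ (Fin k)) :
    Measurable fun x : EuclideanSpace ℝ (Fin k) =>
      f ⬝ᵥ (δ - x).ofLp + a / max (matQuad K x) b * (f ⬝ᵥ x.ofLp) := by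
  have hq : Measurable (matQuad K) := (continuous_matQuad K).measurable
  have hf : Measurable fun x : EuclideanSpace ℝ (Fin k) => f ⬝ᵥ x.ofLp :=
    Continuous.measurable (by fun_prop)
  have hf' : Measurable fun x : EuclideanSpace ℝ (Fin k) => f ⬝ᵥ (δ - x).ofLp :=
    Continuous.measurable (by fun_prop)
  have hm : Measurable fun x => max (matQuad K x) b := hq.max measurable_const
  fun_prop

/-- Limiting quadratic risk of shrinkage when the precision matrices `J n` of the Gaussian laws and
the matrices `Kn n` defining the shrinkage factor have the same limit. The vectors `f n` need not
converge. -/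
theorem tendsto_shrink_risk (hk : 3 ≤ k) {K : Matrix (Fin k) (Fin k) ℝ} (hK : K.PosDef)
    {Kn J : ℕ → Matrix (Fin k) (Fin k) ℝ} (hKn : Tendsto Kn atTop (𝓝 K))
    (hJ : Tendsto J atTop (𝓝 K)) (hJp : ∀ᶠ n in atTop, (J n).PosDef)
    {μ : ℕ → EuclideanSpace ℝ (Fin k)} {δ : EuclideanSpace ℝ (Fin k)}
    (hμ : Tendsto μ atTop (𝓝 δ)) {f : ℕ → Fin k → ℝ} {B : ℝ}
    (hf : ∀ᶠ n in atTop, ‖WithLp.toLp 2 (f n)‖ ≤ B) {a b ω : ℝ} (ha : 0 ≤ a) (hb : 0 ≤ b)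
    (hω : Tendsto (fun n => f n ⬝ᵥ (K⁻¹ *ᵥ f n)) atTop (𝓝 ω))
    {g : EuclideanSpace ℝ (Fin k) → ℝ}
    (hg : ∀ᵐ x, Tendsto (fun n => riskGain a b K (f n) x) atTop (𝓝 (g x))) :
    (∀ᶠ n in atTop, Integrable fun x => gaussDensity (J n) (μ n) x *
      (f n ⬝ᵥ (δ - x).ofLp + a / max (matQuad (Kn n) x) b * (f n ⬝ᵥ x.ofLp)) ^ 2) ∧
    Integrable (fun x => gaussDensity K δ x * g x) ∧
    Tendsto (fun n => ∫ x, gaussDensity (J n) (μ n) x *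
      (f n ⬝ᵥ (δ - x).ofLp + a / max (matQuad (Kn n) x) b * (f n ⬝ᵥ x.ofLp)) ^ 2) atTop
      (𝓝 (ω - ∫ x, gaussDensity K δ x * g x)) := by
  obtain ⟨κ, hκ, hκK, hκn⟩ := eventually_le_matQuad hK hKn
  set C := 4 * B ^ 2 * (1 + ‖δ‖ ^ 2) + 2 * (a * B / κ) ^ 2
  have hFC : ∀ᶠ n in atTop, ∀ᵐ x, |(f n ⬝ᵥ (δ - x).ofLp +
      a / max (matQuad (Kn n) x) b * (f n ⬝ᵥ x.ofLp)) ^ 2| ≤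
        C * (1 + ‖x‖ ^ 2 + (‖x‖ ^ 2)⁻¹) := by
    filter_upwards [hκn, hf] with n h1 h2
    exact .of_forall fun x => sq_shrink_le ha hκ h1 h2 δ x
  have hGC : ∀ᶠ n in atTop, ∀ x, |(f n ⬝ᵥ (δ - x).ofLp +
      a / max (matQuad K x) b * (f n ⬝ᵥ x.ofLp)) ^ 2| ≤
        C * (1 + ‖x‖ ^ 2 + (‖x‖ ^ 2)⁻¹) := by
    filter_upwards [hf] with n h2
    exact fun x => sq_shrink_le ha hκ hκK h2 δ x
  have hFG : ∀ᵐ x, Tendsto (fun n =>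
      (f n ⬝ᵥ (δ - x).ofLp + a / max (matQuad (Kn n) x) b * (f n ⬝ᵥ x.ofLp)) ^ 2 -
      (f n ⬝ᵥ (δ - x).ofLp + a / max (matQuad K x) b * (f n ⬝ᵥ x.ofLp)) ^ 2) atTop (𝓝 0) := by
    filter_upwards [ae_ne_zero hk] with x hx
    have hs0 : 0 < ‖x‖ := norm_pos_iff.2 hx
    have hmax : max (matQuad K x) b ≠ 0 :=
      (lt_of_lt_of_le (by positivity) ((hκK x).trans (le_max_left _ _))).ne'
    have t1 : Tendsto (fun n => a / max (matQuad (Kn n) x) b) atTop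
        (𝓝 (a / max (matQuad K x) b)) :=
      tendsto_const_nhds.div ((tendsto_matQuad hKn tendsto_const_nhds).max tendsto_const_nhds) hmax
    have t2 : Tendsto (fun n => a / max (matQuad (Kn n) x) b - a / max (matQuad K x) b) atTop
        (𝓝 0) := by simpa using t1.sub_const (a / max (matQuad K x) b)
    have t3 : Tendsto (fun n => (a / max (matQuad (Kn n) x) b) ^ 2 -
        (a / max (matQuad K x) b) ^ 2) atTop (𝓝 0) := by
      have := (t1.pow 2).sub_const ((a / max (matQuad K x) b) ^ 2)
      rwa [sub_self] at this
    have bd (z : EuclideanSpace ℝ (Fin k)) : ∀ᶠ n in atTop, |f n ⬝ᵥ z.ofLp| ≤ B * ‖z‖ := by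
      filter_upwards [hf] with n hn
      exact (abs_dot_le _ _).trans (by gcongr)
    have u1 : Tendsto (fun n => (a / max (matQuad (Kn n) x) b - a / max (matQuad K x) b) *
        (2 * (f n ⬝ᵥ x.ofLp) * (f n ⬝ᵥ (δ - x).ofLp))) atTop (𝓝 0) := by
      refine t2.zero_mul_isBoundedUnder_le ⟨2 * (B * ‖x‖) * (B * ‖δ - x‖), eventually_map.2 ?_⟩
      filter_upwards [bd x, bd (δ - x)] with n h1 h2
      simp only [Function.comp_apply, Real.norm_eq_abs, abs_mul, abs_two]
      have : 0 ≤ B * ‖x‖ := (abs_nonneg _).trans h1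
      gcongr
    have u2 : Tendsto (fun n => ((a / max (matQuad (Kn n) x) b) ^ 2 -
        (a / max (matQuad K x) b) ^ 2) * (f n ⬝ᵥ x.ofLp) ^ 2) atTop (𝓝 0) := by
      refine t3.zero_mul_isBoundedUnder_le ⟨(B * ‖x‖) ^ 2, eventually_map.2 ?_⟩
      filter_upwards [bd x] with n h1
      simp only [Function.comp_apply, Real.norm_eq_abs, abs_pow]
      gcongr
    have u3 := u1.add u2
    rw [add_zero] at u3
    exact u3.congr fun n => by ring
  have L1 := tendsto_integral_gaussDensity_sub hk hK hJ hJp hμ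
    (F := fun n x => (f n ⬝ᵥ (δ - x).ofLp +
      a / max (matQuad (Kn n) x) b * (f n ⬝ᵥ x.ofLp)) ^ 2)
    (G := fun n x => (f n ⬝ᵥ (δ - x).ofLp +
      a / max (matQuad K x) b * (f n ⬝ᵥ x.ofLp)) ^ 2)
    (fun n => ((measurable_shrink _ _ _ _ _).pow_const 2).aestronglyMeasurable)
    (fun n => ((measurable_shrink _ _ _ _ _).pow_const 2).aestronglyMeasurable)
    hFC (hGC.mono fun n hn => .of_forall hn) hFG
    (.of_forall fun x => hGC.mono fun n hn => hn x)
  obtain ⟨C', -, hC'⟩ := exists_abs_riskGain_le hK ha b B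
  obtain ⟨Ig, Lg⟩ := tendsto_integral_gaussDensity hk hK δ
    (F := fun n => riskGain a b K (f n)) (G := g) (C := C')
    (fun n => (measurable_riskGain _ _ _ _).aestronglyMeasurable)
    ((ae_ne_zero hk).mono fun x hx => hf.mono fun n hn => hC' _ hn x hx)
    (hf.mono fun n hn => (ae_ne_zero hk).mono fun x hx => hC' _ hn x hx) hg
  refine ⟨?_, Ig, ?_⟩
  · filter_upwards [hFC, hJp] with n h1 h2
    exact integrable_gaussDensity_mul hk h2 _
      ((measurable_shrink _ _ _ _ _).pow_const 2).aestronglyMeasurable h1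
  · have L2 := hω.sub Lg
    have L3 := L1.add L2
    rw [zero_add] at L3
    refine L3.congr fun n => ?_
    rw [(integral_shrink_sq hk hK (f n) δ ha hb).2]
    ring

end AsymptoticShrinkage

/-! ### Linear images of Gaussian errors -/

section LinearImages

variable {Ω : Type*} [MeasurableSpace Ω] {P : Measure Ω} {n k : ℕ}
  {v : NNReal} {e : Fin n → Ω → ℝ}

lemma hasGaussianLaw_errors (hi : iIndepFun e P)
    (hl : ∀ i, HasLaw (e i) (gaussianReal 0 v) P) :
    HasGaussianLaw (fun ω => (e · ω)) P :=
  hi.hasGaussianLaw fun i => ⟨by rw [(hl i).map_eq]; infer_instance⟩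

lemma memLp_error (hl : ∀ i, HasLaw (e i) (gaussianReal 0 v) P) (i : Fin n) :
    MemLp (e i) 2 P := by
  have : HasGaussianLaw (e i) P := ⟨by rw [(hl i).map_eq]; infer_instance⟩
  exact this.memLp_two

lemma memLp_dot_errors (hl : ∀ i, HasLaw (e i) (gaussianReal 0 v) P)
    (p : Fin n → ℝ) : MemLp (fun ω => p ⬝ᵥ (e · ω)) 2 P := by
  simp only [dotProduct]
  exact memLp_finsetSum _ fun i _ => (memLp_error hl i).const_mul (p i)

variable [IsProbabilityMeasure P]

lemma integral_dot_errors (hl : ∀ i, HasLaw (e i) (gaussianReal 0 v) P)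
    (p : Fin n → ℝ) : ∫ ω, p ⬝ᵥ (e · ω) ∂P = 0 := by
  simp only [dotProduct]
  rw [integral_finsetSum _ fun i _ =>
    ((memLp_error hl i).integrable one_le_two).const_mul (p i)]
  refine Finset.sum_eq_zero fun i _ => ?_
  rw [integral_const_mul, (hl i).integral_eq]
  simp

lemma covariance_dot_errors (hi : iIndepFun e P)
    (hl : ∀ i, HasLaw (e i) (gaussianReal 0 v) P) (p q : Fin n → ℝ) :
    cov[fun ω => p ⬝ᵥ (e · ω), fun ω => q ⬝ᵥ (e · ω); P] = (v : ℝ) * (p ⬝ᵥ q) := by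
  simp only [dotProduct]
  rw [covariance_fun_sum_fun_sum (fun i => (memLp_error hl i).const_mul (p i))
    (fun i => (memLp_error hl i).const_mul (q i)), Finset.mul_sum]
  refine Finset.sum_congr rfl fun i _ => ?_
  rw [Finset.sum_eq_single i]
  · rw [covariance_const_mul_left, covariance_const_mul_right,
      covariance_self (hl i).aemeasurable, (hl i).variance_eq]
    simp
    ring
  · intro j _ hj
    rw [covariance_const_mul_left, covariance_const_mul_right,
      (hi.indepFun hj.symm).covariance_eq_zero (memLp_error hl i) (memLp_error hl j)]
    simp
  · simp

lemma hasLaw_affine_errors (hi : iIndepFun e P)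
    (hl : ∀ i, HasLaw (e i) (gaussianReal 0 v) P)
    (m : EuclideanSpace ℝ (Fin k)) (B : Matrix (Fin k) (Fin n) ℝ) :
    HasLaw (fun ω => m + WithLp.toLp 2 (B *ᵥ (e · ω)))
      (multivariateGaussian m ((v : ℝ) • (B * Bᵀ))) P := by
  have hG := hasGaussianLaw_errors hi hl
  set L : (Fin n → ℝ) →L[ℝ] EuclideanSpace ℝ (Fin k) :=
    LinearMap.toContinuousLinearMap
      ((WithLp.linearEquiv 2 ℝ (Fin k → ℝ)).symm.toLinearMap ∘ₗ B.mulVecLin) with hL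
  have hW : HasGaussianLaw (fun ω => WithLp.toLp 2 (B *ᵥ (e · ω))) P := hG.map_fun L
  have hWae := hW.aemeasurable
  have hpsd : ((v : ℝ) • (B * Bᵀ)).PosSemidef := by
    have := posSemidef_self_mul_conjTranspose B
    rw [conjTranspose_eq_transpose_of_trivial] at this
    exact this.smul (v.coe_nonneg)
  refine ⟨by fun_prop, ?_⟩
  have hdot (x : EuclideanSpace ℝ (Fin k)) (z : Fin n → ℝ) :
      inner ℝ x (WithLp.toLp 2 (B *ᵥ z)) = (Bᵀ *ᵥ x.ofLp) ⬝ᵥ z := by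
    rw [← dot_eq_inner x.ofLp, mulVec_transpose]
    simp [dotProduct_mulVec]
  have key : P.map (fun ω => WithLp.toLp 2 (B *ᵥ (e · ω))) =
      multivariateGaussian 0 ((v : ℝ) • (B * Bᵀ)) := by
    have := hW.isGaussian_map
    apply IsGaussian.ext
    · rw [integral_map hWae aestronglyMeasurable_id]
      simp only [id]
      rw [integral_id_multivariateGaussian]
      have hint : Integrable (fun ω => WithLp.toLp 2 (B *ᵥ (e · ω))) P := hW.integrable
      apply ext_inner_left ℝ
      intro x
      rw [← integral_inner hint, inner_zero_right]
      simp_rw [hdot]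
      exact integral_dot_errors hl _
    · ext x y
      rw [covarianceBilin_apply_eq_cov IsGaussian.memLp_two_id,
        covarianceBilin_multivariateGaussian hpsd, covariance_map (by fun_prop) (by fun_prop) hWae]
      simp only [Function.comp_def, hdot]
      rw [covariance_dot_errors hi hl, mulVec_transpose, ← dotProduct_mulVec]
      simp [smul_mulVec, mulVec_mulVec]
  have e1 : (fun ω => m + WithLp.toLp 2 (B *ᵥ (e · ω))) =
      (fun x => m + x) ∘ (fun ω => WithLp.toLp 2 (B *ᵥ (e · ω))) := rfl
  rw [e1, ← AEMeasurable.map_map_of_aemeasurable (by fun_prop) hWae, key, multivariateGaussian,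
    multivariateGaussian, Measure.map_map (by fun_prop) (by fun_prop)]
  congr 1
  ext1 x
  simp

/-- The covariance of the two Gaussian images is a multiple of `B a`. -/
lemma indepFun_errors (hi : iIndepFun e P)
    (hl : ∀ i, HasLaw (e i) (gaussianReal 0 v) P)
    {a : Fin n → ℝ} {B : Matrix (Fin k) (Fin n) ℝ} (h : B *ᵥ a = 0) :
    IndepFun (fun ω => a ⬝ᵥ (e · ω)) (fun ω => WithLp.toLp 2 (B *ᵥ (e · ω))) P := by
  have hG := hasGaussianLaw_errors hi hl
  set L : (Fin n → ℝ) →L[ℝ] ℝ × EuclideanSpace ℝ (Fin k) :=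
    LinearMap.toContinuousLinearMap
      ((LinearMap.mk (AddHom.mk (fun z => a ⬝ᵥ z) (dotProduct_add a))
        (fun c z => dotProduct_smul c a z)).prod
      ((WithLp.linearEquiv 2 ℝ (Fin k → ℝ)).symm.toLinearMap ∘ₗ B.mulVecLin)) with hL
  have hW : HasGaussianLaw (fun ω => ((a ⬝ᵥ (e · ω)), WithLp.toLp 2 (B *ᵥ (e · ω)))) P :=
    hG.map_fun L
  have hdot (x : EuclideanSpace ℝ (Fin k)) (z : Fin n → ℝ) :
      inner ℝ x (WithLp.toLp 2 (B *ᵥ z)) = (Bᵀ *ᵥ x.ofLp) ⬝ᵥ z := by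
    rw [← dot_eq_inner x.ofLp, mulVec_transpose]
    simp [dotProduct_mulVec]
  refine hW.indepFun_of_covariance_inner fun x y => ?_
  simp only [hdot, Real.inner_apply]
  rw [covariance_const_mul_left, covariance_dot_errors hi hl, dotProduct_comm, mulVec_transpose,
    ← dotProduct_mulVec, h]
  simp

/-- The second moment splits because `a'e` is centred and independent of `B e`. -/
lemma second_moment_split (hi : iIndepFun e P)
    (hl : ∀ i, HasLaw (e i) (gaussianReal 0 v) P)
    {a : Fin n → ℝ} {B : Matrix (Fin k) (Fin n) ℝ} (h : B *ᵥ a = 0)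
    (m : EuclideanSpace ℝ (Fin k)) {F : EuclideanSpace ℝ (Fin k) → ℝ} (hF : Measurable F)
    (hF2 : Integrable (fun x => F x ^ 2) (multivariateGaussian m ((v : ℝ) • (B * Bᵀ)))) :
    Integrable (fun ω => (a ⬝ᵥ (e · ω) + F (m + WithLp.toLp 2 (B *ᵥ (e · ω)))) ^ 2) P ∧
    ∫ ω, (a ⬝ᵥ (e · ω) + F (m + WithLp.toLp 2 (B *ᵥ (e · ω)))) ^ 2 ∂P =
      (v : ℝ) * (a ⬝ᵥ a) + ∫ x, F x ^ 2 ∂multivariateGaussian m ((v : ℝ) • (B * Bᵀ)) := by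
  have hlaw := hasLaw_affine_errors hi hl m B
  set W := fun ω => m + WithLp.toLp 2 (B *ᵥ (e · ω)) with hW
  set X := fun ω => a ⬝ᵥ (e · ω) with hX
  have hX2 : MemLp X 2 P := memLp_dot_errors hl a
  have hF' : MemLp F 2 (multivariateGaussian m ((v : ℝ) • (B * Bᵀ))) :=
    (memLp_two_iff_integrable_sq hF.aestronglyMeasurable).2 hF2
  have hFW : MemLp (fun ω => F (W ω)) 2 P := by
    rw [← hlaw.map_eq] at hF'
    exact hF'.comp_of_map hlaw.aemeasurable
  have hind : IndepFun X (fun ω => F (W ω)) P :=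
    (indepFun_errors hi hl h).comp measurable_id (hF.comp (measurable_const_add m))
  have hsum : MemLp (fun ω => X ω + F (W ω)) 2 P := hX2.add hFW
  refine ⟨hsum.integrable_sq, ?_⟩
  have hXF : Integrable (fun ω => X ω * F (W ω)) P := hX2.integrable_mul hFW
  have e1 : ∀ ω, (X ω + F (W ω)) ^ 2 = X ω ^ 2 + (2 * (X ω * F (W ω)) + F (W ω) ^ 2) :=
    fun ω => by ring
  have e0 : ∫ ω, (X ω + F (W ω)) ^ 2 ∂P =
      ∫ ω, (X ω ^ 2 + (2 * (X ω * F (W ω)) + F (W ω) ^ 2)) ∂P :=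
    integral_congr_ae (.of_forall e1)
  refine e0.trans ?_
  have a1 : Integrable (fun ω => 2 * (X ω * F (W ω)) + F (W ω) ^ 2) P :=
    (hXF.const_mul 2).add hFW.integrable_sq
  rw [integral_add hX2.integrable_sq a1,
    integral_add (hXF.const_mul 2) hFW.integrable_sq, integral_const_mul]
  have e2 : ∫ ω, X ω * F (W ω) ∂P = 0 := by
    rw [hind.integral_fun_mul_eq_mul_integral hX2.aestronglyMeasurable hFW.aestronglyMeasurable,
      integral_dot_errors hl a, zero_mul]
  have e3 : ∫ ω, X ω ^ 2 ∂P = (v : ℝ) * (a ⬝ᵥ a) := by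
    rw [← covariance_dot_errors hi hl a a, covariance_self hX2.aestronglyMeasurable.aemeasurable,
      variance_of_integral_eq_zero hX2.aestronglyMeasurable.aemeasurable
        (integral_dot_errors hl a)]
  have e4 : ∫ ω, F (W ω) ^ 2 ∂P = ∫ x, F x ^ 2 ∂multivariateGaussian m ((v : ℝ) • (B * Bᵀ)) := by
    rw [← hlaw.map_eq, integral_map hlaw.aemeasurable (hF.pow_const 2).aestronglyMeasurable]
  rw [e2, e3, e4]
  ring

end LinearImages

/-! ### Representation of the estimators through linear images of the errors -/

section Representation

variable {n m k l : ℕ} (X₁ : Matrix (Fin n) (Fin m) ℝ) (X₂ : Matrix (Fin n) (Fin k) ℝ)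

lemma sampleGram_toBlocks₁₁ : (sampleGram X₁ X₂).toBlocks₁₁ = (n : ℝ)⁻¹ • (X₁ᵀ * X₁) := by
  ext i j; simp [sampleGram, toBlocks₁₁, mul_apply, fromCols]

lemma sampleGram_toBlocks₁₂ : (sampleGram X₁ X₂).toBlocks₁₂ = (n : ℝ)⁻¹ • (X₁ᵀ * X₂) := by
  ext i j; simp [sampleGram, toBlocks₁₂, mul_apply, fromCols]

lemma sampleGram_toBlocks₂₁ : (sampleGram X₁ X₂).toBlocks₂₁ = (n : ℝ)⁻¹ • (X₂ᵀ * X₁) := by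
  ext i j; simp [sampleGram, toBlocks₂₁, mul_apply, fromCols]

lemma sampleGram_toBlocks₂₂ : (sampleGram X₁ X₂).toBlocks₂₂ = (n : ℝ)⁻¹ • (X₂ᵀ * X₂) := by
  ext i j; simp [sampleGram, toBlocks₂₂, mul_apply, fromCols]

lemma posSemidef_sampleGram : (sampleGram X₁ X₂).PosSemidef := by
  have h := posSemidef_conjTranspose_mul_self (fromCols X₁ X₂)
  rw [conjTranspose_eq_transpose_of_trivial] at h
  exact h.smul (by positivity : (0 : ℝ) ≤ (n : ℝ)⁻¹)

variable {X₁ X₂}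

lemma posDef_gram₁ (hn : 0 < n) (hS : (sampleGram X₁ X₂).PosDef) : (X₁ᵀ * X₁).PosDef := by
  have hn' : (0 : ℝ) < n := by exact_mod_cast hn
  have h := (posDef_toBlocks₁₁ hS).smul hn'
  rwa [sampleGram_toBlocks₁₁, smul_smul, mul_inv_cancel₀ hn'.ne', one_smul] at h

lemma inv_sampleGram_toBlocks₁₁ (hn : 0 < n) (hS : (sampleGram X₁ X₂).PosDef) :
    (sampleGram X₁ X₂).toBlocks₁₁⁻¹ = (n : ℝ) • (X₁ᵀ * X₁)⁻¹ := by
  have hn' : (n : ℝ) ≠ 0 := by positivity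
  have hd := (isUnit_iff_isUnit_det _).1 (posDef_gram₁ hn hS).isUnit
  rw [sampleGram_toBlocks₁₁]
  apply inv_eq_right_inv
  rw [smul_mul_smul_comm, inv_mul_cancel₀ hn', mul_nonsing_inv _ hd, one_smul]

lemma residualGram_eq (hn : 0 < n) (hS : (sampleGram X₁ X₂).PosDef) :
    X₂ᵀ * residualProj X₁ * X₂ = (n : ℝ) • schur22 (sampleGram X₁ X₂) := by
  have hn' : (n : ℝ) ≠ 0 := by positivity
  rw [schur22, inv_sampleGram_toBlocks₁₁ hn hS, sampleGram_toBlocks₂₂, sampleGram_toBlocks₂₁,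
    sampleGram_toBlocks₁₂]
  simp only [Matrix.smul_mul, Matrix.mul_smul, smul_sub, smul_smul, residualProj, Matrix.mul_sub,
    Matrix.sub_mul, Matrix.mul_one, Matrix.mul_assoc]
  congr 1
  · rw [mul_inv_cancel₀ hn', one_smul]
  · have : (n : ℝ) * ((n : ℝ)⁻¹ * ((n : ℝ) * (n : ℝ)⁻¹)) = 1 := by field_simp
    rw [this, one_smul]

/-- The direction in which the errors enter every estimator of `d' β₁`. -/
noncomputable def errorDirection (X₁ : Matrix (Fin n) (Fin m) ℝ) (d : Fin m → ℝ) : Fin n → ℝ :=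
  √(n : ℝ) • (X₁ *ᵥ ((X₁ᵀ * X₁)⁻¹ *ᵥ d))

/-- The matrix `(S₂₂.₁ + (r/n) I)⁻¹` of the ridge estimator, for `S` the sample Gram matrix. -/
noncomputable def ridgeInv (X₁ : Matrix (Fin n) (Fin m) ℝ) (X₂ : Matrix (Fin n) (Fin k) ℝ)
    (r : ℝ) : Matrix (Fin k) (Fin k) ℝ :=
  (schur22 (sampleGram X₁ X₂) + (r / n) • 1)⁻¹

/-- The matrix through which the errors enter `√n β̂₂`. -/
noncomputable def errorMatrix (X₁ : Matrix (Fin n) (Fin m) ℝ) (X₂ : Matrix (Fin n) (Fin k) ℝ)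
    (r : ℝ) : Matrix (Fin k) (Fin n) ℝ :=
  (√(n : ℝ))⁻¹ • (ridgeInv X₁ X₂ r * X₂ᵀ * residualProj X₁)

/-- The mean of `√n β̂₂` under the local signal `δ / √n`. -/
noncomputable def ridgeMean (X₁ : Matrix (Fin n) (Fin m) ℝ) (X₂ : Matrix (Fin n) (Fin k) ℝ)
    (r : ℝ) (δ : Fin k → ℝ) : Fin k → ℝ :=
  ridgeInv X₁ X₂ r *ᵥ (schur22 (sampleGram X₁ X₂) *ᵥ δ)

lemma errorDirection_dot (hn : 0 < n) (hS : (sampleGram X₁ X₂).PosDef) (d : Fin m → ℝ) :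
    errorDirection X₁ d ⬝ᵥ errorDirection X₁ d =
      d ⬝ᵥ ((sampleGram X₁ X₂).toBlocks₁₁⁻¹ *ᵥ d) := by
  have hd := (isUnit_iff_isUnit_det _).1 (posDef_gram₁ hn hS).isUnit
  rw [inv_sampleGram_toBlocks₁₁ hn hS, errorDirection]
  simp only [smul_dotProduct, dotProduct_smul, smul_eq_mul, smul_mulVec]
  rw [← mul_assoc, Real.mul_self_sqrt (Nat.cast_nonneg n)]
  congr 1
  rw [dotProduct_mulVec, vecMul_mulVec, ← mulVec_transpose, transpose_mul, transpose_transpose,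
    mulVec_mulVec, mul_nonsing_inv _ hd, one_mulVec]

lemma errorMatrix_mulVec (hn : 0 < n) (hS : (sampleGram X₁ X₂).PosDef) (r : ℝ) (c : ℝ)
    (d : Fin m → ℝ) : errorMatrix X₁ X₂ r *ᵥ (c • errorDirection X₁ d) = 0 := by
  rw [errorMatrix, errorDirection, mulVec_smul, mulVec_smul, mulVec_mulVec]
  rw [Matrix.smul_mul, Matrix.mul_assoc, residualProj_mul_self (posDef_gram₁ hn hS)]
  simp

lemma posDef_ridge (hn : 0 < n) (hS : (sampleGram X₁ X₂).PosDef) {r : ℝ} (hr : 0 < r) :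
    (schur22 (sampleGram X₁ X₂) + (r / n) • (1 : Matrix (Fin k) (Fin k) ℝ)).PosDef :=
  (posDef_schur22 hS).add (PosDef.one.smul (by positivity))

lemma errorMatrix_mul_transpose (hn : 0 < n) (hS : (sampleGram X₁ X₂).PosDef) {r : ℝ}
    (hr : 0 < r) : errorMatrix X₁ X₂ r * (errorMatrix X₁ X₂ r)ᵀ =
      ridgeInv X₁ X₂ r * schur22 (sampleGram X₁ X₂) * ridgeInv X₁ X₂ r := by
  have hs : (ridgeInv X₁ X₂ r)ᵀ = ridgeInv X₁ X₂ r := (posDef_ridge hn hS hr).inv.isHermitian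
  have hn' : (0 : ℝ) < n := by positivity
  have hsq : (√(n : ℝ))⁻¹ * (√(n : ℝ))⁻¹ * n = 1 := by
    rw [← mul_inv, Real.mul_self_sqrt hn'.le, inv_mul_cancel₀ hn'.ne']
  have hM (Z : Matrix (Fin n) (Fin k) ℝ) :
      residualProj X₁ * (residualProj X₁ * Z) = residualProj X₁ * Z := by
    rw [← Matrix.mul_assoc, residualProj_idem (posDef_gram₁ hn hS)]
  have hG (Z : Matrix (Fin k) (Fin k) ℝ) : X₂ᵀ * (residualProj X₁ * (X₂ * Z)) =
      (n : ℝ) • (schur22 (sampleGram X₁ X₂) * Z) := by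
    rw [← Matrix.mul_assoc, ← Matrix.mul_assoc, residualGram_eq hn hS, Matrix.smul_mul]
  rw [errorMatrix, transpose_smul, Matrix.smul_mul, Matrix.mul_smul, smul_smul, transpose_mul,
    transpose_mul, hs, residualProj_transpose, transpose_transpose]
  simp only [Matrix.mul_assoc, hM, hG, Matrix.mul_smul, smul_smul]
  rw [hsq, one_smul]

/-- `√n β̂₂` for the weighted ridge estimator. -/
lemma sqrt_smul_estWR_snd (hn : 0 < n) (hS : (sampleGram X₁ X₂).PosDef) {r : ℝ} (hr : 0 < r)
    (X₃ : Matrix (Fin n) (Fin l) ℝ) (β₁ : Fin m → ℝ) (δ : Fin k → ℝ) (e : Fin n → ℝ) :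
    √(n : ℝ) • (estWR X₁ X₂ r (response X₁ X₂ X₃ β₁ ((√(n : ℝ))⁻¹ • δ) 0 e)).2 =
      ridgeMean X₁ X₂ r δ + errorMatrix X₁ X₂ r *ᵥ e := by
  have hn' : (0 : ℝ) < n := by positivity
  have hs : √(n : ℝ) ≠ 0 := by positivity
  have hX := posDef_gram₁ hn hS
  have hdet := (isUnit_iff_isUnit_det _).1 (posDef_ridge hn hS hr).isUnit
  have hinv : (X₂ᵀ * residualProj X₁ * X₂ + r • 1)⁻¹ = (n : ℝ)⁻¹ • ridgeInv X₁ X₂ r := by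
    have : X₂ᵀ * residualProj X₁ * X₂ + r • 1 =
        (n : ℝ) • (schur22 (sampleGram X₁ X₂) + (r / n) • 1) := by
      rw [residualGram_eq hn hS, smul_add, smul_smul, mul_div_cancel₀ _ hn'.ne']
    rw [this]
    apply inv_eq_right_inv
    rw [ridgeInv, Matrix.smul_mul, Matrix.mul_smul, smul_smul, mul_inv_cancel₀ hn'.ne', one_smul,
      mul_nonsing_inv _ hdet]
  have hMy : residualProj X₁ *ᵥ response X₁ X₂ X₃ β₁ ((√(n : ℝ))⁻¹ • δ) 0 e =
      (√(n : ℝ))⁻¹ • (residualProj X₁ *ᵥ (X₂ *ᵥ δ)) + residualProj X₁ *ᵥ e := by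
    rw [response, mulVec_zero, add_zero, mulVec_add, mulVec_add, mulVec_mulVec,
      residualProj_mul_self hX, zero_mulVec, zero_add, mulVec_smul, mulVec_smul]
  have h1 : X₂ᵀ *ᵥ (residualProj X₁ *ᵥ (X₂ *ᵥ δ)) =
      (n : ℝ) • (schur22 (sampleGram X₁ X₂) *ᵥ δ) := by
    rw [mulVec_mulVec, mulVec_mulVec, residualGram_eq hn hS, smul_mulVec]
  rw [(estWR_eq hX hr _).1, hinv, hMy, mulVec_add, mulVec_smul, h1, ridgeMean, errorMatrix,
    smul_mulVec, smul_mulVec, mulVec_add, smul_add, smul_add, mulVec_smul, mulVec_smul,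
    ← mulVec_mulVec, ← mulVec_mulVec]
  simp only [smul_smul]
  have c1 : √(n : ℝ) * ((n : ℝ)⁻¹ * ((√(n : ℝ))⁻¹ * n)) = 1 := by
    field_simp
  have c2 : √(n : ℝ) * (n : ℝ)⁻¹ = (√(n : ℝ))⁻¹ := by
    rw [eq_comm, inv_eq_iff_eq_inv, mul_inv, inv_inv, inv_mul_eq_div, Real.div_sqrt]
  rw [c1, one_smul, c2]

lemma dot_inv_gram_mulVec (hn : 0 < n) (hS : (sampleGram X₁ X₂).PosDef) (d : Fin m → ℝ)
    (z : Fin k → ℝ) :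
    d ⬝ᵥ ((X₁ᵀ * X₁)⁻¹ *ᵥ (X₁ᵀ *ᵥ (X₂ *ᵥ z))) = d2 (sampleGram X₁ X₂) d ⬝ᵥ z := by
  have hn' : (n : ℝ) ≠ 0 := by positivity
  rw [← dotProduct_inv_toBlocks₁₁ hS, inv_sampleGram_toBlocks₁₁ hn hS, sampleGram_toBlocks₁₂,
    smul_mulVec, smul_mulVec, mulVec_smul, smul_smul, mul_inv_cancel₀ hn', one_smul,
    ← mulVec_mulVec z X₁ᵀ X₂]

/-- `√n d'(β̂₁ - β₁)` for the post-selection least squares estimator. -/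
lemma sqrt_mul_estRE (hn : 0 < n) (hS : (sampleGram X₁ X₂).PosDef)
    (X₃ : Matrix (Fin n) (Fin l) ℝ) (β₁ d : Fin m → ℝ) (δ : Fin k → ℝ) (e : Fin n → ℝ) :
    √(n : ℝ) * (d ⬝ᵥ (estRE X₁ (response X₁ X₂ X₃ β₁ ((√(n : ℝ))⁻¹ • δ) 0 e) - β₁)) =
      errorDirection X₁ d ⬝ᵥ e + d2 (sampleGram X₁ X₂) d ⬝ᵥ δ := by
  have hs : √(n : ℝ) ≠ 0 := by positivity
  have hX := posDef_gram₁ hn hS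
  have hd := (isUnit_iff_isUnit_det _).1 hX.isUnit
  have hT : ((X₁ᵀ * X₁)⁻¹)ᵀ = (X₁ᵀ * X₁)⁻¹ := by
    rw [transpose_nonsing_inv, transpose_mul, transpose_transpose]
  have h1 : estRE X₁ (response X₁ X₂ X₃ β₁ ((√(n : ℝ))⁻¹ • δ) 0 e) - β₁ =
      (√(n : ℝ))⁻¹ • ((X₁ᵀ * X₁)⁻¹ *ᵥ (X₁ᵀ *ᵥ (X₂ *ᵥ δ))) +
        (X₁ᵀ * X₁)⁻¹ *ᵥ (X₁ᵀ *ᵥ e) := by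
    rw [estRE, response, mulVec_zero, add_zero]
    simp only [mulVec_add, mulVec_smul]
    have : (X₁ᵀ * X₁)⁻¹ *ᵥ (X₁ᵀ *ᵥ (X₁ *ᵥ β₁)) = β₁ := by
      rw [mulVec_mulVec, mulVec_mulVec, Matrix.mul_assoc, nonsing_inv_mul _ hd, one_mulVec]
    rw [this]
    abel
  have h2 : d ⬝ᵥ ((X₁ᵀ * X₁)⁻¹ *ᵥ (X₁ᵀ *ᵥ e)) = (X₁ *ᵥ ((X₁ᵀ * X₁)⁻¹ *ᵥ d)) ⬝ᵥ e := by
    rw [dotProduct_mulVec, ← mulVec_transpose, hT, dotProduct_mulVec, vecMul_transpose]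
  rw [h1, dotProduct_add, dotProduct_smul, dot_inv_gram_mulVec hn hS, h2, errorDirection,
    smul_dotProduct, smul_eq_mul, smul_eq_mul, mul_add, mul_inv_cancel_left₀ hs, add_comm]

lemma estWR_sub_estRE (hn : 0 < n) (hS : (sampleGram X₁ X₂).PosDef) {r : ℝ} (hr : 0 < r)
    (d : Fin m → ℝ) (y : Fin n → ℝ) :
    √(n : ℝ) * (d ⬝ᵥ ((estWR X₁ X₂ r y).1 - estRE X₁ y)) =
      -(d2 (sampleGram X₁ X₂) d ⬝ᵥ (√(n : ℝ) • (estWR X₁ X₂ r y).2)) := by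
  rw [(estWR_eq (posDef_gram₁ hn hS) hr y).2, sub_sub_cancel_left, dotProduct_neg,
    dot_inv_gram_mulVec hn hS, dotProduct_smul, smul_eq_mul]
  ring

/-- `√n d'(β̂₁ - β₁)` for an estimator that moves from the ridge estimator towards the
post-selection estimator by the factor `t`. -/
lemma sqrt_mul_shrink (hn : 0 < n) (hS : (sampleGram X₁ X₂).PosDef) {r : ℝ} (hr : 0 < r)
    (X₃ : Matrix (Fin n) (Fin l) ℝ) (β₁ d : Fin m → ℝ) (δ : Fin k → ℝ) (e : Fin n → ℝ) (t : ℝ)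
    {y : Fin n → ℝ} (hy : y = response X₁ X₂ X₃ β₁ ((√(n : ℝ))⁻¹ • δ) 0 e) :
    √(n : ℝ) * (d ⬝ᵥ ((estWR X₁ X₂ r y).1 -
        t • ((estWR X₁ X₂ r y).1 - estRE X₁ y) - β₁)) =
      errorDirection X₁ d ⬝ᵥ e +
        (d2 (sampleGram X₁ X₂) d ⬝ᵥ (δ - (ridgeMean X₁ X₂ r δ + errorMatrix X₁ X₂ r *ᵥ e)) +
          t * (d2 (sampleGram X₁ X₂) d ⬝ᵥ (ridgeMean X₁ X₂ r δ + errorMatrix X₁ X₂ r *ᵥ e))) := by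
  have h1 := sqrt_mul_estRE hn hS X₃ β₁ d δ e
  have h2 := estWR_sub_estRE hn hS hr d y
  have h3 := sqrt_smul_estWR_snd hn hS hr X₃ β₁ δ e
  rw [← hy] at h1 h3
  rw [h3] at h2
  have h4 : (estWR X₁ X₂ r y).1 - t • ((estWR X₁ X₂ r y).1 - estRE X₁ y) - β₁ =
      (1 - t) • ((estWR X₁ X₂ r y).1 - estRE X₁ y) + (estRE X₁ y - β₁) := by
    rw [sub_smul, one_smul]; abel
  rw [h4, dotProduct_add, dotProduct_smul, smul_eq_mul, mul_add, h1, mul_left_comm, h2,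
    dotProduct_sub]
  ring

lemma statT_eq (hn : 0 < n) (hS : (sampleGram X₁ X₂).PosDef) {r : ℝ} (hr : 0 < r) (σ : ℝ)
    (X₃ : Matrix (Fin n) (Fin l) ℝ) (β₁ : Fin m → ℝ) (δ : Fin k → ℝ) (e : Fin n → ℝ)
    {y : Fin n → ℝ} (hy : y = response X₁ X₂ X₃ β₁ ((√(n : ℝ))⁻¹ • δ) 0 e) :
    statT σ X₁ X₂ r y = quadForm σ (sampleGram X₁ X₂)
      (ridgeMean X₁ X₂ r δ + errorMatrix X₁ X₂ r *ᵥ e) := by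
  rw [← sqrt_smul_estWR_snd hn hS hr X₃ β₁ δ e, ← hy, statT, residualGram_eq hn hS, quadForm]
  simp only [smul_mulVec, mulVec_smul, smul_dotProduct, dotProduct_smul, smul_eq_mul]
  rw [← mul_assoc, Real.mul_self_sqrt (Nat.cast_nonneg n)]

end Representation

/-! ### The ridge parameter -/

lemma eventually_ridgeParam_pos {c₁ c₂ : ℝ} (α : ℝ) (p : ℕ → ℕ) (hc₁ : 0 < c₁) (hc₂ : 0 < c₂) :
    ∀ᶠ n in atTop, 0 < ridgeParam c₁ c₂ α p n := by
  filter_upwards [eventually_ge_atTop 3] with n hn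
  have hn' : (3 : ℝ) ≤ n := by exact_mod_cast hn
  have h1 : 1 < Real.log n := by
    rw [Real.lt_log_iff_exp_lt (by linarith)]
    linarith [Real.exp_one_lt_d9]
  have h2 : 0 < Real.log (Real.log n) := Real.log_pos h1
  have h3 : 0 < Real.log (max n (p n) : ℕ) := by
    apply Real.log_pos
    have : 3 ≤ max n (p n) := le_max_of_le_left hn
    have : (3 : ℝ) ≤ (max n (p n) : ℕ) := by exact_mod_cast this
    linarith
  have h4 : 0 < thresholdLevel c₁ α n := by
    unfold thresholdLevel
    have : (0 : ℝ) < n := by linarith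
    positivity
  unfold ridgeParam
  positivity

/-- Up to constants the ridge parameter is at most `n ^ (2 α) n ^ (3 α / 4) n ^ ν`, where the
middle factor dominates the iterated logarithm. -/
lemma tendsto_ridgeParam_div {c₁ c₂ α ν : ℝ} {p : ℕ → ℕ} (hα : 0 < α) (hν : 0 < ν)
    (h : 3 * α + ν < 1)
    (hp : (fun n : ℕ => Real.log (p n)) =O[atTop] fun n : ℕ => (n : ℝ) ^ ν) :
    Tendsto (fun n => ridgeParam c₁ c₂ α p n / n) atTop (𝓝 0) := by
  have hlog : (fun n : ℕ => Real.log n) =O[atTop] fun n : ℕ => (n : ℝ) ^ (α / 4) :=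
    (isLittleO_log_rpow_atTop (by positivity)).isBigO.comp_tendsto tendsto_natCast_atTop_atTop
  have hlogν : (fun n : ℕ => Real.log n) =O[atTop] fun n : ℕ => (n : ℝ) ^ ν :=
    (isLittleO_log_rpow_atTop hν).isBigO.comp_tendsto tendsto_natCast_atTop_atTop
  have hll : (fun n : ℕ => Real.log (Real.log n)) =O[atTop] fun n : ℕ => (n : ℝ) ^ (α / 4) := by
    refine .trans ?_ hlog
    refine Asymptotics.IsBigO.of_bound 1 ?_
    filter_upwards [eventually_ge_atTop 3] with n hn
    have hn' : (3 : ℝ) ≤ n := by exact_mod_cast hn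
    have h1 : 1 < Real.log n := by
      rw [Real.lt_log_iff_exp_lt (by linarith)]
      linarith [Real.exp_one_lt_d9]
    rw [Real.norm_of_nonneg (Real.log_nonneg h1.le), Real.norm_of_nonneg (by linarith), one_mul]
    linarith [Real.log_le_sub_one_of_pos (show 0 < Real.log n by linarith)]
  have hmax : (fun n : ℕ => Real.log (max n (p n) : ℕ)) =O[atTop] fun n : ℕ => (n : ℝ) ^ ν := by
    refine Asymptotics.IsBigO.trans (g := fun n : ℕ => ‖Real.log n‖ + ‖Real.log (p n)‖) ?_
      (hlogν.norm_left.add hp.norm_left)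
    refine Asymptotics.IsBigO.of_bound 1 (.of_forall fun n => ?_)
    rw [one_mul, Real.norm_of_nonneg (by positivity : 0 ≤ ‖Real.log n‖ + ‖Real.log (p n)‖)]
    rcases max_choice n (p n) with h | h <;> rw [h]
    · exact le_add_of_nonneg_right (norm_nonneg _)
    · exact le_add_of_nonneg_left (norm_nonneg _)
  have hth : (fun n : ℕ => c₂ * (thresholdLevel c₁ α n ^ 2)⁻¹) =O[atTop]
      fun n : ℕ => (n : ℝ) ^ (2 * α) := by
    refine Asymptotics.IsBigO.of_bound (|c₂| * (c₁ ^ 2)⁻¹) ?_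
    filter_upwards [eventually_gt_atTop 0] with n hn
    have hn' : (0 : ℝ) < n := by exact_mod_cast hn
    have : (thresholdLevel c₁ α n ^ 2)⁻¹ = (c₁ ^ 2)⁻¹ * (n : ℝ) ^ (2 * α) := by
      rw [thresholdLevel, mul_pow, mul_inv, ← Real.rpow_mul_natCast hn'.le,
        ← Real.rpow_neg hn'.le]
      congr 2
      push_cast; ring
    rw [this, norm_mul, norm_mul, norm_inv, norm_pow, Real.norm_eq_abs c₁, sq_abs,
      Real.norm_eq_abs c₂]
    exact le_of_eq (by ring)
  have hinv : (fun n : ℕ => (n : ℝ)⁻¹) =O[atTop] fun n : ℕ => (n : ℝ)⁻¹ :=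
    Asymptotics.isBigO_refl _ _
  have hall := ((hth.mul (hll.pow 3)).mul hmax).mul hinv
  have hlim : Tendsto (fun n : ℕ => (n : ℝ) ^ (-(1 - (2 * α + 3 * (α / 4) + ν)))) atTop (𝓝 0) :=
    (tendsto_rpow_neg_atTop (by linarith)).comp tendsto_natCast_atTop_atTop
  refine (Asymptotics.IsBigO.trans_tendsto ?_ hlim)
  refine (hall.congr' ?_ ?_)
  · exact .of_forall fun n => by simp only [ridgeParam]; ring
  · filter_upwards [eventually_gt_atTop 0] with n hn
    have hn' : (0 : ℝ) < n := by exact_mod_cast hn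
    rw [← Real.rpow_natCast, ← Real.rpow_mul hn'.le, ← Real.rpow_neg_one, ← Real.rpow_add hn',
      ← Real.rpow_add hn', ← Real.rpow_add hn']
    congr 1
    push_cast; ring

/-! ### Limits of the normalised contrast -/

section Contrast

variable {m k : ℕ}

/-- The contrast `s₁⁻¹ d₂` through which the redundant block enters the normalised estimators. -/
noncomputable def scaledContrast (σ : ℝ) (S : Matrix (Fin m ⊕ Fin k) (Fin m ⊕ Fin k) ℝ)
    (d : Fin m → ℝ) : Fin k → ℝ :=
  (√(s1sq σ S d))⁻¹ • d2 S d

lemma scaledContrast_dot_sq {σ : ℝ} {S : Matrix (Fin m ⊕ Fin k) (Fin m ⊕ Fin k) ℝ}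
    {d : Fin m → ℝ} (h : 0 < s1sq σ S d) (x : Fin k → ℝ) :
    (scaledContrast σ S d ⬝ᵥ x) ^ 2 = (d2 S d ⬝ᵥ x) ^ 2 / s1sq σ S d := by
  rw [scaledContrast, smul_dotProduct, smul_eq_mul, mul_pow, inv_pow, Real.sq_sqrt h.le,
    inv_mul_eq_div]

lemma scaledContrast_quad {σ : ℝ} (hσ : 0 < σ) {S : Matrix (Fin m ⊕ Fin k) (Fin m ⊕ Fin k) ℝ}
    (hS : S.PosDef) {d : Fin m → ℝ} (hd : d ≠ 0) :
    scaledContrast σ S d ⬝ᵥ ((σ ^ 2 • (schur22 S)⁻¹) *ᵥ scaledContrast σ S d) =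
      1 - cRatio S d := by
  have h := s1sq_pos hσ hS hd
  rw [one_sub_cRatio hσ hS hd, scaledContrast, s2sq]
  simp only [mulVec_smul, smul_dotProduct, dotProduct_smul, smul_eq_mul, smul_mulVec]
  rw [← inv_mul_eq_div, ← Real.sq_sqrt h.le, Real.sqrt_sq (Real.sqrt_nonneg _)]
  ring

lemma quadForm_eq_matQuad (σ : ℝ) (S : Matrix (Fin m ⊕ Fin k) (Fin m ⊕ Fin k) ℝ)
    (x : EuclideanSpace ℝ (Fin k)) :
    quadForm σ S x = matQuad ((σ ^ 2)⁻¹ • schur22 S) x := by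
  rw [quadForm, matQuad, smul_mulVec, dotProduct_smul, smul_eq_mul, inv_mul_eq_div]

lemma cRatio_nonneg {S : Matrix (Fin m ⊕ Fin k) (Fin m ⊕ Fin k) ℝ} (hS : S.PosDef)
    {d : Fin m → ℝ} (hd : d ≠ 0) : 0 ≤ cRatio S d := by
  rw [cRatio_eq one_pos]
  have h2 := (posDef_toBlocks₁₁ hS).inv.posSemidef.dotProduct_mulVec_nonneg d
  simp only [star_trivial] at h2
  have := s1sq_pos one_pos hS hd
  positivity

lemma cRatio_le_one {S : Matrix (Fin m ⊕ Fin k) (Fin m ⊕ Fin k) ℝ} (hS : S.PosDef)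
    {d : Fin m → ℝ} (hd : d ≠ 0) : cRatio S d ≤ 1 := by
  have h := one_sub_cRatio one_pos hS hd
  have h1 := s1sq_pos one_pos hS hd
  have h2 := s2sq_nonneg 1 hS d
  have : 0 ≤ s2sq 1 S d / s1sq 1 S d := by positivity
  linarith

lemma tendsto_inv_matrix {ι : Type*} {l : Filter ι} {A : ι → Matrix (Fin k) (Fin k) ℝ}
    {K : Matrix (Fin k) (Fin k) ℝ} (hK : K.PosDef) (h : Tendsto A l (𝓝 K)) :
    Tendsto (fun n => (A n)⁻¹) l (𝓝 K⁻¹) := by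
  refine Tendsto.comp (continuousAt_matrix_inv K ?_) h
  have hd := (isUnit_iff_isUnit_det _).1 hK.isUnit
  rw [Ring.inverse_eq_inv']
  exact continuousAt_inv₀ hd.ne_zero

lemma tendsto_mul_mul {ι : Type*} {l : Filter ι} {A : ι → Matrix (Fin k) (Fin m) ℝ}
    {B : ι → Matrix (Fin m) (Fin m) ℝ} {C : ι → Matrix (Fin m) (Fin k) ℝ}
    {A' : Matrix (Fin k) (Fin m) ℝ} {B' : Matrix (Fin m) (Fin m) ℝ} {C' : Matrix (Fin m) (Fin k) ℝ}
    (h1 : Tendsto A l (𝓝 A')) (h2 : Tendsto B l (𝓝 B')) (h3 : Tendsto C l (𝓝 C')) :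
    Tendsto (fun n => A n * B n * C n) l (𝓝 (A' * B' * C')) := by
  have hc : Continuous fun q : Matrix (Fin k) (Fin m) ℝ × Matrix (Fin m) (Fin m) ℝ ×
      Matrix (Fin m) (Fin k) ℝ => q.1 * q.2.1 * q.2.2 :=
    (continuous_fst.matrix_mul continuous_snd.fst).matrix_mul continuous_snd.snd
  have h4 := h1.prodMk_nhds (h2.prodMk_nhds h3)
  have h5 := (hc.tendsto (A', B', C')).comp h4
  exact h5

variable {S : Matrix (Fin m ⊕ Fin k) (Fin m ⊕ Fin k) ℝ}
  {Sn : ℕ → Matrix (Fin m ⊕ Fin k) (Fin m ⊕ Fin k) ℝ}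

lemma tendsto_schur22 (hS : S.PosDef) (h : Tendsto Sn atTop (𝓝 S)) :
    Tendsto (fun n => schur22 (Sn n)) atTop (𝓝 (schur22 S)) := by
  have h11 : Tendsto (fun n => (Sn n).toBlocks₁₁) atTop (𝓝 S.toBlocks₁₁) :=
    ((continuous_id.matrix_submatrix _ _).tendsto S).comp h
  have h12 : Tendsto (fun n => (Sn n).toBlocks₁₂) atTop (𝓝 S.toBlocks₁₂) :=
    ((continuous_id.matrix_submatrix _ _).tendsto S).comp h
  have h21 : Tendsto (fun n => (Sn n).toBlocks₂₁) atTop (𝓝 S.toBlocks₂₁) :=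
    ((continuous_id.matrix_submatrix _ _).tendsto S).comp h
  have h22 : Tendsto (fun n => (Sn n).toBlocks₂₂) atTop (𝓝 S.toBlocks₂₂) :=
    ((continuous_id.matrix_submatrix _ _).tendsto S).comp h
  exact h22.sub (tendsto_mul_mul h21 (tendsto_inv_matrix (posDef_toBlocks₁₁ hS) h11) h12)

/-- If the matrices have the same limit, their quadratic forms agree asymptotically along bounded
vectors. -/
lemma tendsto_dot_mulVec_sub {A A' : ℕ → Matrix (Fin k) (Fin k) ℝ} {K : Matrix (Fin k) (Fin k) ℝ}
    (hA : Tendsto A atTop (𝓝 K)) (hA' : Tendsto A' atTop (𝓝 K)) {f : ℕ → Fin k → ℝ} {B : ℝ}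
    (hf : ∀ᶠ n in atTop, ‖WithLp.toLp 2 (f n)‖ ≤ B) :
    Tendsto (fun n => f n ⬝ᵥ (A n *ᵥ f n) - f n ⬝ᵥ (A' n *ᵥ f n)) atTop (𝓝 0) := by
  have h1 : Tendsto (fun n => (∑ i, ∑ j, |(A n - A' n) i j|) * B ^ 2) atTop (𝓝 0) := by
    have hc : Continuous fun M : Matrix (Fin k) (Fin k) ℝ => (∑ i, ∑ j, |M i j|) * B ^ 2 := by
      fun_prop
    have := (hc.tendsto _).comp (hA.sub hA')
    simpa [Function.comp_def] using this
  refine squeeze_zero_norm' ?_ h1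
  filter_upwards [hf] with n hn
  rw [← dotProduct_sub, ← sub_mulVec]
  exact abs_dotProduct_mulVec_le _ _ hn

/-- The squared length of the contrast is at most a constant multiple of `1 - c`. -/
lemma exists_norm_scaledContrast_le {σ : ℝ} (hσ : 0 < σ) (hS : S.PosDef)
    (h : Tendsto Sn atTop (𝓝 S)) (hSn : ∀ᶠ n in atTop, (Sn n).PosDef) {d : ℕ → Fin m → ℝ}
    (hd : ∀ n, d n ≠ 0) :
    ∃ κ > 0, ∀ᶠ n in atTop,
      κ * ‖WithLp.toLp 2 (scaledContrast σ (Sn n) (d n))‖ ^ 2 ≤ 1 - cRatio (Sn n) (d n) := by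
  have hK : (σ ^ 2 • (schur22 S)⁻¹).PosDef := (posDef_schur22 hS).inv.smul (by positivity)
  have hlim : Tendsto (fun n => σ ^ 2 • (schur22 (Sn n))⁻¹) atTop (𝓝 (σ ^ 2 • (schur22 S)⁻¹)) :=
    (tendsto_inv_matrix (posDef_schur22 hS) (tendsto_schur22 hS h)).const_smul _
  obtain ⟨κ, hκ, -, hle⟩ := eventually_le_matQuad hK hlim
  refine ⟨κ, hκ, ?_⟩
  filter_upwards [hle, hSn] with n hn hp
  rw [← scaledContrast_quad hσ hp (hd n)]
  exact hn _

lemma exists_norm_scaledContrast_bound {σ : ℝ} (hσ : 0 < σ) (hS : S.PosDef)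
    (h : Tendsto Sn atTop (𝓝 S)) (hSn : ∀ᶠ n in atTop, (Sn n).PosDef) {d : ℕ → Fin m → ℝ}
    (hd : ∀ n, d n ≠ 0) :
    ∃ B, ∀ᶠ n in atTop, ‖WithLp.toLp 2 (scaledContrast σ (Sn n) (d n))‖ ≤ B := by
  obtain ⟨κ, hκ, hle⟩ := exists_norm_scaledContrast_le hσ hS h hSn hd
  refine ⟨√(1 / κ), ?_⟩
  filter_upwards [hle, hSn] with n hn hp
  apply Real.le_sqrt_of_sq_le
  rw [le_div_iff₀ hκ, mul_comm]
  linarith [cRatio_nonneg hp (hd n)]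

/-- `(1 - c) (d₂'x)² / s₂²` and `(d₂'x)² / s₁²` agree asymptotically; the quotient by `s₂²` may
have a zero denominator, in which case both terms vanish. -/
lemma tendsto_contrast_sub {σ : ℝ} (hσ : 0 < σ) (hS : S.PosDef)
    (h : Tendsto Sn atTop (𝓝 S)) (hSn : ∀ᶠ n in atTop, (Sn n).PosDef) {d : ℕ → Fin m → ℝ}
    (hd : ∀ n, d n ≠ 0) {c : ℝ} (hc : Tendsto (fun n => cRatio (Sn n) (d n)) atTop (𝓝 c))
    (x : EuclideanSpace ℝ (Fin k)) :
    Tendsto (fun n => (1 - c) * ((d2 (Sn n) (d n) ⬝ᵥ x.ofLp) ^ 2 / s2sq σ (Sn n) (d n)) -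
      (scaledContrast σ (Sn n) (d n) ⬝ᵥ x.ofLp) ^ 2) atTop (𝓝 0) := by
  obtain ⟨κ, hκ, hle⟩ := exists_norm_scaledContrast_le hσ hS h hSn hd
  have h1 : Tendsto (fun n => ‖x‖ ^ 2 / κ * |cRatio (Sn n) (d n) - c|) atTop (𝓝 0) := by
    have := ((hc.sub_const c).abs).const_mul (‖x‖ ^ 2 / κ)
    simpa using this
  refine squeeze_zero_norm' ?_ h1
  filter_upwards [hle, hSn] with n hn hp
  have hs := s1sq_pos hσ hp (hd n)
  set t := (scaledContrast σ (Sn n) (d n) ⬝ᵥ x.ofLp) ^ 2 with ht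
  have ht1 : κ * t ≤ (1 - cRatio (Sn n) (d n)) * ‖x‖ ^ 2 := by
    have h2 := abs_dot_le (scaledContrast σ (Sn n) (d n)) x
    have h3 : t ≤ (‖WithLp.toLp 2 (scaledContrast σ (Sn n) (d n))‖ * ‖x‖) ^ 2 := by
      rw [ht, ← sq_abs]
      gcongr
    calc κ * t ≤ κ * (‖WithLp.toLp 2 (scaledContrast σ (Sn n) (d n))‖ * ‖x‖) ^ 2 := by gcongr
      _ = κ * ‖WithLp.toLp 2 (scaledContrast σ (Sn n) (d n))‖ ^ 2 * ‖x‖ ^ 2 := by ring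
      _ ≤ _ := by gcongr
  have ht2 := scaledContrast_dot_sq hs x.ofLp
  have ht0 : 0 ≤ t := sq_nonneg _
  have hcn := one_sub_cRatio hσ hp (hd n)
  rcases eq_or_ne (s2sq σ (Sn n) (d n)) 0 with h0 | h0
  · rw [h0, zero_div] at hcn
    rw [hcn, zero_mul] at ht1
    have : t = 0 := le_antisymm (by nlinarith) ht0
    rw [h0, this, div_zero, mul_zero, sub_zero, norm_zero]
    positivity
  · have h2 : (d2 (Sn n) (d n) ⬝ᵥ x.ofLp) ^ 2 / s2sq σ (Sn n) (d n) =
        t / (1 - cRatio (Sn n) (d n)) := by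
      rw [hcn, ht, ht2]
      field_simp
    have hpos : 0 < 1 - cRatio (Sn n) (d n) := by
      rw [hcn]
      exact div_pos (lt_of_le_of_ne (s2sq_nonneg σ hp _) h0.symm) hs
    have h3 : (1 - c) * ((d2 (Sn n) (d n) ⬝ᵥ x.ofLp) ^ 2 / s2sq σ (Sn n) (d n)) - t =
        t / (1 - cRatio (Sn n) (d n)) * (cRatio (Sn n) (d n) - c) := by
      rw [h2]; field_simp; ring
    rw [h3, norm_mul, Real.norm_eq_abs, Real.norm_eq_abs, abs_of_nonneg (by positivity)]
    refine mul_le_mul_of_nonneg_right ?_ (abs_nonneg _)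
    rw [div_le_div_iff₀ hpos hκ]
    linarith

end Contrast

section Translation

variable {k : ℕ}

lemma gaussDensity_add (K : Matrix (Fin k) (Fin k) ℝ) (δ z : EuclideanSpace ℝ (Fin k)) :
    gaussDensity K δ (z + δ) = gaussDensity K 0 z := by
  simp [gaussDensity]

lemma integrable_shift_multivariateGaussian {V : Matrix (Fin k) (Fin k) ℝ} (hV : V.PosDef)
    {δ : EuclideanSpace ℝ (Fin k)} {g : EuclideanSpace ℝ (Fin k) → ℝ}
    (h : Integrable fun x => gaussDensity V⁻¹ δ x * g x) :
    Integrable (fun z => g (z + δ)) (multivariateGaussian 0 V) := by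
  rw [integrable_multivariateGaussian_iff hV]
  refine (h.comp_add_right δ).congr (.of_forall fun z => ?_)
  simp [gaussDensity_add]

lemma integral_shift_multivariateGaussian {V : Matrix (Fin k) (Fin k) ℝ} (hV : V.PosDef)
    (δ : EuclideanSpace ℝ (Fin k)) (g : EuclideanSpace ℝ (Fin k) → ℝ) :
    ∫ z, g (z + δ) ∂multivariateGaussian 0 V = ∫ x, gaussDensity V⁻¹ δ x * g x := by
  rw [integral_multivariateGaussian hV,
    ← integral_add_right_eq_self (fun x => gaussDensity V⁻¹ δ x * g x) δ]
  simp_rw [gaussDensity_add]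

end Translation

/-! ### Identification of the limiting gains -/

section Gains

variable {m k : ℕ} {S : Matrix (Fin m ⊕ Fin k) (Fin m ⊕ Fin k) ℝ}
  {Sn : ℕ → Matrix (Fin m ⊕ Fin k) (Fin m ⊕ Fin k) ℝ}

lemma posDef_smul_schur22 {σ : ℝ} (hσ : 0 < σ) (hS : S.PosDef) :
    ((σ ^ 2)⁻¹ • schur22 S).PosDef :=
  (posDef_schur22 hS).smul (by positivity)

lemma inv_smul_inv_schur22 {σ : ℝ} (hσ : 0 < σ) (hS : S.PosDef) :
    (σ ^ 2 • (schur22 S)⁻¹)⁻¹ = (σ ^ 2)⁻¹ • schur22 S := by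
  have hd := (isUnit_iff_isUnit_det _).1 (posDef_schur22 hS).isUnit
  apply inv_eq_right_inv
  rw [smul_mul_smul_comm, mul_inv_cancel₀ (by positivity), nonsing_inv_mul _ hd, one_smul]

lemma inv_smul_schur22 {σ : ℝ} (hσ : 0 < σ) (hS : S.PosDef) :
    ((σ ^ 2)⁻¹ • schur22 S)⁻¹ = σ ^ 2 • (schur22 S)⁻¹ := by
  have hd := (isUnit_iff_isUnit_det _).1 (posDef_schur22 hS).isUnit
  apply inv_eq_right_inv
  rw [smul_mul_smul_comm, inv_mul_cancel₀ (by positivity), mul_nonsing_inv _ hd, one_smul]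

lemma tendsto_smul_inv_schur22 (σ : ℝ) (hS : S.PosDef) (h : Tendsto Sn atTop (𝓝 S)) :
    Tendsto (fun n => σ ^ 2 • (schur22 (Sn n))⁻¹) atTop (𝓝 (σ ^ 2 • (schur22 S)⁻¹)) :=
  (tendsto_inv_matrix (posDef_schur22 hS) (tendsto_schur22 hS h)).const_smul _

lemma tendsto_smul_schur22 (σ : ℝ) (hS : S.PosDef) (h : Tendsto Sn atTop (𝓝 S)) :
    Tendsto (fun n => (σ ^ 2)⁻¹ • schur22 (Sn n)) atTop (𝓝 ((σ ^ 2)⁻¹ • schur22 S)) :=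
  (tendsto_schur22 hS h).const_smul _

lemma tendsto_quadForm (σ : ℝ) (hS : S.PosDef) (h : Tendsto Sn atTop (𝓝 S))
    (x : EuclideanSpace ℝ (Fin k)) : Tendsto (fun n => quadForm σ (Sn n) x) atTop
      (𝓝 (matQuad ((σ ^ 2)⁻¹ • schur22 S) x)) := by
  simp_rw [quadForm_eq_matQuad]
  exact tendsto_matQuad (tendsto_smul_schur22 σ hS h) tendsto_const_nhds

variable {σ : ℝ} {d : ℕ → Fin m → ℝ} {c : ℝ}

lemma tendsto_scaledContrast_quad (hσ : 0 < σ) (hS : S.PosDef)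
    (h : Tendsto Sn atTop (𝓝 S)) (hSn : ∀ᶠ n in atTop, (Sn n).PosDef)
    (hd : ∀ n, d n ≠ 0) (hc : Tendsto (fun n => cRatio (Sn n) (d n)) atTop (𝓝 c)) :
    Tendsto (fun n => scaledContrast σ (Sn n) (d n) ⬝ᵥ
      ((σ ^ 2 • (schur22 S)⁻¹) *ᵥ scaledContrast σ (Sn n) (d n))) atTop (𝓝 (1 - c)) := by
  obtain ⟨B, hB⟩ := exists_norm_scaledContrast_bound hσ hS h hSn hd
  have h1 := tendsto_dot_mulVec_sub tendsto_const_nhds (tendsto_smul_inv_schur22 σ hS h) hB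
  have h2 := h1.add (hc.const_sub 1)
  rw [zero_add] at h2
  refine h2.congr' ?_
  filter_upwards [hSn] with n hn
  rw [scaledContrast_quad hσ hn (hd n)]
  ring

/-- Away from the region where the shrinkage factor is truncated, the limiting gain is the limit
of `g1Pre`. The coefficient `k + 2` arises from `4 (k - 2) + (k - 2)² = (k - 2) (k + 2)`. -/
lemma tendsto_riskGain_of_lt (hσ : 0 < σ) (hS : S.PosDef)
    (h : Tendsto Sn atTop (𝓝 S)) (hSn : ∀ᶠ n in atTop, (Sn n).PosDef)
    (hd : ∀ n, d n ≠ 0) (hc : Tendsto (fun n => cRatio (Sn n) (d n)) atTop (𝓝 c))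
    {x : EuclideanSpace ℝ (Fin k)} {b : ℝ} (hb : 0 ≤ b)
    (hx : b < matQuad ((σ ^ 2)⁻¹ • schur22 S) x) {y : ℝ}
    (hy : Tendsto (fun n => g1Pre σ c (Sn n) (d n) x) atTop (𝓝 y)) :
    Tendsto (fun n => riskGain ((k : ℝ) - 2) b ((σ ^ 2)⁻¹ • schur22 S)
      (scaledContrast σ (Sn n) (d n)) x) atTop (𝓝 y) := by
  obtain ⟨B, hB⟩ := exists_norm_scaledContrast_bound hσ hS h hSn hd
  have hω := tendsto_scaledContrast_quad hσ hS h hSn hd hc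
  have hE := tendsto_contrast_sub hσ hS h hSn hd hc x
  have hQ := tendsto_quadForm σ hS h x
  set Q := matQuad ((σ ^ 2)⁻¹ • schur22 S) x
  have hQ0 : 0 < Q := hb.trans_lt hx
  have hQi := hQ.inv₀ hQ0.ne'
  have ht : IsBoundedUnder (· ≤ ·) atTop
      (norm ∘ fun n => (scaledContrast σ (Sn n) (d n) ⬝ᵥ x.ofLp) ^ 2) := by
    refine isBoundedUnder_of_eventually_le (a := (B * ‖x‖) ^ 2) ?_
    filter_upwards [hB] with n hn
    simp only [Function.comp_apply, norm_pow, Real.norm_eq_abs]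
    gcongr
    exact (abs_dot_le _ _).trans (by gcongr)
  have h1 : Tendsto (fun n => (Q⁻¹ ^ 2 - (quadForm σ (Sn n) x)⁻¹ ^ 2) *
      (scaledContrast σ (Sn n) (d n) ⬝ᵥ x.ofLp) ^ 2) atTop (𝓝 0) := by
    refine Tendsto.zero_mul_isBoundedUnder_le ?_ ht
    have := (hQi.pow 2).const_sub (Q⁻¹ ^ 2)
    rwa [sub_self] at this
  have h2 : Tendsto (fun n => (scaledContrast σ (Sn n) (d n) ⬝ᵥ
      ((σ ^ 2 • (schur22 S)⁻¹) *ᵥ scaledContrast σ (Sn n) (d n))) * Q⁻¹ -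
        (1 - c) * (quadForm σ (Sn n) x)⁻¹) atTop (𝓝 0) := by
    simpa using (hω.mul_const Q⁻¹).sub (hQi.const_mul (1 - c))
  have h3 := (hE.mul (hQi.pow 2))
  rw [zero_mul] at h3
  have h4 := ((h2.const_mul (2 * ((k : ℝ) - 2))).sub
    ((h1.sub h3).const_mul (((k : ℝ) - 2) * (k + 2)))).add hy
  simp only [sub_zero, mul_zero, zero_add] at h4
  refine h4.congr' ?_
  have hQn : ∀ᶠ n in atTop, 0 < quadForm σ (Sn n) x := hQ.eventually_const_lt hQ0
  filter_upwards [hQn] with n hn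
  rw [riskGain, max_eq_left hx.le, if_pos hx, inv_smul_schur22 hσ hS, g1Pre,
    ← div_div _ (s2sq σ (Sn n) (d n)), mul_div_assoc ((k : ℝ) + 2)]
  generalize (d2 (Sn n) (d n) ⬝ᵥ x.ofLp) ^ 2 / s2sq σ (Sn n) (d n) = E
  generalize quadForm σ (Sn n) x = q at hn
  field_simp
  ring

/-- In the region where the shrinkage factor is truncated to one, the limiting gain is the one of
the post-selection estimator. -/
lemma tendsto_riskGain_of_gt (hσ : 0 < σ) (hS : S.PosDef)
    (h : Tendsto Sn atTop (𝓝 S)) (hSn : ∀ᶠ n in atTop, (Sn n).PosDef)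
    (hd : ∀ n, d n ≠ 0) (hc : Tendsto (fun n => cRatio (Sn n) (d n)) atTop (𝓝 c))
    {x : EuclideanSpace ℝ (Fin k)} {b : ℝ} (hb : 0 < b)
    (hx : matQuad ((σ ^ 2)⁻¹ • schur22 S) x < b) {y : ℝ}
    (hy : Tendsto (fun n => (2 - (d2 (Sn n) (d n) ⬝ᵥ x.ofLp) ^ 2 / s2sq σ (Sn n) (d n)) * (1 - c))
      atTop (𝓝 y)) :
    Tendsto (fun n => riskGain b b ((σ ^ 2)⁻¹ • schur22 S)
      (scaledContrast σ (Sn n) (d n)) x) atTop (𝓝 y) := by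
  have hω := tendsto_scaledContrast_quad hσ hS h hSn hd hc
  have hE := tendsto_contrast_sub hσ hS h hSn hd hc x
  have h1 := ((hω.sub_const (1 - c)).const_mul 2).add (hE.add hy)
  simp only [sub_self, mul_zero, zero_add] at h1
  refine h1.congr fun n => ?_
  rw [riskGain, max_eq_right hx.le, if_neg hx.not_gt, inv_smul_schur22 hσ hS]
  field_simp
  ring

lemma tendsto_riskGain_g2 (hσ : 0 < σ) (hS : S.PosDef)
    (h : Tendsto Sn atTop (𝓝 S)) (hSn : ∀ᶠ n in atTop, (Sn n).PosDef)
    (hd : ∀ n, d n ≠ 0) (hc : Tendsto (fun n => cRatio (Sn n) (d n)) atTop (𝓝 c))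
    (hk : 0 < (k : ℝ) - 2) {x : EuclideanSpace ℝ (Fin k)}
    (hx : matQuad ((σ ^ 2)⁻¹ • schur22 S) x ≠ (k : ℝ) - 2) {y : ℝ}
    (hy : Tendsto (fun n => g2Pre σ c (Sn n) (d n) x) atTop (𝓝 y)) :
    Tendsto (fun n => riskGain ((k : ℝ) - 2) ((k : ℝ) - 2) ((σ ^ 2)⁻¹ • schur22 S)
      (scaledContrast σ (Sn n) (d n)) x) atTop (𝓝 y) := by
  have hQ := tendsto_quadForm σ hS h x
  rcases lt_or_gt_of_ne hx with hlt | hgt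
  · refine tendsto_riskGain_of_gt hσ hS h hSn hd hc hk hlt (hy.congr' ?_)
    filter_upwards [hQ.eventually_lt_const hlt] with n hn
    rw [g2Pre, if_neg (not_le.2 hn), if_pos hn.le, zero_add]
  · refine tendsto_riskGain_of_lt hσ hS h hSn hd hc hk.le hgt (hy.congr' ?_)
    filter_upwards [hQ.eventually_const_lt hgt] with n hn
    rw [g2Pre, if_pos hn.le, if_neg (not_le.2 hn), add_zero]

end Gains

/-! ### Transfer of second moments to asymptotic risks -/

lemma eventually_posDef {ι : Type*} [Fintype ι] [DecidableEq ι] {A : ℕ → Matrix ι ι ℝ}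
    {K : Matrix ι ι ℝ} (hK : K.PosDef) (h : Tendsto A atTop (𝓝 K))
    (hA : ∀ n, (A n).PosSemidef) : ∀ᶠ n in atTop, (A n).PosDef := by
  have hd : Tendsto (fun n => (A n).det) atTop (𝓝 K.det) :=
    ((continuous_id.matrix_det).tendsto K).comp h
  filter_upwards [hd.eventually_ne hK.det_pos.ne'] with n hn
  exact (hA n).posDef_iff_det_ne_zero.2 hn

/-- The asymptotic regime: the Gram matrices converge to a positive definite matrix, the ridge
parameter is positive and of smaller order than `n`, and the contrasts do not vanish. -/
structure RegularDesign {m k : ℕ} (X₁ : ∀ n, Matrix (Fin n) (Fin m) ℝ)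
    (X₂ : ∀ n, Matrix (Fin n) (Fin k) ℝ) (r : ℕ → ℝ)
    (S : Matrix (Fin m ⊕ Fin k) (Fin m ⊕ Fin k) ℝ) (d : ℕ → Fin m → ℝ) : Prop where
  posDef : S.PosDef
  tendsto_gram : Tendsto (fun n => sampleGram (X₁ n) (X₂ n)) atTop (𝓝 S)
  ridge_pos : ∀ᶠ n in atTop, 0 < r n
  ridge_div : Tendsto (fun n => r n / n) atTop (𝓝 0)
  ne_zero : ∀ n, d n ≠ 0

namespace RegularDesign

variable {m k : ℕ} {X₁ : ∀ n, Matrix (Fin n) (Fin m) ℝ}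
  {X₂ : ∀ n, Matrix (Fin n) (Fin k) ℝ} {r : ℕ → ℝ}
  {S : Matrix (Fin m ⊕ Fin k) (Fin m ⊕ Fin k) ℝ} {d : ℕ → Fin m → ℝ}

lemma eventually_gram (h : RegularDesign X₁ X₂ r S d) :
    ∀ᶠ n in atTop, (sampleGram (X₁ n) (X₂ n)).PosDef :=
  eventually_posDef h.posDef h.tendsto_gram fun _ => posSemidef_sampleGram _ _

lemma tendsto_ridgeInv (h : RegularDesign X₁ X₂ r S d) :
    Tendsto (fun n => ridgeInv (X₁ n) (X₂ n) (r n)) atTop (𝓝 (schur22 S)⁻¹) := by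
  refine tendsto_inv_matrix (posDef_schur22 h.posDef) ?_
  have := (tendsto_schur22 h.posDef h.tendsto_gram).add
    (h.ridge_div.smul_const (1 : Matrix (Fin k) (Fin k) ℝ))
  rwa [zero_smul, add_zero] at this

lemma tendsto_ridgeMean (h : RegularDesign X₁ X₂ r S d) (δ : EuclideanSpace ℝ (Fin k)) :
    Tendsto (fun n => WithLp.toLp 2 (ridgeMean (X₁ n) (X₂ n) (r n) δ)) atTop (𝓝 δ) := by
  have hd := (isUnit_iff_isUnit_det _).1 (posDef_schur22 h.posDef).isUnit
  have hc : Continuous fun M : Matrix (Fin k) (Fin k) ℝ => WithLp.toLp 2 (M *ᵥ δ.ofLp) := by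
    fun_prop
  have h1 := (hc.tendsto _).comp
    (h.tendsto_ridgeInv.mul (tendsto_schur22 h.posDef h.tendsto_gram))
  rw [nonsing_inv_mul _ hd, one_mulVec] at h1
  refine h1.congr fun n => ?_
  simp [ridgeMean, mulVec_mulVec]

/-- The covariance matrix of `√n β̂₂` tends to the one of unpenalised least squares. -/
lemma tendsto_cov (h : RegularDesign X₁ X₂ r S d) (σ : ℝ) :
    Tendsto (fun n => σ ^ 2 • (errorMatrix (X₁ n) (X₂ n) (r n) *
      (errorMatrix (X₁ n) (X₂ n) (r n))ᵀ)) atTop (𝓝 (σ ^ 2 • (schur22 S)⁻¹)) := by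
  have hd := (isUnit_iff_isUnit_det _).1 (posDef_schur22 h.posDef).isUnit
  have h1 := ((h.tendsto_ridgeInv.mul (tendsto_schur22 h.posDef h.tendsto_gram)).mul
    h.tendsto_ridgeInv).const_smul (σ ^ 2)
  rw [nonsing_inv_mul _ hd, Matrix.one_mul] at h1
  refine h1.congr' ?_
  filter_upwards [h.eventually_gram, h.ridge_pos, eventually_gt_atTop 0] with n hp hr hn
  rw [errorMatrix_mul_transpose hn hp hr]

lemma eventually_cov (h : RegularDesign X₁ X₂ r S d) {σ : ℝ} (hσ : 0 < σ) :
    ∀ᶠ n in atTop, (σ ^ 2 • (errorMatrix (X₁ n) (X₂ n) (r n) *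
      (errorMatrix (X₁ n) (X₂ n) (r n))ᵀ)).PosDef := by
  refine eventually_posDef ((posDef_schur22 h.posDef).inv.smul (by positivity : 0 < σ ^ 2))
    (h.tendsto_cov σ) fun n => ?_
  have := posSemidef_self_mul_conjTranspose (errorMatrix (X₁ n) (X₂ n) (r n))
  rw [conjTranspose_eq_transpose_of_trivial] at this
  exact this.smul (sq_nonneg σ)

variable {Ω : Type*} [MeasurableSpace Ω] {P : Measure Ω} [IsProbabilityMeasure P] {σ : ℝ}
  {ε : ∀ n : ℕ, Fin n → Ω → ℝ} {β₁ : ℕ → Fin m → ℝ} {est : ℕ → Ω → Fin m → ℝ}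

/-- The normalised error of each estimator is a linear form in the errors with second moment `c`
plus a function of `√n β̂₂`, which is independent of that linear form. -/
lemma hasADR (h : RegularDesign X₁ X₂ r S d) (hσ : 0 < σ) (hε : GaussianErrors P σ ε)
    {μ : ℕ → EuclideanSpace ℝ (Fin k)} {F : ℕ → EuclideanSpace ℝ (Fin k) → ℝ}
    (hF : ∀ n, Measurable (F n))
    (hF2 : ∀ᶠ n in atTop, Integrable (fun x => F n x ^ 2) (multivariateGaussian (μ n)
      (σ ^ 2 • (errorMatrix (X₁ n) (X₂ n) (r n) * (errorMatrix (X₁ n) (X₂ n) (r n))ᵀ))))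
    (hrep : ∀ᶠ n : ℕ in atTop, ∀ ω,
      √(n : ℝ) * (√(s1sq σ (sampleGram (X₁ n) (X₂ n)) (d n)))⁻¹ * (d n ⬝ᵥ (est n ω - β₁ n)) =
        ((√(s1sq σ (sampleGram (X₁ n) (X₂ n)) (d n)))⁻¹ • errorDirection (X₁ n) (d n)) ⬝ᵥ
          (ε n · ω) + F n (μ n + WithLp.toLp 2 (errorMatrix (X₁ n) (X₂ n) (r n) *ᵥ (ε n · ω))))
    {ℓ : ℝ} (hlim : Tendsto (fun n => cRatio (sampleGram (X₁ n) (X₂ n)) (d n) +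
      ∫ x, F n x ^ 2 ∂multivariateGaussian (μ n)
        (σ ^ 2 • (errorMatrix (X₁ n) (X₂ n) (r n) * (errorMatrix (X₁ n) (X₂ n) (r n))ᵀ)))
      atTop (𝓝 ℓ)) :
    HasADR P (fun n => s1sq σ (sampleGram (X₁ n) (X₂ n)) (d n)) d β₁ est ℓ := by
  have key : ∀ᶠ n : ℕ in atTop,
      Integrable (fun ω => (√(n : ℝ) * (√(s1sq σ (sampleGram (X₁ n) (X₂ n)) (d n)))⁻¹ *
        (d n ⬝ᵥ (est n ω - β₁ n))) ^ 2) P ∧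
      ∫ ω, (√(n : ℝ) * (√(s1sq σ (sampleGram (X₁ n) (X₂ n)) (d n)))⁻¹ *
        (d n ⬝ᵥ (est n ω - β₁ n))) ^ 2 ∂P = cRatio (sampleGram (X₁ n) (X₂ n)) (d n) +
      ∫ x, F n x ^ 2 ∂multivariateGaussian (μ n)
        (σ ^ 2 • (errorMatrix (X₁ n) (X₂ n) (r n) * (errorMatrix (X₁ n) (X₂ n) (r n))ᵀ)) := by
    filter_upwards [hF2, hrep, h.eventually_gram, eventually_gt_atTop 0] with n h1 h2 hp hn
    have hs := s1sq_pos hσ hp (h.ne_zero n)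
    have h3 := second_moment_split (hε n).1 (hε n).2
      (errorMatrix_mulVec hn hp (r n) (√(s1sq σ (sampleGram (X₁ n) (X₂ n)) (d n)))⁻¹ (d n))
      (μ n) (hF n) h1
    simp_rw [h2]
    refine ⟨h3.1, h3.2.trans ?_⟩
    congr 1
    change σ ^ 2 * _ = _
    rw [smul_dotProduct, dotProduct_smul, errorDirection_dot hn hp, cRatio_eq hσ, smul_eq_mul,
      smul_eq_mul, ← mul_assoc (_⁻¹), ← mul_inv, Real.mul_self_sqrt hs.le, div_eq_mul_inv]
    ring
  exact ⟨key.mono fun n hn => hn.1, hlim.congr' (key.mono fun n hn => hn.2.symm)⟩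

end RegularDesign

/-! ### Risks of the four estimators -/

namespace RegularDesign

variable {m k : ℕ} {l : ℕ → ℕ} {X₁ : ∀ n, Matrix (Fin n) (Fin m) ℝ}
  {X₂ : ∀ n, Matrix (Fin n) (Fin k) ℝ} {X₃ : ∀ n, Matrix (Fin n) (Fin (l n)) ℝ} {r : ℕ → ℝ}
  {S : Matrix (Fin m ⊕ Fin k) (Fin m ⊕ Fin k) ℝ} {d : ℕ → Fin m → ℝ}
  {Ω : Type*} [MeasurableSpace Ω] {P : Measure Ω} [IsProbabilityMeasure P] {σ : ℝ}
  {ε : ∀ n : ℕ, Fin n → Ω → ℝ} {y : ∀ n : ℕ, Ω → Fin n → ℝ} {β₁ : ℕ → Fin m → ℝ}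
  {δ : EuclideanSpace ℝ (Fin k)}

/-- The risk is the sum of the variances `c`, `1 - c` of the two independent parts; the bias of the
ridge estimator is asymptotically negligible. -/
lemma hasADR_estWR (h : RegularDesign X₁ X₂ r S d) (hσ : 0 < σ) (hε : GaussianErrors P σ ε)
    (hy : ∀ᶠ n : ℕ in atTop, ∀ ω,
      y n ω = response (X₁ n) (X₂ n) (X₃ n) (β₁ n) ((√(n : ℝ))⁻¹ • δ.ofLp) 0 (ε n · ω)) :
    HasADR P (fun n => s1sq σ (sampleGram (X₁ n) (X₂ n)) (d n)) d β₁
      (fun n ω => (estWR (X₁ n) (X₂ n) (r n) (y n ω)).1) 1 := by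
  set f : ℕ → Fin k → ℝ := fun n => scaledContrast σ (sampleGram (X₁ n) (X₂ n)) (d n) with hf
  set μ : ℕ → EuclideanSpace ℝ (Fin k) :=
    fun n => WithLp.toLp 2 (ridgeMean (X₁ n) (X₂ n) (r n) δ)
  have hm : ∀ᶠ n in atTop, _ := (h.eventually_cov hσ).mono fun n hn =>
    second_moment_multivariateGaussian hn.posSemidef (μ n) δ (f n)
  refine h.hasADR hσ hε (μ := μ) (F := fun n x => f n ⬝ᵥ (δ - x).ofLp)
    (fun n => Continuous.measurable (by fun_prop)) (hm.mono fun n hn => hn.1) ?_ ?_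
  · filter_upwards [h.eventually_gram, h.ridge_pos, eventually_gt_atTop 0, hy] with n hp hr hn hyn ω
    have h1 := sqrt_mul_shrink hn hp hr (X₃ n) (β₁ n) (d n) δ (ε n · ω) 0 (hyn ω)
    simp only [zero_smul, sub_zero, zero_mul, add_zero] at h1
    rw [mul_comm √(n : ℝ), mul_assoc, h1, mul_add, smul_dotProduct, smul_eq_mul]
    simp only [hf, scaledContrast, μ, smul_dotProduct, smul_eq_mul, WithLp.ofLp_sub, WithLp.ofLp_add]
  · obtain ⟨B, hB⟩ := exists_norm_scaledContrast_bound hσ h.posDef h.tendsto_gram h.eventually_gram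
      h.ne_zero
    have h1 := tendsto_dot_mulVec_sub (h.tendsto_cov σ)
      (tendsto_smul_inv_schur22 σ h.posDef h.tendsto_gram) hB
    have h2 : Tendsto (fun n => (f n ⬝ᵥ (δ - μ n).ofLp) ^ 2) atTop (𝓝 0) := by
      have h3 : Tendsto (fun n => (B * ‖δ - μ n‖) ^ 2) atTop (𝓝 0) := by
        have := ((((h.tendsto_ridgeMean δ).const_sub δ).norm).const_mul B).pow 2
        simpa using this
      refine squeeze_zero_norm' ?_ h3
      filter_upwards [hB] with n hn
      rw [norm_pow, Real.norm_eq_abs]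
      gcongr
      exact (abs_dot_le _ _).trans (by gcongr)
    have h3 := (h1.add h2).const_add 1
    rw [add_zero, add_zero] at h3
    refine h3.congr' ?_
    filter_upwards [hm, h.eventually_gram] with n hn hp
    rw [hn.2]
    linarith [scaledContrast_quad hσ hp (h.ne_zero n)]

lemma hasADR_estRE (h : RegularDesign X₁ X₂ r S d) (hσ : 0 < σ) (hε : GaussianErrors P σ ε)
    (hy : ∀ᶠ n : ℕ in atTop, ∀ ω,
      y n ω = response (X₁ n) (X₂ n) (X₃ n) (β₁ n) ((√(n : ℝ))⁻¹ • δ.ofLp) 0 (ε n · ω))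
    {c Δ : ℝ} (hc : Tendsto (fun n => cRatio (sampleGram (X₁ n) (X₂ n)) (d n)) atTop (𝓝 c))
    (hc1 : c ≤ 1)
    (hΔ : c < 1 → Tendsto (fun n => DeltaD σ (sampleGram (X₁ n) (X₂ n)) δ (d n)) atTop (𝓝 Δ)) :
    HasADR P (fun n => s1sq σ (sampleGram (X₁ n) (X₂ n)) (d n)) d β₁
      (fun n ω => estRE (X₁ n) (y n ω)) (1 - (1 - c) * (1 - Δ)) := by
  set f : ℕ → Fin k → ℝ := fun n => scaledContrast σ (sampleGram (X₁ n) (X₂ n)) (d n) with hf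
  refine h.hasADR hσ hε (μ := 0) (F := fun n _ => f n ⬝ᵥ δ.ofLp)
    (fun n => measurable_const) (.of_forall fun n => integrable_const _) ?_ ?_
  · filter_upwards [h.eventually_gram, eventually_gt_atTop 0, hy] with n hp hn hyn ω
    have h1 := sqrt_mul_estRE hn hp (X₃ n) (β₁ n) (d n) δ (ε n · ω)
    rw [← hyn ω] at h1
    rw [mul_comm √(n : ℝ), mul_assoc, h1, mul_add, smul_dotProduct, smul_eq_mul]
    simp [hf, scaledContrast, smul_dotProduct]
  · have h1 := tendsto_contrast_sub hσ h.posDef h.tendsto_gram h.eventually_gram h.ne_zero hc δ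
    have h2 : Tendsto (fun n => (1 - c) * DeltaD σ (sampleGram (X₁ n) (X₂ n)) δ (d n)) atTop
        (𝓝 ((1 - c) * Δ)) := by
      -- for `c = 1` the limit `Δ` is immaterial, `DeltaD` being multiplied by zero
      rcases hc1.lt_or_eq with hlt | rfl
      · exact (hΔ hlt).const_mul _
      · simp
    have h3 := hc.add (h2.sub h1)
    have h4 : c + ((1 - c) * Δ - 0) = 1 - (1 - c) * (1 - Δ) := by ring
    rw [h4] at h3
    refine h3.congr fun n => ?_
    simp [DeltaD, hf]

/-- Estimators that shrink by the factor `a / max T̂ b`: the case `b = 0` is the shrinkage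
estimator, the case `b = a` the positive shrinkage estimator. -/
lemma hasADR_shrink (h : RegularDesign X₁ X₂ r S d) (hσ : 0 < σ) (hε : GaussianErrors P σ ε)
    (hk : 3 ≤ k) (hy : ∀ᶠ n : ℕ in atTop, ∀ ω,
      y n ω = response (X₁ n) (X₂ n) (X₃ n) (β₁ n) ((√(n : ℝ))⁻¹ • δ.ofLp) 0 (ε n · ω))
    {c : ℝ} (hc : Tendsto (fun n => cRatio (sampleGram (X₁ n) (X₂ n)) (d n)) atTop (𝓝 c))
    {a b : ℝ} (ha : 0 ≤ a) (hb : 0 ≤ b) {t : ℕ → Ω → ℝ}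
    (ht : ∀ n ω, 0 < statT σ (X₁ n) (X₂ n) (r n) (y n ω) →
      t n ω = a / max (statT σ (X₁ n) (X₂ n) (r n) (y n ω)) b) {g : EuclideanSpace ℝ (Fin k) → ℝ}
    (hg : ∀ᵐ x, Tendsto (fun n => riskGain a b ((σ ^ 2)⁻¹ • schur22 S)
      (scaledContrast σ (sampleGram (X₁ n) (X₂ n)) (d n)) x) atTop (𝓝 (g x))) :
    Integrable (fun z => g (z + δ)) (multivariateGaussian 0 (σ ^ 2 • (schur22 S)⁻¹)) ∧
    HasADR P (fun n => s1sq σ (sampleGram (X₁ n) (X₂ n)) (d n)) d β₁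
      (fun n ω => (estWR (X₁ n) (X₂ n) (r n) (y n ω)).1 - t n ω •
        ((estWR (X₁ n) (X₂ n) (r n) (y n ω)).1 - estRE (X₁ n) (y n ω)))
      (1 - ∫ z, g (z + δ) ∂multivariateGaussian 0 (σ ^ 2 • (schur22 S)⁻¹)) := by
  set f : ℕ → Fin k → ℝ := fun n => scaledContrast σ (sampleGram (X₁ n) (X₂ n)) (d n) with hf
  set μ : ℕ → EuclideanSpace ℝ (Fin k) :=
    fun n => WithLp.toLp 2 (ridgeMean (X₁ n) (X₂ n) (r n) δ) with hμ
  set V : ℕ → Matrix (Fin k) (Fin k) ℝ := fun n => σ ^ 2 •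
    (errorMatrix (X₁ n) (X₂ n) (r n) * (errorMatrix (X₁ n) (X₂ n) (r n))ᵀ) with hV
  have hVp : ∀ᶠ n in atTop, (V n).PosDef := h.eventually_cov hσ
  have hS2 : (σ ^ 2 • (schur22 S)⁻¹).PosDef :=
    (posDef_schur22 h.posDef).inv.smul (by positivity : 0 < σ ^ 2)
  have hJ : Tendsto (fun n => (V n)⁻¹) atTop (𝓝 ((σ ^ 2)⁻¹ • schur22 S)) := by
    rw [← inv_smul_inv_schur22 hσ h.posDef]
    exact tendsto_inv_matrix hS2 (h.tendsto_cov σ)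
  obtain ⟨B, hB⟩ := exists_norm_scaledContrast_bound hσ h.posDef h.tendsto_gram h.eventually_gram
    h.ne_zero
  have hω := tendsto_scaledContrast_quad hσ h.posDef h.tendsto_gram h.eventually_gram
    h.ne_zero hc
  rw [← inv_smul_schur22 hσ h.posDef] at hω
  obtain ⟨r1, r2, r3⟩ := tendsto_shrink_risk hk (posDef_smul_schur22 hσ h.posDef)
    (tendsto_smul_schur22 σ h.posDef h.tendsto_gram) hJ (hVp.mono fun n hn => hn.inv)
    (h.tendsto_ridgeMean δ) hB ha hb hω hg
  rw [integral_shift_multivariateGaussian hS2, inv_smul_inv_schur22 hσ h.posDef]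
  rw [← inv_smul_inv_schur22 hσ h.posDef] at r2
  refine ⟨integrable_shift_multivariateGaussian hS2 r2, ?_⟩
  refine h.hasADR hσ hε (μ := μ) (F := fun n x => f n ⬝ᵥ (δ - x).ofLp +
      a / max (matQuad ((σ ^ 2)⁻¹ • schur22 (sampleGram (X₁ n) (X₂ n))) x) b * (f n ⬝ᵥ x.ofLp))
    (fun n => measurable_shrink _ _ _ _ _) ?_ ?_ ?_
  · filter_upwards [r1, hVp] with n h1 h2
    exact (integrable_multivariateGaussian_iff h2 _ _).2 h1
  · filter_upwards [h.eventually_gram, h.ridge_pos, eventually_gt_atTop 0, hy] with n hp hr hn hyn ω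
    have h1 := sqrt_mul_shrink hn hp hr (X₃ n) (β₁ n) (d n) δ (ε n · ω) (t n ω) (hyn ω)
    have h2 := statT_eq hn hp hr σ (X₃ n) (β₁ n) δ (ε n · ω) (hyn ω)
    set w : EuclideanSpace ℝ (Fin k) :=
      μ n + WithLp.toLp 2 (errorMatrix (X₁ n) (X₂ n) (r n) *ᵥ (ε n · ω)) with hw
    have hw' : ridgeMean (X₁ n) (X₂ n) (r n) δ + errorMatrix (X₁ n) (X₂ n) (r n) *ᵥ (ε n · ω) =
        w.ofLp := rfl
    rw [hw'] at h1 h2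
    rw [quadForm_eq_matQuad] at h2
    have h3 : t n ω * (d2 (sampleGram (X₁ n) (X₂ n)) (d n) ⬝ᵥ w.ofLp) =
        a / max (matQuad ((σ ^ 2)⁻¹ • schur22 (sampleGram (X₁ n) (X₂ n))) w) b *
          (d2 (sampleGram (X₁ n) (X₂ n)) (d n) ⬝ᵥ w.ofLp) := by
      -- the factor is irrelevant where `√n β̂₂` vanishes
      rcases eq_or_ne w.ofLp 0 with h4 | h4
      · rw [h4]; simp
      · have h5 := (posDef_smul_schur22 hσ hp).dotProduct_mulVec_pos h4
        rw [star_trivial] at h5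
        rw [ht n ω (h2 ▸ h5), h2]
    rw [h3] at h1
    rw [mul_comm √(n : ℝ), mul_assoc, h1, smul_dotProduct, smul_eq_mul]
    simp only [hf, scaledContrast, smul_dotProduct, smul_eq_mul, WithLp.ofLp_sub]
    ring
  · have h1 := hc.add r3
    rw [← add_sub_assoc, add_sub_cancel] at h1
    refine h1.congr' ?_
    filter_upwards [hVp] with n hn
    rw [integral_multivariateGaussian hn]

end RegularDesign

end ShrinkageRisk

open ShrinkageRisk in
theorem theorem3
    {Ω : Type*} [MeasurableSpace Ω] (P : Measure Ω) [IsProbabilityMeasure P]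
    -- block sizes `p₁`, `p₂`, `p₃ₙ`, the total dimension `pₙ`, design and coefficients
    (p₁ p₂ : ℕ) (p₃ p : ℕ → ℕ) (hp : ∀ n, p n = p₁ + p₂ + p₃ n)
    (X₁ : ∀ n, Matrix (Fin n) (Fin p₁) ℝ) (X₂ : ∀ n, Matrix (Fin n) (Fin p₂) ℝ)
    (X₃ : ∀ n, Matrix (Fin n) (Fin (p₃ n)) ℝ)
    (β₁ : ℕ → Fin p₁ → ℝ) (β₂ : ℕ → Fin p₂ → ℝ) (β₃ : ∀ n, Fin (p₃ n) → ℝ)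
    -- responses of the linear model with Gaussian errors
    (σ : ℝ) (hσ : 0 < σ) (ε : ∀ n : ℕ, Fin n → Ω → ℝ) (hε : GaussianErrors P σ ε)
    (y : ∀ n : ℕ, Ω → Fin n → ℝ)
    (hy : ∀ n ω, y n ω =
      response (X₁ n) (X₂ n) (X₃ n) (β₁ n) (β₂ n) (β₃ n) (fun i => ε n i ω))
    -- signal strengths
    (δ : EuclideanSpace ℝ (Fin p₂))
    (hS₁ : StrongSignals p β₁) (hS₂ : LocalSignals δ β₂) (hS₃ : NoSignals p₃ β₃)
    -- rates
    (τ η ν α c₁ c₂ : ℝ) (hτ : 0 < τ) (hτ' : τ < 1 / 2) (hτη : τ < η) (hη : η ≤ 1)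
    (hν : 0 < ν) (hν' : ν < 1) (hα : 0 < α) (hα' : α < min ((η - ν - τ) / 3) (1 / 4 - τ / 2))
    (hc₁ : 0 < c₁) (hc₂ : 0 < c₂)
    (hB2 : PositiveEigenvaluesGrow (fun n => redundantGram (X₁ n) (X₂ n) (X₃ n)) η)
    (hB3 : (fun n : ℕ => Real.log (p n)) =O[atTop] fun n : ℕ => (n : ℝ) ^ ν)
    -- `Σₙ = n⁻¹ (X₁, X₂)'(X₁, X₂)` converges to a positive definite matrix
    (Sn : ℕ → Matrix (Fin p₁ ⊕ Fin p₂) (Fin p₁ ⊕ Fin p₂) ℝ)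
    (hSn : ∀ n, Sn n = sampleGram (X₁ n) (X₂ n))
    (S : Matrix (Fin p₁ ⊕ Fin p₂) (Fin p₁ ⊕ Fin p₂) ℝ) (hS : S.PosDef)
    (hB4 : Tendsto Sn atTop (𝓝 S))
    -- the ridge parameter and the linear combination
    (r : ℕ → ℝ) (hr : ∀ n, r n = ridgeParam c₁ c₂ α p n)
    (d : ℕ → Fin p₁ → ℝ) (hd : ∀ n, 0 < ‖WithLp.toLp 2 (d n)‖ ∧ ‖WithLp.toLp 2 (d n)‖ ≤ 1) :
    HasADR P (fun n => s1sq σ (Sn n) (d n)) d β₁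
      (fun n ω => (estWR (X₁ n) (X₂ n) (r n) (y n ω)).1) 1 ∧
    ∀ c : ℝ, Tendsto (fun n => cRatio (Sn n) (d n)) atTop (𝓝 c) →
      c ≤ 1 ∧
      (∀ Δ : ℝ, (c < 1 → Tendsto (fun n => DeltaD σ (Sn n) δ (d n)) atTop (𝓝 Δ)) →
        HasADR P (fun n => s1sq σ (Sn n) (d n)) d β₁
          (fun n ω => estRE (X₁ n) (y n ω)) (1 - (1 - c) * (1 - Δ))) ∧
      (2 < p₂ → ∀ g₁ : EuclideanSpace ℝ (Fin p₂) → ℝ,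
        (∀ᵐ x : EuclideanSpace ℝ (Fin p₂),
          Tendsto (fun n => g1Pre σ c (Sn n) (d n) x) atTop (𝓝 (g₁ x))) →
        Integrable (fun z => g₁ (z + δ)) (multivariateGaussian 0 (σ ^ 2 • (schur22 S)⁻¹)) ∧
        HasADR P (fun n => s1sq σ (Sn n) (d n)) d β₁
          (fun n ω => estSE σ (X₁ n) (X₂ n) (r n) (y n ω))
          (1 - ∫ z, g₁ (z + δ) ∂multivariateGaussian 0 (σ ^ 2 • (schur22 S)⁻¹))) ∧
      (2 < p₂ → ∀ g₂ : EuclideanSpace ℝ (Fin p₂) → ℝ,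
        (∀ᵐ x : EuclideanSpace ℝ (Fin p₂),
          Tendsto (fun n => g2Pre σ c (Sn n) (d n) x) atTop (𝓝 (g₂ x))) →
        Integrable (fun z => g₂ (z + δ)) (multivariateGaussian 0 (σ ^ 2 • (schur22 S)⁻¹)) ∧
        HasADR P (fun n => s1sq σ (Sn n) (d n)) d β₁
          (fun n ω => estPSE σ (X₁ n) (X₂ n) (r n) (y n ω))
          (1 - ∫ z, g₂ (z + δ) ∂multivariateGaussian 0 (σ ^ 2 • (schur22 S)⁻¹))) := by
  obtain rfl : Sn = fun n => sampleGram (X₁ n) (X₂ n) := funext hSn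
  obtain rfl : r = ridgeParam c₁ c₂ α p := funext hr
  have h : RegularDesign X₁ X₂ (ridgeParam c₁ c₂ α p) S d :=
    { posDef := hS
      tendsto_gram := hB4
      ridge_pos := eventually_ridgeParam_pos α p hc₁ hc₂
      ridge_div := by
        refine tendsto_ridgeParam_div hα hν ?_ hB3
        have := (lt_min_iff.1 hα').1
        linarith
      ne_zero := fun n h0 => by simpa [h0] using (hd n).1 }
  have hyr : ∀ᶠ n : ℕ in atTop, ∀ ω, y n ω =
      response (X₁ n) (X₂ n) (X₃ n) (β₁ n) ((√(n : ℝ))⁻¹ • δ.ofLp) 0 (ε n · ω) := by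
    filter_upwards [hS₂.2, hS₃] with n h2 h3 ω
    have e2 : β₂ n = (√(n : ℝ))⁻¹ • δ.ofLp := by
      ext j
      rw [h2 j, Pi.smul_apply, smul_eq_mul, inv_mul_eq_div]
    have e3 : β₃ n = 0 := funext h3
    rw [hy n ω, e2, e3]
  refine ⟨h.hasADR_estWR hσ hε hyr, fun c hc => ?_⟩
  have hc1 : c ≤ 1 := le_of_tendsto hc <| h.eventually_gram.mono fun n hn =>
    cRatio_le_one hn (h.ne_zero n)
  refine ⟨hc1, fun Δ hΔ => h.hasADR_estRE hσ hε hyr hc hc1 hΔ, fun hk g hg => ?_,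
    fun hk g hg => ?_⟩
  · have hk' : (0 : ℝ) < (p₂ : ℝ) - 2 := by
      rw [sub_pos]; exact_mod_cast hk
    refine h.hasADR_shrink hσ hε hk hyr hc hk'.le le_rfl (fun n ω hT => ?_) ?_
    · rw [max_eq_left hT.le]
    · filter_upwards [hg, ae_ne_zero hk] with x hx hx0
      exact tendsto_riskGain_of_lt hσ hS hB4 h.eventually_gram h.ne_zero hc le_rfl
        ((posDef_smul_schur22 hσ hS).dotProduct_mulVec_pos (by simpa using hx0)) hx
  · have hk' : (0 : ℝ) < (p₂ : ℝ) - 2 := by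
      rw [sub_pos]; exact_mod_cast hk
    refine h.hasADR_shrink hσ hε hk hyr hc hk'.le hk'.le (fun n ω hT => ?_) ?_
    · rcases le_total (statT σ (X₁ n) (X₂ n) (ridgeParam c₁ c₂ α p n) (y n ω)) ((p₂ : ℝ) - 2)
        with h0 | h0
      · rw [max_eq_right h0, min_eq_right ((one_le_div hT).2 h0), div_self hk'.ne']
      · rw [max_eq_left h0, min_eq_left ((div_le_one hT).2 h0)]
    · filter_upwards [hg, ae_matQuad_ne hk (posDef_smul_schur22 hσ hS) ((p₂ : ℝ) - 2)] with x hx hx0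
      exact tendsto_riskGain_g2 hσ hS hB4 h.eventually_gram h.ne_zero hc hk' hx0 hx
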